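/- **Setting.** For $n$ bosonic modes with $[q_j,p_k]=i\delta_{jk}$ and $v=(v_q,v_p)\in\mathbb R^{2n}$ let $W(v)=\exp\!\big(i\sqrt{2\pi}\,(v_p\cdot q-v_q\cdot p)\big)$, and let $\mathcal N(\mu,\Sigma,v)=\exp\!\big(-\pi(v-\mu)^T\Sigma^{-1}(v-\mu)\big)/\sqrt{|\det\Sigma|}$, so that $\Sigma$ is the covariance matrix of $\sqrt{2\pi}\,v$. An ideal GKP codestate is a nonzero generalised ket (a continuous antilinear functional on Schwartz space) fixed by the displacements $W(v_1),\dots,W(v_{2n})$ for a basis $v_1,\dots,v_{2n}$ of $\mathbb R^{2n}$ with integral symplectic products. Consider a circuit in which one data mode in an ideal GKP codestate $|\bar\psi\rangle_D$ and $N\ge 0$ ancilla modes in an ideal GKP codestate $|\bar\varphi\rangle_A$ undergo independent Gaussian displacement noise $\rho\mapsto\int \mathcal N(0,\Delta^2\,\mathrm{Id},v)\,W(v)\rho W(v)^\dagger dv$, $\Delta>0$; then a Gaussian unitary $U_S$ with $U_S^\dagger\zeta U_S=S\zeta$, $\zeta=(q_1,\dots,q_{N+1},p_1,\dots,p_{N+1})^T$,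 $S$ real symplectic, is applied, the positions of all ancillas are measured by ideal homodyne detection, and, given the outcome $m$, a correction displacement $W(D(m))^\dagger$ chosen by an arbitrary decoder $D$ is applied to the data mode. The circuit is a syndrome extraction circuit in the following sense: without noise it leaves the data codestate intact up to a displacement that depends on the outcome, i.e. $U_S(|\bar\psi\rangle_D\otimes|\bar\varphi\rangle_A)=\sum_{\ell\in L}c_\ell\,W(d_\ell)|\bar\psi\rangle_D\otimes|\ell\rangle_q$ for a nonempty uniformly discrete set $L\subset\mathbb R^N$, nonzero amplitudes $c_\ell$ and displacements $d_\ell\in\mathbb R^2$. Post-measurement states are understood up to a positive factor, as limits of projections of the ancillas onto ever narrower wave packets around $m$. **Theorem.** (1) For every $N$ and every real symplectic $S$ there is a positive definite real $2\times2$ matrix $\Sigma'$ with $\det\Sigma'=1$ such that for every syndrome extraction circuit as above with matrix $S$, every $\Delta>0$, every decoder $D$ and every outcome $m$: up to normalisation the final state of the data mode is $$\int \mathcal X(v)\,W(v)|\bar\psi\rangle\langle\bar\psi|_D W(v)^\dagger\,dv,\qquad \mathcal X(v)=\sum_i p_i\,\mathcal N(\mu_i,\Delta^2\Sigma',v),$$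 with (at most countably many) weights $p_i>0$, $\sum_ip_i=1$, and means $\mu_i\in\mathbb R^2$, where $\mathcal X$ has finite second moments. Moreover, for every such representation with finite second moments, the covariance matrix $C=2\pi\,\mathbb E\big[(v-\mathbb E v)(v-\mathbb E v)^T\big]$ of $\sqrt{2\pi}\,v$, $v\sim\mathcal X$, satisfies $$\det C\ \ge\ \Delta^4 ,\qquad\text{and hence}\qquad \Delta_q\Delta_p\ \ge\ \Delta^2\quad\text{for }\Delta_q=\sqrt{C_{qq}},\ \Delta_p=\sqrt{C_{pp}}.$$ (2) The biased $q$-Steane circuits attain this trade-off. For every $\lambda>0$ and $(\alpha,\beta)\ne(0,0)$ there is a syndrome extraction circuit as above with one ancilla, data state $\alpha|\bar0\rangle+\beta|\bar1\rangle$ of the square GKP code, ancilla state $|\bar0\rangle^{\lambda}+|\bar1\rangle^{\lambda}$ of the rectangular GKP code (where $|\bar 0\rangle^\lambda=\sum_n|2n\sqrt{\lambda\pi}\rangle_q$, $|\bar 1\rangle^\lambda=\sum_n|(2n+1)\sqrt{\lambda\pi}\rangle_q$) and $U_S=e^{-iq_1p_2}\,\mathrm{Sq}_2(\sqrt\lambda)$,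 i.e. $(U_Sf)(x,y)=\lambda^{1/4}f\big(x,\sqrt\lambda\,(y-x)\big)$, such that for all $\Delta>0$, all decoders and all outcomes, (1) holds with common covariance $\Delta^2\Sigma'=\mathrm{diag}(\Delta_q^2,\Delta_p^2)$, where $\Delta_q=\Delta/\sqrt{1+\lambda}$ and $\Delta_p=\sqrt{1+\lambda}\,\Delta$, so that $\Delta_q\Delta_p=\Delta^2$. -/

import Mathlib

open Real Set Filter Topology MeasureTheory ProbabilityTheory
open scoped SchwartzMap ComplexConjugate LineDeriv ContDiff Matrix

noncomputable section

namespace GKPNoGo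

/-! ### Phase space, wave functions and displacement operators -/

/-- Configuration space of a system of bosonic modes labelled by `ι`. -/
abbrev Conf (ι : Type) [Fintype ι] : Type := EuclideanSpace ℝ ι

/-- Phase space of the modes `ι`: a vector `v` has the position components `v (Sum.inl j)` and the
momentum components `v (Sum.inr j)`. -/
abbrev Phase (ι : Type) : Type := ι ⊕ ι → ℝ

/-- Schwartz wave functions: the common dense domain of all quadrature operators. -/
abbrev Wave (ι : Type) [Fintype ι] : Type := 𝓢(Conf ι, ℂ)

/-- Generalised (not necessarily normalisable) kets: continuous antilinear functionals
`f ↦ ⟨f|ψ⟩` on Schwartz space. -/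
abbrev Ket (ι : Type) [Fintype ι] : Type := Wave ι →L⋆[ℂ] ℂ

/-- Generalised (not necessarily trace-class) operators, given by their matrix elements
`ρ f g = ⟨f|ρ|g⟩` between Schwartz wave functions. -/
abbrev Op (ι : Type) [Fintype ι] : Type := Wave ι → Wave ι → ℂ

variable {ι : Type} [Fintype ι]

/-- The position part of a phase-space vector. -/
def posPart (v : Phase ι) : Conf ι := WithLp.toLp 2 fun j => v (Sum.inl j)

/-- The momentum part of a phase-space vector. -/
def momPart (v : Phase ι) : Conf ι := WithLp.toLp 2 fun j => v (Sum.inr j)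

/-- The symplectic product `∑ⱼ (u_{q,j} v_{p,j} - u_{p,j} v_{q,j})`. -/
def symplecticProduct (u v : Phase ι) : ℝ :=
  ∑ j, (u (Sum.inl j) * v (Sum.inr j) - u (Sum.inr j) * v (Sum.inl j))

/-- The exponent (divided by `i`) of the phase in the action of a displacement operator. -/
def displacePhase (v : Phase ι) (x : Conf ι) : ℝ :=
  √(2 * π) * inner ℝ (momPart v) x - π * inner ℝ (posPart v) (momPart v)

theorem hasTemperateGrowth_cis :
    Function.HasTemperateGrowth (fun t : ℝ => Complex.exp (t * Complex.I)) := by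
  have h1 : ContDiff ℝ ∞ (fun t : ℝ => Complex.exp (t * Complex.I)) :=
    (Complex.ofRealCLM.contDiff.mul contDiff_const).cexp
  refine ⟨h1, fun n => ⟨0, 1, fun t => ?_⟩⟩
  have h2 : ∀ n : ℕ, iteratedDeriv n (fun t : ℝ => Complex.exp (t * Complex.I))
      = fun t : ℝ => Complex.I ^ n * Complex.exp (t * Complex.I) := by
    intro n
    induction n with
    | zero => simp
    | succ n ih =>
      rw [iteratedDeriv_succ, ih]
      funext t
      have h3 : HasDerivAt (fun t : ℝ => Complex.exp (t * Complex.I))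
          (Complex.exp (t * Complex.I) * (1 * Complex.I)) t :=
        ((Complex.ofRealCLM.hasDerivAt (x := t)).mul_const Complex.I).cexp
      rw [(h3.const_mul (Complex.I ^ n)).deriv]
      ring
  rw [norm_iteratedFDeriv_eq_norm_iteratedDeriv, h2]
  simp [Complex.norm_exp_ofReal_mul_I]

theorem hasTemperateGrowth_displacePhase (v : Phase ι) :
    Function.HasTemperateGrowth
      (fun x : Conf ι => Complex.exp (displacePhase v x * Complex.I)) := by
  refine hasTemperateGrowth_cis.comp (f := displacePhase v) ?_
  have h : Function.HasTemperateGrowth (fun x : Conf ι => inner ℝ (momPart v) x) :=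
    Function.hasTemperateGrowth_inner_right _
  exact ((Function.HasTemperateGrowth.const _).mul h).sub (Function.HasTemperateGrowth.const _)

/-- The displacement operator `W(v) = exp(i√(2π) (v_p · q - v_q · p))` on wave functions. In the
position representation, with `q` multiplication by `x` and `p = -i∇`,
`(W(v) f)(x) = exp(i√(2π) v_p · x - iπ v_q · v_p) f(x - √(2π) v_q)`. -/
def displace (v : Phase ι) : Wave ι →L[ℂ] Wave ι :=
  (SchwartzMap.smulLeftCLM ℂ fun x : Conf ι => Complex.exp (displacePhase v x * Complex.I)) ∘L
    SchwartzMap.compSubConstCLM ℂ (√(2 * π) • posPart v)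

theorem displace_apply (v : Phase ι) (f : Wave ι) (x : Conf ι) :
    displace v f x =
      Complex.exp (displacePhase v x * Complex.I) * f (x - √(2 * π) • posPart v) := by
  simp [displace, SchwartzMap.smulLeftCLM_apply_apply (hasTemperateGrowth_displacePhase v)]

/-! ### Quadratures and Gaussian unitaries -/

/-- The position operator of mode `j`. -/
def positionOp (j : ι) : Wave ι →L[ℂ] Wave ι :=
  SchwartzMap.smulLeftCLM ℂ fun x : Conf ι => (x j : ℂ)

theorem positionOp_apply (j : ι) (f : Wave ι) (x : Conf ι) :
    positionOp j f x = x j * f x := by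
  have h : Function.HasTemperateGrowth (fun x : Conf ι => (x j : ℂ)) :=
    (Complex.ofRealCLM ∘L (EuclideanSpace.proj j : Conf ι →L[ℝ] ℝ)).hasTemperateGrowth
  simp [positionOp, SchwartzMap.smulLeftCLM_apply_apply h]

/-- The momentum operator `-i ∂ⱼ` of mode `j`. -/
def momentumOp [DecidableEq ι] (j : ι) : Wave ι →L[ℂ] Wave ι :=
  (-Complex.I) • LineDeriv.lineDerivOpCLM ℂ (Wave ι) (EuclideanSpace.single j (1 : ℝ) : Conf ι)

theorem momentumOp_apply [DecidableEq ι] (j : ι) (f : Wave ι) (x : Conf ι) :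
    momentumOp j f x = -Complex.I * lineDeriv ℝ f x (EuclideanSpace.single j (1 : ℝ)) := by
  simp [momentumOp, SchwartzMap.lineDerivOp_apply]

/-- The quadrature vector `ζ = (q₁, …, q_n, p₁, …, p_n)`. -/
def quadrature [DecidableEq ι] : ι ⊕ ι → (Wave ι →L[ℂ] Wave ι) := Sum.elim positionOp momentumOp

/-- `U` is a Gaussian unitary with matrix `S`: it preserves the `L²` inner product and
`U† ζ U = S ζ`, which is written here as `ζ U = U S ζ`. -/
structure IsGaussianUnitary [DecidableEq ι] (U : Wave ι ≃L[ℂ] Wave ι) (S : Matrix (ι ⊕ ι) (ι ⊕ ι) ℝ) : Prop where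
  inner_eq : ∀ f g : Wave ι, ∫ x, conj (U f x) * U g x = ∫ x, conj (f x) * g x
  conj_quadrature : ∀ (a : ι ⊕ ι) (f : Wave ι),
    quadrature a (U f) = U (∑ b, (S a b : ℂ) • quadrature b f)



/-! ### Ideal GKP states -/

/-- `ψ` is an ideal GKP codestate on the modes `ι`: a nonzero generalised ket fixed by the
displacements along a basis of phase space that generates a symplectically integral lattice (the
stabiliser lattice). The condition `W(v)|ψ⟩ = |ψ⟩` is `⟨W(v)† f|ψ⟩ = ⟨f|ψ⟩`, where
`W(v)† = W(-v)`. -/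
def IsGKPState (ψ : Ket ι) : Prop :=
  ψ ≠ 0 ∧ ∃ v : ι ⊕ ι → Phase ι, LinearIndependent ℝ v ∧
    (∀ a b, ∃ n : ℤ, symplecticProduct (v a) (v b) = n) ∧
    ∀ a f, ψ (displace (-v a) f) = ψ f

/-- The configuration `x` of a single mode. -/
def point (x : ℝ) : Conf (Fin 1) := WithLp.toLp 2 fun _ => x

/-- `ψ` is the ideal one-mode rectangular GKP codestate
`α|0̄⟩ + β|1̄⟩ = α ∑ₙ |2n√(λπ)⟩_q + β ∑ₙ |(2n+1)√(λπ)⟩_q` of aspect ratio `lam`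
(the square code for `lam = 1`). -/
def IsRectangularState (lam : ℝ) (α β : ℂ) (ψ : Ket (Fin 1)) : Prop :=
  ∀ f : Wave (Fin 1),
    HasSum (fun n : ℤ => (if Even n then α else β) * conj (f (point (n * √(lam * π))))) (ψ f)

/-! ### Tensor products -/

/-- The configuration of the modes selected by `e`. -/
def restrictModes {κ : Type} [Fintype κ] (e : κ → ι) : Conf ι →L[ℝ] Conf κ :=
  ((EuclideanSpace.equiv κ ℝ).symm : (κ → ℝ) →L[ℝ] Conf κ) ∘L
    ContinuousLinearMap.pi fun j => (EuclideanSpace.proj (e j) : Conf ι →L[ℝ] ℝ)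

variable {κ : Type} [Fintype κ]

theorem norm_le_restrictModes (x : Conf (ι ⊕ κ)) :
    ‖x‖ ≤ ‖restrictModes Sum.inl x‖ + ‖restrictModes Sum.inr x‖ := by
  have h : ‖x‖ ^ 2 = ‖restrictModes Sum.inl x‖ ^ 2 + ‖restrictModes Sum.inr x‖ ^ 2 := by
    simp [EuclideanSpace.norm_sq_eq, Fintype.sum_sum_type, restrictModes]
  have h1 := norm_nonneg (restrictModes (ι := ι ⊕ κ) Sum.inl x)
  have h2 := norm_nonneg (restrictModes (ι := ι ⊕ κ) Sum.inr x)
  nlinarith [norm_nonneg x]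

/-- A Schwartz function of some of the modes and its derivatives, seen on all modes. -/
theorem iteratedFDeriv_comp_restrict_le (e : κ → ι) (f : Wave κ) :
    ∃ M : ℝ, 0 ≤ M ∧ ∀ (n : ℕ) (x : Conf ι),
      ‖iteratedFDeriv ℝ n (fun y => f (restrictModes e y)) x‖
        ≤ ‖iteratedFDeriv ℝ n f (restrictModes e x)‖ * M ^ n := by
  refine ⟨‖restrictModes (ι := ι) e‖, norm_nonneg _, fun n x => ?_⟩
  have h := (restrictModes (ι := ι) e).iteratedFDeriv_comp_right (f := f) (f.smooth ⊤) x
    (i := n) (by exact_mod_cast le_top)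
  have h2 : (fun y => f (restrictModes e y)) = f ∘ (restrictModes (ι := ι) e) := rfl
  rw [h2, h]
  refine (ContinuousMultilinearMap.norm_compContinuousLinearMap_le _ _).trans ?_
  simp

theorem contDiff_comp_restrict (e : κ → ι) (f : Wave κ) :
    ContDiff ℝ ∞ (fun y : Conf ι => f (restrictModes e y)) :=
  (f.smooth ⊤).comp (restrictModes e).contDiff

theorem tensor_decay (f : Wave ι) (g : Wave κ) (k n : ℕ) :
    ∃ C : ℝ, ∀ x : Conf (ι ⊕ κ), ‖x‖ ^ k * ‖iteratedFDeriv ℝ n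
      (fun y => f (restrictModes Sum.inl y) * g (restrictModes Sum.inr y)) x‖ ≤ C := by
  obtain ⟨M, hM, hf⟩ := iteratedFDeriv_comp_restrict_le (ι := ι ⊕ κ) Sum.inl f
  obtain ⟨M', hM', hg⟩ := iteratedFDeriv_comp_restrict_le (ι := ι ⊕ κ) Sum.inr g
  choose A hA using fun k n => f.decay k n
  choose B hB using fun k n => g.decay k n
  refine ⟨∑ i ∈ Finset.range (n + 1), (n.choose i : ℝ) * (2 ^ k * (M ^ i * M' ^ (n - i) *
    (A k i * B 0 (n - i) + A 0 i * B k (n - i)))), fun x => ?_⟩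
  have h1 := norm_iteratedFDeriv_mul_le (𝕜 := ℝ) (N := ∞)
    (f := fun y : Conf (ι ⊕ κ) => f (restrictModes Sum.inl y))
    (g := fun y : Conf (ι ⊕ κ) => g (restrictModes Sum.inr y))
    (contDiff_comp_restrict Sum.inl f) (contDiff_comp_restrict Sum.inr g) x (n := n)
    (by exact_mod_cast le_top)
  refine (mul_le_mul_of_nonneg_left h1 (by positivity)).trans ?_
  rw [Finset.mul_sum]
  refine Finset.sum_le_sum fun i _ => ?_
  set a := restrictModes (ι := ι ⊕ κ) Sum.inl x
  set b := restrictModes (ι := ι ⊕ κ) Sum.inr x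
  set P := ‖iteratedFDeriv ℝ i f a‖
  set Q := ‖iteratedFDeriv ℝ (n - i) g b‖
  have hx : ‖x‖ ^ k ≤ 2 ^ k * (‖a‖ ^ k + ‖b‖ ^ k) := by
    have h2 : ‖x‖ ≤ 2 * max ‖a‖ ‖b‖ := by
      have := norm_le_restrictModes x
      have := le_max_left ‖a‖ ‖b‖
      have := le_max_right ‖a‖ ‖b‖
      linarith
    calc ‖x‖ ^ k ≤ (2 * max ‖a‖ ‖b‖) ^ k := by gcongr
      _ = 2 ^ k * (max ‖a‖ ‖b‖) ^ k := mul_pow _ _ _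
      _ ≤ 2 ^ k * (‖a‖ ^ k + ‖b‖ ^ k) := by
        gcongr
        rcases max_cases ‖a‖ ‖b‖ with h | h <;> rw [h.1]
        · exact le_add_of_nonneg_right (by positivity)
        · exact le_add_of_nonneg_left (by positivity)
  have e1 : ‖a‖ ^ k * P * Q ≤ A k i * B 0 (n - i) := by
    have := (hB 0 (n - i)).2 b
    rw [pow_zero, one_mul] at this
    exact mul_le_mul ((hA k i).2 a) this (norm_nonneg _)
      (le_trans (by positivity) ((hA k i).2 a))
  have e2 : P * (‖b‖ ^ k * Q) ≤ A 0 i * B k (n - i) := by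
    have := (hA 0 i).2 a
    rw [pow_zero, one_mul] at this
    exact mul_le_mul this ((hB k (n - i)).2 b) (by positivity) (le_trans (norm_nonneg _) this)
  calc ‖x‖ ^ k * ((n.choose i : ℝ) *
        ‖iteratedFDeriv ℝ i (fun y : Conf (ι ⊕ κ) => f (restrictModes Sum.inl y)) x‖ *
        ‖iteratedFDeriv ℝ (n - i) (fun y : Conf (ι ⊕ κ) => g (restrictModes Sum.inr y)) x‖)
      ≤ (2 ^ k * (‖a‖ ^ k + ‖b‖ ^ k)) * ((n.choose i : ℝ) * (P * M ^ i) *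
        (Q * M' ^ (n - i))) := by
        gcongr
        · exact hf i x
        · exact hg (n - i) x
    _ = (n.choose i : ℝ) * (2 ^ k * (M ^ i * M' ^ (n - i) *
        (‖a‖ ^ k * P * Q + P * (‖b‖ ^ k * Q)))) := by ring
    _ ≤ _ := by gcongr


/-- The product wave function `(f ⊗ g)(x, y) = f(x) g(y)`. -/
def tensor (f : Wave ι) (g : Wave κ) : Wave (ι ⊕ κ) where
  toFun x := f (restrictModes Sum.inl x) * g (restrictModes Sum.inr x)
  smooth' := (contDiff_comp_restrict Sum.inl f).mul (contDiff_comp_restrict Sum.inr g)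
  decay' := tensor_decay f g

theorem tensor_apply (f : Wave ι) (g : Wave κ) (x : Conf (ι ⊕ κ)) :
    tensor f g x = f (restrictModes Sum.inl x) * g (restrictModes Sum.inr x) := rfl

/-! ### Gaussian noise -/

/-- The normal density `𝒩(μ, Σ, v) = exp(-π (v - μ)ᵀ Σ⁻¹ (v - μ)) / √|det Σ|`; in this convention
`Σ` is the covariance matrix of `√(2π) v`. -/
def gaussianDensity [DecidableEq ι] (μ : Phase ι) (Sig : Matrix (ι ⊕ ι) (ι ⊕ ι) ℝ) (v : Phase ι) : ℝ :=
  Real.exp (-π * ((v - μ) ⬝ᵥ (Sig⁻¹ *ᵥ (v - μ)))) / √|Sig.det|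

/-- The operator `|ψ⟩⟨ψ|`. -/
def pureState (ψ : Ket ι) : Op ι := fun f g => ψ f * conj (ψ g)

/-- Conjugation `W(v) ρ W(v)†` by a displacement. -/
def conjDisplace (v : Phase ι) (ρ : Op ι) : Op ι := fun f g =>
  ρ (displace (-v) f) (displace (-v) g)

/-- The random displacement `∫ X(v) W(v) ρ W(v)† dv` with density `X`. -/
def randomDisplacement (X : Phase ι → ℝ) (ρ : Op ι) : Op ι := fun f g =>
  ∫ v, (X v : ℂ) * conjDisplace v ρ f g

/-- Conjugation `U ρ U†` by a unitary. -/
def evolve (U : Wave ι ≃L[ℂ] Wave ι) (ρ : Op ι) : Op ι := fun f g =>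
  ρ (U.symm f) (U.symm g)

/-! ### Homodyne measurement -/

/-- The wave packet `x ↦ k((x - m)/ε)` of width `ε` around `m` (zero for `ε = 0`). -/
def wavePacket (k : Wave κ) (m : Conf κ) (ε : ℝ) : Wave κ :=
  if h : ε = 0 then 0 else
    SchwartzMap.compSubConstCLM ℂ m
      (SchwartzMap.compCLMOfContinuousLinearEquiv ℂ
        (ContinuousLinearEquiv.smulLeft (Units.mk0 ε⁻¹ (inv_ne_zero h))) k)

theorem wavePacket_apply (k : Wave κ) (m : Conf κ) {ε : ℝ} (h : ε ≠ 0) (x : Conf κ) :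
    wavePacket k m ε x = k (ε⁻¹ • (x - m)) := by
  simp [wavePacket, h, Units.smul_def]

/-- `σ` is a (not necessarily normalised) state of the modes `ι` after an ideal homodyne measurement
of all positions of the modes `κ` of `ρ` with outcome `m`. The modes `κ` are projected onto
the position eigenket `|m⟩_q`, as the limit of sharper and sharper nonnegative wave packets around
`m`; since position eigenkets are not normalisable, the limit is taken up to positive factors, and
`σ` is determined up to a positive factor. -/
def IsHomodyneState (ρ : Op (ι ⊕ κ)) (m : Conf κ) (σ : Op ι) : Prop :=
  σ ≠ 0 ∧ ∀ k : Wave κ, k ≠ 0 → HasCompactSupport k → (∀ x, (k x).im = 0 ∧ 0 ≤ (k x).re) →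
    ∃ a : ℝ → ℝ, (∀ ε, 0 < ε → 0 < a ε) ∧ ∀ f g : Wave ι,
      Tendsto (fun ε => (a ε : ℂ) * ρ (tensor f (wavePacket k m ε)) (tensor g (wavePacket k m ε)))
        (𝓝[>] 0) (𝓝 (σ f g))

/-! ### Syndrome extraction circuits -/

/-- The modes of a circuit: one data mode and `N` ancilla modes. -/
abbrev Modes (N : ℕ) : Type := Fin 1 ⊕ Fin N

/-- A Gaussian syndrome extraction circuit: a Gaussian unitary `U` with matrix `S` acting on a data
mode in the ideal GKP codestate `data` and on `N` ancilla modes in the ideal GKP codestate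
`ancilla`, followed by position homodyne measurements of the ancillas.

That the circuit extracts a syndrome means: without noise, the possible ancilla outcomes form a
grid, and for each of them the data mode is left in its codestate up to a displacement, i.e.
`U (|data⟩ ⊗ |ancilla⟩) = ∑_ℓ amp ℓ • W(shift ℓ)|data⟩ ⊗ |ℓ⟩_q`. -/
structure SyndromeCircuit (N : ℕ) (S : Matrix (Modes N ⊕ Modes N) (Modes N ⊕ Modes N) ℝ) where
  /-- the Gaussian unitary -/
  U : Wave (Modes N) ≃L[ℂ] Wave (Modes N)
  gaussian : IsGaussianUnitary U S
  /-- the data codestate -/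
  data : Ket (Fin 1)
  data_gkp : IsGKPState data
  /-- the ancilla codestate -/
  ancilla : Ket (Fin N)
  ancilla_gkp : IsGKPState ancilla
  /-- the joint input `|data⟩ ⊗ |ancilla⟩` -/
  input : Ket (Modes N)
  input_tensor : ∀ f g, input (tensor f g) = data f * ancilla g
  /-- the ancilla outcomes that are possible without noise -/
  outcomes : Set (Conf (Fin N))
  outcomes_nonempty : outcomes.Nonempty
  outcomes_separated : ∃ r > 0, outcomes.Pairwise fun x y => r ≤ dist x y
  /-- the amplitude of an outcome -/
  amp : Conf (Fin N) → ℂ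
  amp_ne_zero : ∀ l ∈ outcomes, amp l ≠ 0
  /-- the displacement of the data mode that belongs to an outcome -/
  shift : Conf (Fin N) → Phase (Fin 1)
  noiseless : ∀ f g, HasSum
    (fun l : outcomes => amp l * data (displace (-shift l) f) * conj (g l))
    (input (U.symm (tensor f g)))

variable {N : ℕ} {S : Matrix (Modes N ⊕ Modes N) (Modes N ⊕ Modes N) ℝ}

/-- The joint state before the measurement, when independent Gaussian displacement noise of
variance `Δ²` acts on every quadrature of every input mode. -/
def SyndromeCircuit.noisyState (C : SyndromeCircuit N S) (Δ : ℝ) : Op (Modes N) :=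
  evolve C.U (randomDisplacement (gaussianDensity 0 (Δ ^ 2 • 1)) (pureState C.input))

/-- With noise of variance `Δ²` and the decoder `D` (which answers the outcome `m` by
the correction `W(D m)†`), the data mode ends, after outcome `m`, up to normalisation in the state
`∫ X(v) W(v)|data⟩⟨data|W(v)† dv`: the residual displacement error has density `X`. -/
def SyndromeCircuit.HasResidualError (C : SyndromeCircuit N S) (Δ : ℝ)
    (D : Conf (Fin N) → Phase (Fin 1)) (m : Conf (Fin N)) (X : Phase (Fin 1) → ℝ) : Prop :=
  ∃ σ : Op (Fin 1), IsHomodyneState (C.noisyState Δ) m σ ∧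
    conjDisplace (-D m) σ = randomDisplacement X (pureState C.data)

/-! ### Mixtures of Gaussians -/

/-- A mixture of normal distributions with the common covariance matrix `Sig`. -/
structure GaussianMixture (Sig : Matrix (ι ⊕ ι) (ι ⊕ ι) ℝ) where
  /-- the index set of the components -/
  Index : Type
  /-- the weights -/
  weight : Index → ℝ
  weight_pos : ∀ i, 0 < weight i
  weight_sum : HasSum weight 1
  /-- the means -/
  mean : Index → Phase ι

/-- The density `∑ᵢ pᵢ 𝒩(μᵢ, Σ, v)`. -/
def GaussianMixture.density [DecidableEq ι] {Sig : Matrix (ι ⊕ ι) (ι ⊕ ι) ℝ}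
    (M : GaussianMixture Sig) (v : Phase ι) : ℝ :=
  ∑' i, M.weight i * gaussianDensity (M.mean i) Sig v

/-- The law of a random displacement with density `X`. -/
def displacementLaw (X : Phase ι → ℝ) : Measure (Phase ι) :=
  volume.withDensity fun v => ENNReal.ofReal (X v)

/-- The random displacement with density `X` has finite second moments. -/
def HasFiniteVariance (X : Phase ι → ℝ) : Prop :=
  ∀ a, MemLp (fun v : Phase ι => v a) 2 (displacementLaw X)

/-- The covariance matrix of `√(2π) v`, for `v` with density `X`. -/
def covarianceMatrix (X : Phase ι → ℝ) : Matrix (ι ⊕ ι) (ι ⊕ ι) ℝ :=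
  Matrix.of fun a b => 2 * π * cov[fun v => v a, fun v => v b; displacementLaw X]

/-- The position spread `Δ_q` of a one-mode displacement error. -/
def spreadQ (X : Phase (Fin 1) → ℝ) : ℝ := √(covarianceMatrix X (Sum.inl 0) (Sum.inl 0))

/-- The momentum spread `Δ_p` of a one-mode displacement error. -/
def spreadP (X : Phase (Fin 1) → ℝ) : ℝ := √(covarianceMatrix X (Sum.inr 0) (Sum.inr 0))

/-! ### The biased `q`-Steane circuit -/

/-- The configuration with data position `x` and position `y` of the single ancilla. -/
def point₂ (x y : ℝ) : Conf (Modes 1) := WithLp.toLp 2 (Sum.elim (fun _ => x) fun _ => y)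

/-- `C` is the biased `q`-Steane circuit with data codestate `α|0̄⟩ + β|1̄⟩` of the square code. Its
ancilla is the state `|+̄⟩` of the square code with the noise biased by `lam`, which is the
state `|+̄⟩` of the rectangular code with unbiased noise, squeezed by `Sq(√lam)`. Hence
`U = exp(-i q₁ p₂) Sq₂(√lam)`, that is `(U f)(x, y) = lam^(1/4) f(x, √lam (y - x))`. -/
structure SyndromeCircuit.IsBiasedSteane {S : Matrix (Modes 1 ⊕ Modes 1) (Modes 1 ⊕ Modes 1) ℝ}
    (C : SyndromeCircuit 1 S) (lam : ℝ) (α β : ℂ) : Prop where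
  unitary : ∀ f x y, C.U f (point₂ x y) = (lam ^ (1 / 4 : ℝ) : ℝ) * f (point₂ x (√lam * (y - x)))
  data : IsRectangularState 1 α β C.data
  ancilla : IsRectangularState lam 1 1 C.ancilla

/-- The covariance matrix `diag(Δq², Δp²)` of one mode. -/
def biasedCovariance (Δq Δp : ℝ) : Matrix (Fin 1 ⊕ Fin 1) (Fin 1 ⊕ Fin 1) ℝ :=
  Matrix.diagonal (Sum.elim (fun _ => Δq ^ 2) fun _ => Δp ^ 2)

end GKPNoGo
end

/-!
The residual error of a Gaussian syndrome extraction circuit is a mixture of normal laws with one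
common covariance matrix of determinant `Δ⁴`.

*Noise.* A Gaussian unitary with matrix `S` turns `W(v)` into `W(S v)` up to a phase
(`IsGaussianUnitary.symm_displace`): both displacements translate the quadratures alike, and the
quadratures act irreducibly on Schwartz space (`exists_eq_smul_of_commute_quadrature`, through the
uniqueness of the ground state and the totality of the Hermite functions). Hence the noisy circuit
is the noiseless one followed by a normal displacement with covariance matrix `Δ² S Sᵀ`
(`SyndromeCircuit.noisyState_apply`).

*Measurement.* The possible noiseless outcomes `l` are uniformly separated, so a narrow ancilla wave
packet meets at most one of their displaced copies, and different `l` do not interfere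
(`SyndromeCircuit.hasSum_overlap_output`). Given `l` and the outcome `m`, the measured positions have
been displaced by `m - l`. By Gaussian conditioning (`integral_stdLaw_eq_conditional`) the data
displacement is then normal, with a mean depending on `l` and `m` and with the Schur complement
`Δ² residualCov S` as covariance matrix. Summing over `l` with the weights `|amp l|²` times the density
of the displacement gives the mixture (`SyndromeCircuit.exists_gaussianMixture`). The interchange of
the limit of sharp packets with the sum rests on two bounds: the overlaps of a GKP state with displaced
wave functions are bounded, since they are periodic under the stabiliser lattice, and the amplitudes
are square summable against Gaussians (`SyndromeCircuit.summable_amp`), since the output of the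
noiseless circuit pairs with Gaussian ancilla wave functions. Reducing the shifts modulo the stabiliser
lattice keeps the second moments finite.

*Determinant.* For symplectic `S`, the inverse of `A = S Sᵀ` is `A` with positions and momenta
exchanged up to signs. Jacobi's identity for complementary minors then shows that the kept quadratures
(data position and momentum, ancilla positions) and the ancilla positions alone have covariance
matrices of equal determinant (`det_kept`). So the Schur complement has determinant `1`
(`residualCov_posDef_and_det`). The covariance matrix of a mixture dominates the common covariance
matrix of its components, and `det` is monotone on positive definite matrices
(`le_det_covarianceMatrix`).

*The Steane circuit.* Its unitary maps the grid of the input onto the grid of all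
`(n√π, l√π)` with amplitudes that do not depend on `l` (`steaneInput_symm_tensor`), which is the product
form that makes it a syndrome extraction circuit with trivial shifts, and its Schur complement is
`diag((1 + λ)⁻¹, 1 + λ)` (`residualCov_steaneMatrix`).
-/

noncomputable section

namespace GKPNoGo

/-! ### Gaussian wave functions -/

theorem one_add_pow_mul_exp_neg_le {a : ℝ} (ha : 0 < a) (M : ℕ) {r : ℝ} (hr : 0 ≤ r) :
    (1 + r) ^ M * Real.exp (-a * r ^ 2) ≤ 2 ^ M * (M.factorial * Real.exp a / a ^ M) := by
  have h1 : (1 + r) ^ M ≤ (2 * (1 + r ^ 2)) ^ M := by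
    gcongr
    nlinarith [sq_nonneg (r - 1)]
  have h2 := Real.pow_div_factorial_le_exp (a * (1 + r ^ 2)) (by positivity) M
  have h3 : (1 + r ^ 2) ^ M ≤ M.factorial * Real.exp (a * (1 + r ^ 2)) / a ^ M := by
    rw [le_div_iff₀ (by positivity)]
    rw [div_le_iff₀ (by positivity), mul_pow] at h2
    linarith
  calc (1 + r) ^ M * Real.exp (-a * r ^ 2)
      ≤ (2 ^ M * (M.factorial * Real.exp (a * (1 + r ^ 2)) / a ^ M)) * Real.exp (-a * r ^ 2) := by
        rw [mul_pow] at h1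
        gcongr
        exact h1.trans (by gcongr)
    _ = 2 ^ M * (M.factorial * (Real.exp (a * (1 + r ^ 2)) * Real.exp (-a * r ^ 2)) / a ^ M) := by
        ring
    _ = _ := by rw [← Real.exp_add]; ring_nf

section Gaussian

variable {E : Type*} [NormedAddCommGroup E] [InnerProductSpace ℝ E]

theorem norm_iteratedFDeriv_cexp_neg_mul_le {a : ℝ} (ha : 0 < a) (n i : ℕ) (hi : i ≤ n) (t : ℝ) :
    ‖iteratedFDeriv ℝ i (fun s : ℝ => Complex.exp (-(a * s : ℝ))) t‖
      ≤ (1 + a) ^ n * Real.exp (-a * t) := by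
  have h : ∀ i : ℕ, iteratedDeriv i (fun s : ℝ => Complex.exp (-(a * s : ℝ)))
      = fun s : ℝ => (-a : ℂ) ^ i * Complex.exp (-(a * s : ℝ)) := by
    intro i
    induction i with
    | zero => simp
    | succ i ih =>
      rw [iteratedDeriv_succ, ih]
      funext s
      have h3 : HasDerivAt (fun s : ℝ => Complex.exp (-(a * s : ℝ)))
          (Complex.exp (-(a * s : ℝ)) * (-a)) s := by
        have : HasDerivAt (fun s : ℝ => -((a * s : ℝ) : ℂ)) (-a : ℂ) s := by
          have := (((hasDerivAt_id s).const_mul a).ofReal_comp).fun_neg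
          simpa using this
        exact this.cexp
      rw [(h3.const_mul _).deriv]
      ring
  rw [norm_iteratedFDeriv_eq_norm_iteratedDeriv, h, norm_mul, norm_pow, norm_neg,
    Complex.norm_real, Real.norm_of_nonneg ha.le, Complex.norm_exp]
  gcongr
  · exact (pow_le_pow_left₀ ha.le (by linarith) i).trans
      (pow_le_pow_right₀ (by linarith) hi)
  · simp

/-- The Gaussian `x ↦ exp(-a ‖x‖²)` as a Schwartz function. -/
def gaussianWave (a : ℝ) (ha : 0 < a) : 𝓢(E, ℂ) where
  toFun x := Complex.exp (-(a * ‖x‖ ^ 2 : ℝ))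
  smooth' := by
    have h : ContDiff ℝ ∞ (fun x : E => ((a * ‖x‖ ^ 2 : ℝ) : ℂ)) :=
      Complex.ofRealCLM.contDiff.comp (contDiff_const.mul (contDiff_norm_sq ℝ))
    exact h.neg.cexp
  decay' k n := by
    obtain ⟨K, C, hC, hf⟩ :=
      (Function.hasTemperateGrowth_norm_sq (H := E)).norm_iteratedFDeriv_le_uniform n
    refine ⟨n.factorial * (1 + a) ^ n * (1 + C) ^ n *
      (2 ^ (k + K * n) * ((k + K * n).factorial * Real.exp a / a ^ (k + K * n))), fun x => ?_⟩
    have hg : ContDiff ℝ ∞ (fun s : ℝ => Complex.exp (-(a * s : ℝ))) :=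
      (Complex.ofRealCLM.contDiff.comp (contDiff_const.mul contDiff_id)).neg.cexp
    have h := norm_iteratedFDeriv_comp_le (𝕜 := ℝ) hg (f := fun x : E => ‖x‖ ^ 2)
      (contDiff_norm_sq ℝ) (n := n) (by exact_mod_cast le_top) x
      (C := (1 + a) ^ n * Real.exp (-a * ‖x‖ ^ 2)) (D := (1 + C) * (1 + ‖x‖) ^ K)
      (fun i hi => norm_iteratedFDeriv_cexp_neg_mul_le ha n i hi _)
      (fun i hi hi' => by
        have hx : 1 ≤ (1 + ‖x‖) ^ K := one_le_pow₀ (by linarith [norm_nonneg x])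
        refine (hf i hi' x).trans (le_trans ?_ (le_self_pow₀ ?_ (by omega)))
        · gcongr; linarith
        · nlinarith)
    have hb := one_add_pow_mul_exp_neg_le ha (k + K * n) (norm_nonneg x)
    have hxk : ‖x‖ ^ k ≤ (1 + ‖x‖) ^ k := by gcongr; linarith
    calc ‖x‖ ^ k * ‖iteratedFDeriv ℝ n (fun x : E => Complex.exp (-(a * ‖x‖ ^ 2 : ℝ))) x‖
        ≤ (1 + ‖x‖) ^ k * (n.factorial * ((1 + a) ^ n * Real.exp (-a * ‖x‖ ^ 2)) *
          ((1 + C) * (1 + ‖x‖) ^ K) ^ n) := by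
          gcongr
          exact h
      _ = n.factorial * (1 + a) ^ n * (1 + C) ^ n *
          ((1 + ‖x‖) ^ (k + K * n) * Real.exp (-a * ‖x‖ ^ 2)) := by
          rw [mul_pow, ← pow_mul, pow_add]; ring
      _ ≤ _ := by gcongr

theorem gaussianWave_apply {a : ℝ} (ha : 0 < a) (x : E) :
    gaussianWave a ha x = Complex.exp (-(a * ‖x‖ ^ 2 : ℝ)) := rfl

end Gaussian

/-! ### Strong continuity of the displacement operators -/

section Translation

variable {E F : Type*} [NormedAddCommGroup E] [NormedSpace ℝ E]
  [NormedAddCommGroup F] [NormedSpace ℝ F] [NormedSpace ℂ F]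

theorem iteratedFDeriv_compSubConst (f : 𝓢(E, F)) (n : ℕ) (h x : E) :
    iteratedFDeriv ℝ n (f.compSubConstCLM ℂ h) x = iteratedFDeriv ℝ n f (x - h) :=
  iteratedFDeriv_comp_sub n h x

theorem tendsto_compSubConst_zero (f : 𝓢(E, F)) :
    Tendsto (fun h : E => f.compSubConstCLM ℂ h) (𝓝 0) (𝓝 f) := by
  rw [(schwartz_withSeminorms ℝ E F).tendsto_nhds]
  rintro ⟨k, n⟩ ε hε
  set C := 2 ^ k * ((Finset.Iic (k, n + 1)).sup fun m => SchwartzMap.seminorm ℝ m.1 m.2) f with hC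
  have hC0 : 0 ≤ C := by positivity
  have hev : ∀ᶠ h : E in 𝓝 0, ‖h‖ < min 1 (ε / (C * 2 ^ k + 1)) := by
    have := (continuous_norm (E := E)).tendsto 0
    rw [norm_zero] at this
    exact this.eventually (gt_mem_nhds (by positivity))
  filter_upwards [hev] with h hh
  have h1 : ‖h‖ ≤ 1 := (hh.trans_le (min_le_left _ _)).le
  have h2 : ‖h‖ * (C * 2 ^ k + 1) < ε := by
    rw [← lt_div_iff₀ (by positivity)]
    exact hh.trans_le (min_le_right _ _)
  refine lt_of_le_of_lt (SchwartzMap.seminorm_le_bound ℝ k n _ (M := C * 2 ^ k * ‖h‖)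
    (by positivity) fun x => ?_) (by nlinarith [norm_nonneg h])
  have hdiff : iteratedFDeriv ℝ n (⇑(f.compSubConstCLM ℂ h - f)) x
      = iteratedFDeriv ℝ n f (x - h) - iteratedFDeriv ℝ n f x := by
    rw [← iteratedFDeriv_compSubConst]
    have : (⇑(f.compSubConstCLM ℂ h - f)) = ⇑(f.compSubConstCLM ℂ h) - ⇑f := by
      ext y; simp
    rw [this, iteratedFDeriv_sub_apply]
    · exact ((f.compSubConstCLM ℂ h).smooth n).contDiffAt
    · exact (f.smooth n).contDiffAt
  rw [hdiff]
  have hmv : ‖iteratedFDeriv ℝ n f (x - h) - iteratedFDeriv ℝ n f x‖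
      ≤ (C * 2 ^ k / (1 + ‖x‖) ^ k) * ‖x - h - x‖ := by
    refine Convex.norm_image_sub_le_of_norm_fderiv_le (𝕜 := ℝ) (s := Metric.closedBall x 1)
      (fun z _ => ?_) (fun z hz => ?_) (convex_closedBall x 1) (Metric.mem_closedBall_self
      (by norm_num)) (by simpa using h1)
    · exact ((f.smooth (n + 1)).differentiable_iteratedFDeriv
        (by exact_mod_cast Nat.lt_succ_self n)).differentiableAt
    · rw [norm_fderiv_iteratedFDeriv, le_div_iff₀ (by positivity)]
      have hz' : ‖x‖ ≤ ‖z‖ + 1 := by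
        have := norm_le_norm_add_norm_sub' x z
        rw [mem_closedBall_iff_norm'] at hz
        linarith
      have := SchwartzMap.one_add_le_sup_seminorm_apply (𝕜 := ℝ) (m := (k, n + 1)) le_rfl le_rfl f z
      calc ‖iteratedFDeriv ℝ (n + 1) f z‖ * (1 + ‖x‖) ^ k
          ≤ ‖iteratedFDeriv ℝ (n + 1) f z‖ * (2 * (1 + ‖z‖)) ^ k := by
            gcongr; linarith [norm_nonneg z]
        _ = ((1 + ‖z‖) ^ k * ‖iteratedFDeriv ℝ (n + 1) f z‖) * 2 ^ k := by rw [mul_pow]; ring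
        _ ≤ C * 2 ^ k := by gcongr
  have hx : ‖x‖ ^ k ≤ (1 + ‖x‖) ^ k := by gcongr; linarith
  have hpos : 0 < (1 + ‖x‖) ^ k := by positivity
  calc ‖x‖ ^ k * ‖iteratedFDeriv ℝ n f (x - h) - iteratedFDeriv ℝ n f x‖
      ≤ (1 + ‖x‖) ^ k * ((C * 2 ^ k / (1 + ‖x‖) ^ k) * ‖x - h - x‖) := by gcongr
    _ = C * 2 ^ k * ‖h‖ := by
      rw [sub_sub_cancel_left, norm_neg]; field_simp

theorem tendsto_compSubConst_zero_zero :
    Tendsto (fun p : E × 𝓢(E, F) => p.2.compSubConstCLM ℂ p.1) (𝓝 0 ×ˢ 𝓝 0) (𝓝 0) := by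
  rw [(schwartz_withSeminorms ℝ E F).tendsto_nhds]
  rintro ⟨k, n⟩ ε hε
  have h1 : ∀ᶠ h : E in 𝓝 0, ‖h‖ < 1 := by
    have := (continuous_norm (E := E)).tendsto 0
    rw [norm_zero] at this
    exact this.eventually (gt_mem_nhds one_pos)
  have h2 : ∀ᶠ f : 𝓢(E, F) in 𝓝 0,
      ((Finset.Iic (k, n)).sup fun m => SchwartzMap.seminorm ℝ m.1 m.2) f < ε / (4 ^ k + 1) := by
    have h3 : ∀ m : ℕ × ℕ, ∀ᶠ f : 𝓢(E, F) in 𝓝 0,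
        SchwartzMap.seminorm ℝ m.1 m.2 f < ε / (4 ^ k + 1) := by
      intro m
      have := ((schwartz_withSeminorms ℝ E F).continuous_seminorm m).tendsto 0
      rw [map_zero] at this
      exact this.eventually (gt_mem_nhds (by positivity))
    filter_upwards [(Finset.eventually_all _).2 fun m (_ : m ∈ Finset.Iic (k, n)) => h3 m] with f hf
    exact Seminorm.finset_sup_apply_lt (by positivity) hf
  filter_upwards [h1.prod_mk h2] with ⟨h, f⟩ ⟨hh, hf⟩
  rw [lt_div_iff₀ (by positivity)] at hf
  set C := ((Finset.Iic (k, n)).sup fun m => SchwartzMap.seminorm ℝ m.1 m.2) f with hC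
  have hC0 : 0 ≤ C := apply_nonneg _ _
  rw [sub_zero]
  refine lt_of_le_of_lt (SchwartzMap.seminorm_le_bound ℝ k n _ (M := C * 4 ^ k)
    (by positivity) fun x => ?_) (by nlinarith)
  rw [iteratedFDeriv_compSubConst]
  have h3 := SchwartzMap.one_add_le_sup_seminorm_apply (𝕜 := ℝ) (m := (k, n)) le_rfl le_rfl f (x - h)
  have hx : ‖x‖ ≤ 2 * (1 + ‖x - h‖) := by
    have := norm_le_norm_add_norm_sub' x (x - h)
    simp only [sub_sub_cancel] at this
    linarith [norm_nonneg (x - h)]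
  calc ‖x‖ ^ k * ‖iteratedFDeriv ℝ n f (x - h)‖
      ≤ (2 * (1 + ‖x - h‖)) ^ k * ‖iteratedFDeriv ℝ n f (x - h)‖ := by gcongr
    _ = 2 ^ k * ((1 + ‖x - h‖) ^ k * ‖iteratedFDeriv ℝ n f (x - h)‖) := by rw [mul_pow]; ring
    _ ≤ 2 ^ k * (2 ^ k * C) := by gcongr
    _ = C * 4 ^ k := by rw [show (4 : ℝ) = 2 * 2 by norm_num, mul_pow]; ring

/-- Translation is jointly continuous in the shift and in the Schwartz function. -/
theorem continuous_compSubConst :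
    Continuous fun p : E × 𝓢(E, F) => p.2.compSubConstCLM ℂ p.1 := by
  rw [continuous_iff_continuousAt]
  rintro ⟨h₀, f₀⟩
  have hsub : Tendsto (fun p : E × 𝓢(E, F) => p.1 - h₀) (𝓝 (h₀, f₀)) (𝓝 0) := by
    have : Tendsto (fun p : E × 𝓢(E, F) => p.1 - h₀) (𝓝 (h₀, f₀)) (𝓝 (h₀ - h₀)) :=
      (continuous_fst.sub continuous_const).tendsto _
    rwa [sub_self] at this
  have hsub' : Tendsto (fun p : E × 𝓢(E, F) => p.2 - f₀) (𝓝 (h₀, f₀)) (𝓝 0) := by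
    have : Tendsto (fun p : E × 𝓢(E, F) => p.2 - f₀) (𝓝 (h₀, f₀)) (𝓝 (f₀ - f₀)) :=
      (continuous_snd.sub continuous_const).tendsto _
    rwa [sub_self] at this
  have h1 := tendsto_compSubConst_zero_zero.comp (hsub.prodMk hsub')
  have h2 := h1.add ((tendsto_compSubConst_zero f₀).comp hsub)
  rw [zero_add] at h2
  refine (((SchwartzMap.compSubConstCLM ℂ h₀).continuous.tendsto f₀).comp h2).congr fun p => ?_
  simp only [Function.comp_apply]
  rw [← map_add, sub_add_cancel, SchwartzMap.compSubConstCLM_comp, sub_add_cancel]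

/-- Modulation is strongly continuous, since the Fourier transform turns it into translation. -/
theorem continuous_smulLeftCLM_cis {ι : Type} [Fintype ι] (f : Wave ι) :
    Continuous fun p : Conf ι =>
      SchwartzMap.smulLeftCLM ℂ
        (fun x : Conf ι => Complex.exp ((2 * π * inner ℝ p x : ℝ) * Complex.I)) f := by
  have key : ∀ p : Conf ι, SchwartzMap.smulLeftCLM ℂ
        (fun x : Conf ι => Complex.exp ((2 * π * inner ℝ p x : ℝ) * Complex.I)) f
      = FourierTransformInv.fourierInv
        (SchwartzMap.compSubConstCLM ℂ p (FourierTransform.fourier f)) := by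
    intro p
    have ht : Function.HasTemperateGrowth
        (fun x : Conf ι => Complex.exp ((2 * π * inner ℝ p x : ℝ) * Complex.I)) :=
      hasTemperateGrowth_cis.comp (f := fun x : Conf ι => 2 * π * inner ℝ p x)
        ((Function.HasTemperateGrowth.const _).mul (Function.hasTemperateGrowth_inner_right _))
    rw [← FourierTransform.fourierInv_fourier_eq (F := Wave ι) (SchwartzMap.smulLeftCLM ℂ
        (fun x : Conf ι => Complex.exp ((2 * π * inner ℝ p x : ℝ) * Complex.I)) f)]
    congr 1
    ext ξ
    rw [SchwartzMap.compSubConstCLM_apply, SchwartzMap.fourier_coe, SchwartzMap.fourier_coe,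
      Real.fourier_eq', Real.fourier_eq']
    refine integral_congr_ae (ae_of_all _ fun x => ?_)
    simp only [SchwartzMap.smulLeftCLM_apply_apply ht, smul_eq_mul]
    rw [← mul_assoc, ← Complex.exp_add]
    congr 2
    rw [inner_sub_right, real_inner_comm x p]
    push_cast
    ring
  simp_rw [key]
  exact (ContinuousFourierInv.continuous_fourierInv (E := Wave ι) (F := Wave ι)).comp
    (continuous_compSubConst.comp (continuous_id.prodMk continuous_const))

end Translation

section Displacement

variable {ι : Type} [Fintype ι]

theorem continuous_posPart : Continuous (posPart : Phase ι → Conf ι) :=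
  (PiLp.continuous_toLp 2 _).comp (continuous_pi fun _ => continuous_apply _)

theorem continuous_momPart : Continuous (momPart : Phase ι → Conf ι) :=
  (PiLp.continuous_toLp 2 _).comp (continuous_pi fun _ => continuous_apply _)

theorem displace_eq_compSubConst (v : Phase ι) (f : Wave ι) :
    displace v f = Complex.exp ((π * inner ℝ (posPart v) (momPart v) : ℝ) * Complex.I) •
      SchwartzMap.compSubConstCLM ℂ (√(2 * π) • posPart v)
        (SchwartzMap.smulLeftCLM ℂ (fun x : Conf ι => Complex.exp
          ((2 * π * inner ℝ ((√(2 * π))⁻¹ • momPart v) x : ℝ) * Complex.I)) f) := by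
  have ht : Function.HasTemperateGrowth (fun x : Conf ι => Complex.exp
      ((2 * π * inner ℝ ((√(2 * π))⁻¹ • momPart v) x : ℝ) * Complex.I)) :=
    hasTemperateGrowth_cis.comp
      (f := fun x : Conf ι => 2 * π * inner ℝ ((√(2 * π))⁻¹ • momPart v) x)
      ((Function.HasTemperateGrowth.const _).mul (Function.hasTemperateGrowth_inner_right _))
  ext x
  rw [displace_apply, smul_apply, SchwartzMap.compSubConstCLM_apply,
    SchwartzMap.smulLeftCLM_apply_apply ht, smul_eq_mul, smul_eq_mul, ← mul_assoc,
    ← Complex.exp_add, ← add_mul, ← Complex.ofReal_add]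
  congr 4
  have hs : √(2 * π) * √(2 * π) = 2 * π := Real.mul_self_sqrt (by positivity)
  have hs' : √(2 * π) ≠ 0 := by positivity
  have h (A : ℝ) : 2 * π * ((√(2 * π))⁻¹ * A) = √(2 * π) * A := by
    rw [← mul_assoc, ← div_eq_mul_inv, div_eq_iff hs' |>.2 hs.symm]
  rw [displacePhase, inner_sub_right, real_inner_smul_left, real_inner_smul_left,
    real_inner_smul_right, real_inner_comm (momPart v) (posPart v), ← mul_sub, h]
  linear_combination inner ℝ (momPart v) (posPart v) * hs

theorem continuous_displace (f : Wave ι) : Continuous fun v : Phase ι => displace v f := by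
  simp_rw [displace_eq_compSubConst]
  have h1 : Continuous fun v : Phase ι => √(2 * π) • posPart v :=
    (continuous_const_smul (√(2 * π))).comp continuous_posPart
  have h2 := (continuous_smulLeftCLM_cis f).comp
    ((continuous_const_smul (√(2 * π))⁻¹).comp (continuous_momPart (ι := ι)))
  have h3 : Continuous fun v : Phase ι =>
      Complex.exp ((π * inner ℝ (posPart v) (momPart v) : ℝ) * Complex.I) :=
    Complex.continuous_exp.comp ((Complex.continuous_ofReal.comp
      (continuous_const.mul (continuous_posPart.inner continuous_momPart))).mul continuous_const)
  exact h3.smul ((continuous_compSubConst (E := Conf ι) (F := ℂ)).comp (h1.prodMk h2))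

end Displacement

/-! ### The Weyl relations -/

section Weyl

variable {ι : Type} [Fintype ι]

theorem inner_conf (x y : Conf ι) : inner ℝ x y = ∑ j, x j * y j := by
  simp [PiLp.inner_apply, mul_comm]

theorem posPart_add (u v : Phase ι) : posPart (u + v) = posPart u + posPart v := rfl

theorem momPart_add (u v : Phase ι) : momPart (u + v) = momPart u + momPart v := rfl

theorem symplecticProduct_eq_inner (u v : Phase ι) : symplecticProduct u v =
    inner ℝ (posPart u) (momPart v) - inner ℝ (momPart u) (posPart v) := by
  simp [symplecticProduct, inner_conf, posPart, momPart, Finset.sum_sub_distrib]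

@[simp] theorem displace_zero (f : Wave ι) : displace 0 f = f := by
  have h1 : posPart (0 : Phase ι) = 0 := rfl
  have h2 : momPart (0 : Phase ι) = 0 := rfl
  ext x
  simp [displace_apply, displacePhase, h1, h2]

theorem displace_displace (u v : Phase ι) (f : Wave ι) : displace u (displace v f) =
    Complex.exp ((-π * symplecticProduct u v : ℝ) * Complex.I) • displace (u + v) f := by
  ext x
  rw [smul_apply, displace_apply, displace_apply, displace_apply, smul_eq_mul, ← mul_assoc,
    ← mul_assoc, ← Complex.exp_add, ← Complex.exp_add, ← add_mul, ← add_mul, ← Complex.ofReal_add,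
    ← Complex.ofReal_add, posPart_add, smul_add, sub_sub]
  congr 4
  have hs : √(2 * π) * √(2 * π) = 2 * π := Real.mul_self_sqrt (by positivity)
  rw [displacePhase, displacePhase, displacePhase, symplecticProduct_eq_inner, posPart_add,
    momPart_add, inner_sub_right, inner_add_left, inner_add_left, inner_add_right, inner_add_right,
    real_inner_smul_right, real_inner_comm (posPart v) (momPart u),
    real_inner_comm (posPart u) (momPart v)]
  linear_combination -inner ℝ (posPart u) (momPart v) * hs

theorem displace_neg_displace (v : Phase ι) (f : Wave ι) : displace (-v) (displace v f) = f := by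
  have h : symplecticProduct (-v) v = 0 := by
    simp only [symplecticProduct, Pi.neg_apply]
    exact Finset.sum_eq_zero fun j _ => by ring
  rw [displace_displace, h]
  simp

theorem displace_displace_neg (v : Phase ι) (f : Wave ι) : displace v (displace (-v) f) = f := by
  simpa using displace_neg_displace (-v) f

theorem hasLineDerivAt_wave (f : Wave ι) (x v : Conf ι) :
    HasLineDerivAt ℝ f (lineDeriv ℝ f x v) x v :=
  (f.differentiableAt.lineDifferentiableAt).hasLineDerivAt

theorem displacePhase_add_smul_single [DecidableEq ι] (v : Phase ι) (x : Conf ι) (t : ℝ) (j : ι) :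
    displacePhase v (x + t • EuclideanSpace.single j (1 : ℝ)) =
      displacePhase v x + t * (√(2 * π) * v (Sum.inr j)) := by
  simp only [displacePhase, inner_add_right, real_inner_smul_right, EuclideanSpace.inner_single_right]
  simp [momPart]
  ring

/-- Displacements translate the quadratures: `W(v)† ζ W(v) = ζ + √(2π) v`. -/
theorem quadrature_displace [DecidableEq ι] (a : ι ⊕ ι) (v : Phase ι) (f : Wave ι) :
    quadrature a (displace v f) =
      displace v (quadrature a f) + ((√(2 * π) * v a : ℝ) : ℂ) • displace v f := by
  ext x
  cases a with
  | inl j =>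
    simp only [quadrature, Sum.elim_inl, positionOp_apply, displace_apply, add_apply, smul_apply,
      smul_eq_mul, posPart, PiLp.sub_apply, PiLp.smul_apply]
    push_cast
    ring
  | inr j =>
    simp only [quadrature, Sum.elim_inr, momentumOp_apply, displace_apply, add_apply, smul_apply,
      smul_eq_mul]
    set e : Conf ι := EuclideanSpace.single j (1 : ℝ) with he
    set h := √(2 * π) • posPart v
    have h1 : HasLineDerivAt ℝ (displace v f)
        (Complex.exp (displacePhase v x * Complex.I) * ((√(2 * π) * v (Sum.inr j) : ℝ) * Complex.I) *
          f (x - h) + Complex.exp (displacePhase v x * Complex.I) * lineDeriv ℝ f (x - h) e) x e := by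
      have h2 := hasLineDerivAt_wave f (x - h) e
      have h3 : HasDerivAt (fun t : ℝ => Complex.exp (displacePhase v (x + t • e) * Complex.I))
          (Complex.exp (displacePhase v x * Complex.I) *
            ((√(2 * π) * v (Sum.inr j) : ℝ) * Complex.I)) 0 := by
        have h4 : HasDerivAt (fun t : ℝ => displacePhase v (x + t • e))
            (√(2 * π) * v (Sum.inr j)) 0 := by
          simp_rw [he, displacePhase_add_smul_single]
          simpa using ((hasDerivAt_id (0 : ℝ)).mul_const (√(2 * π) * v (Sum.inr j))).const_add
            (displacePhase v x)
        have h5 := (h4.ofReal_comp.mul_const Complex.I).cexp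
        simpa using h5
      have h6 := HasDerivAt.mul h3 h2
      simp only [zero_smul, add_zero] at h6
      refine h6.congr_of_eventuallyEq (Eventually.of_forall fun t => ?_)
      simp only [displace_apply, Pi.mul_apply]
      rw [add_sub_right_comm]
    rw [h1.lineDeriv]
    push_cast
    linear_combination (-(Complex.exp (displacePhase v x * Complex.I)) *
      (√(2 * π) * v (Sum.inr j)) * f (x - h)) * Complex.I_mul_I

theorem displace_tensor {κ : Type} [Fintype κ] (w : Phase (ι ⊕ κ)) (f : Wave ι) (g : Wave κ) :
    displace w (tensor f g) =
      tensor (displace (Sum.elim (fun i => w (Sum.inl (Sum.inl i))) fun i => w (Sum.inr (Sum.inl i))) f)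
        (displace (Sum.elim (fun i => w (Sum.inl (Sum.inr i))) fun i => w (Sum.inr (Sum.inr i))) g) := by
  ext x
  rw [displace_apply, tensor_apply, tensor_apply, displace_apply, displace_apply, mul_mul_mul_comm,
    ← Complex.exp_add, ← add_mul, ← Complex.ofReal_add]
  congr 5
  simp only [displacePhase, inner_conf, Fintype.sum_sum_type, posPart, momPart, restrictModes,
    Sum.elim_inl, Sum.elim_inr]
  simp
  ring

end Weyl

/-! ### Irreducibility of the quadratures -/

section Irreducible

variable {ι : Type} [Fintype ι]

theorem integrable_conj_mul (f g : Wave ι) : Integrable fun x => conj (f x) * g x := by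
  obtain ⟨C, hC⟩ := f.decay 0 0
  refine g.integrable.bdd_mul (c := C)
    (Complex.continuous_conj.comp f.continuous).aestronglyMeasurable (ae_of_all _ fun x => ?_)
  have := hC.2 x
  simpa using this

theorem integral_conj_mul_smul_right (f g : Wave ι) (c : ℂ) :
    ∫ x, conj (f x) * (c • g) x = c * ∫ x, conj (f x) * g x := by
  rw [← integral_const_mul]
  refine integral_congr_ae (ae_of_all _ fun x => ?_)
  simp only [smul_apply, smul_eq_mul]
  ring

theorem integral_conj_mul_smul_left (f g : Wave ι) (c : ℂ) :
    ∫ x, conj ((c • f) x) * g x = conj c * ∫ x, conj (f x) * g x := by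
  rw [← integral_const_mul]
  refine integral_congr_ae (ae_of_all _ fun x => ?_)
  simp only [smul_apply, smul_eq_mul, map_mul]
  ring

theorem integral_conj_mul_sub_left (f h g : Wave ι) :
    ∫ x, conj ((f - h) x) * g x = (∫ x, conj (f x) * g x) - ∫ x, conj (h x) * g x := by
  rw [← integral_sub (integrable_conj_mul f g) (integrable_conj_mul h g)]
  refine integral_congr_ae (ae_of_all _ fun x => ?_)
  simp only [sub_apply, map_sub]
  ring

/-- The ground state `exp(-‖x‖²/2)` of the harmonic oscillator. -/
def groundState : Wave ι := gaussianWave (1 / 2) (by norm_num)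

theorem groundState_apply (x : Conf ι) :
    (groundState : Wave ι) x = Complex.exp (-(1 / 2 * ‖x‖ ^ 2 : ℝ)) := rfl

theorem hasFDerivAt_cexp_norm_sq (c : ℝ) (x : Conf ι) :
    HasFDerivAt (fun y : Conf ι => Complex.exp ((c / 2 * ‖y‖ ^ 2 : ℝ)))
      (Complex.exp ((c / 2 * ‖x‖ ^ 2 : ℝ)) • (Complex.ofRealCLM ∘L (c • innerSL ℝ x))) x := by
  have h1 : HasFDerivAt (fun y : Conf ι => c / 2 * ‖y‖ ^ 2) (c • innerSL ℝ x) x := by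
    have := ((hasStrictFDerivAt_norm_sq x).hasFDerivAt).const_mul (c / 2)
    refine this.congr_fderiv ?_
    rw [← Nat.cast_smul_eq_nsmul ℝ 2, smul_smul]
    congr 1
    push_cast
    ring
  exact (Complex.ofRealCLM.hasFDerivAt.comp x h1).cexp

theorem lineDeriv_groundState [DecidableEq ι] (j : ι) (x : Conf ι) :
    lineDeriv ℝ (groundState : Wave ι) x (EuclideanSpace.single j (1 : ℝ)) =
      -(x j : ℂ) * (groundState : Wave ι) x := by
  have h := hasFDerivAt_cexp_norm_sq (-1) x
  have h0 : (fun y : Conf ι => Complex.exp ((-1 / 2 * ‖y‖ ^ 2 : ℝ))) = (groundState : Wave ι) := by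
    funext y
    rw [groundState_apply]
    congr 1
    push_cast
    ring
  rw [h0] at h
  rw [h.differentiableAt.lineDeriv_eq_fderiv, h.fderiv]
  rw [show Complex.exp ((-1 / 2 * ‖x‖ ^ 2 : ℝ)) = (groundState : Wave ι) x from congrFun h0 x]
  simp [EuclideanSpace.inner_single_right, mul_comm]

theorem annihilate_groundState [DecidableEq ι] (j : ι) :
    positionOp j (groundState : Wave ι) + Complex.I • momentumOp j groundState = 0 := by
  ext x
  rw [add_apply, smul_apply, positionOp_apply, momentumOp_apply, lineDeriv_groundState, smul_eq_mul,
    zero_apply]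
  linear_combination (x j * (groundState : Wave ι) x) * Complex.I_mul_I

/-- The ground state is the only wave function, up to a factor, that is annihilated by all
`q_j + i p_j`. -/
theorem eq_smul_groundState [DecidableEq ι] (h : Wave ι)
    (hh : ∀ j, positionOp j h + Complex.I • momentumOp j h = 0) : ∃ c : ℂ, h = c • groundState := by
  have hd : ∀ x : Conf ι, HasFDerivAt (fun y => h y * Complex.exp ((1 / 2 * ‖y‖ ^ 2 : ℝ)))
      (0 : Conf ι →L[ℝ] ℂ) x := by
    intro x
    have h1 := (h.hasFDerivAt x).mul (hasFDerivAt_cexp_norm_sq 1 x)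
    refine h1.congr_fderiv ?_
    refine ContinuousLinearMap.coe_injective
      ((EuclideanSpace.basisFun ι ℝ).toBasis.ext fun j => ?_)
    have h2 := DFunLike.congr_fun (hh j) x
    rw [add_apply, smul_apply, positionOp_apply, momentumOp_apply, zero_apply,
      h.differentiableAt.lineDeriv_eq_fderiv, smul_eq_mul] at h2
    simp [EuclideanSpace.inner_single_right]
    linear_combination (Complex.exp (2⁻¹ * ‖x‖ ^ 2)) * h2 + Complex.exp (2⁻¹ * ‖x‖ ^ 2) *
      (fderiv ℝ h x (EuclideanSpace.single j (1 : ℝ))) * Complex.I_mul_I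
  refine ⟨h 0, SchwartzMap.ext fun x => ?_⟩
  have hc := is_const_of_fderiv_eq_zero (𝕜 := ℝ) (fun y => (hd y).differentiableAt)
    (fun y => (hd y).fderiv) x 0
  simp only [norm_zero] at hc
  rw [smul_apply, groundState_apply, smul_eq_mul]
  have h3 : h 0 = h x * Complex.exp ((1 / 2 * ‖x‖ ^ 2 : ℝ)) := by
    rw [hc]; simp
  rw [h3, mul_assoc, ← Complex.exp_add]
  simp

/-- The operator `s · q`. -/
def positionDot (s : Conf ι) : Wave ι →L[ℂ] Wave ι := ∑ j, (s j : ℂ) • positionOp j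

theorem positionDot_apply (s : Conf ι) (f : Wave ι) (x : Conf ι) :
    positionDot s f x = (inner ℝ s x : ℝ) * f x := by
  simp only [positionDot, sum_apply, smul_apply, positionOp_apply, inner_conf, smul_eq_mul]
  push_cast
  rw [Finset.sum_mul]
  exact Finset.sum_congr rfl fun j _ => by ring

theorem iterate_positionDot_apply (s : Conf ι) (n : ℕ) (f : Wave ι) (x : Conf ι) :
    ((positionDot s)^[n] f) x = ((inner ℝ s x : ℝ) : ℂ) ^ n * f x := by
  induction n with
  | zero => simp
  | succ n ih => rw [Function.iterate_succ_apply', positionDot_apply, ih, pow_succ]; ring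

theorem integrable_mul_exp_mul_groundState (h : Wave ι) (s : Conf ι) :
    Integrable fun x => ‖h x‖ * (Real.exp |inner ℝ s x| * Real.exp (-(1 / 2 * ‖x‖ ^ 2))) := by
  refine h.integrable.norm.mul_bdd (c := Real.exp (‖s‖ ^ 2 / 2)) ?_ (ae_of_all _ fun x => ?_)
  · exact Continuous.aestronglyMeasurable (by fun_prop)
  · rw [← Real.exp_add, Real.norm_of_nonneg (Real.exp_pos _).le]
    refine Real.exp_le_exp.2 ?_
    have := abs_real_inner_le_norm s x
    nlinarith [sq_nonneg (‖s‖ - ‖x‖)]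

/-- The Hermite functions are total: a wave function orthogonal to all `(s · q)ⁿ` applied to the
ground state vanishes, since the Fourier transform of its product with the ground state does. -/
theorem eq_zero_of_integral_iterate_positionDot (h : Wave ι)
    (hh : ∀ (s : Conf ι) (n : ℕ), ∫ x, conj (h x) * ((positionDot s)^[n] groundState) x = 0) :
    h = 0 := by
  set F : Conf ι → ℂ := fun x => conj (h x) * (groundState : Wave ι) x with hF
  have hFc : Continuous F :=
    (Complex.continuous_conj.comp h.continuous).mul (groundState : Wave ι).continuous
  have hfour : FourierTransform.fourier F = 0 := by
    funext ξ
    rw [Real.fourier_eq']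
    set s : Conf ι := (-2 * π) • ξ with hs
    have h1 : HasSum (fun n : ℕ => ∫ x, (Complex.I ^ n / n.factorial : ℂ) *
        (conj (h x) * ((positionDot s)^[n] groundState) x))
        (∫ x, Complex.exp ((inner ℝ s x : ℝ) * Complex.I) * F x) := by
      refine hasSum_integral_of_dominated_convergence
        (fun n x => ‖h x‖ * (|inner ℝ s x| ^ n / n.factorial * Real.exp (-(1 / 2 * ‖x‖ ^ 2))))
        (fun n => ?_) (fun n => ae_of_all _ fun x => ?_) (ae_of_all _ fun x => ?_) ?_
        (ae_of_all _ fun x => ?_)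
      · exact (continuous_const.mul ((Complex.continuous_conj.comp h.continuous).mul
          (SchwartzMap.continuous _))).aestronglyMeasurable
      · rw [iterate_positionDot_apply, groundState_apply]
        simp only [norm_mul, norm_div, norm_pow, Complex.norm_I, one_pow, RCLike.norm_conj,
          Complex.norm_real, Complex.norm_exp, Complex.norm_natCast, Real.norm_eq_abs]
        rw [← Complex.ofReal_neg, Complex.ofReal_re]
        apply le_of_eq
        ring
      · exact ((NormedSpace.expSeries_div_summable (𝔸 := ℝ) |inner ℝ s x|).mul_right _).mul_left _
      · refine (integrable_mul_exp_mul_groundState h s).congr (ae_of_all _ fun x => ?_)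
        simp only [tsum_mul_left, tsum_mul_right]
        rw [Real.exp_eq_exp_ℝ, NormedSpace.exp_eq_tsum_div]
      · have h2 := (NormedSpace.expSeries_div_hasSum_exp (𝔸 := ℂ)
          (((inner ℝ s x : ℝ) : ℂ) * Complex.I)).mul_right (F x)
        rw [← Complex.exp_eq_exp_ℂ] at h2
        refine h2.congr_fun fun n => ?_
        rw [iterate_positionDot_apply, mul_pow]
        simp only [hF]
        ring
    simp only [integral_const_mul, hh, mul_zero] at h1
    rw [Pi.zero_apply, ← h1.unique hasSum_zero]
    refine integral_congr_ae (ae_of_all _ fun x => ?_)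
    simp only [smul_eq_mul, hs, real_inner_smul_left]
    rw [real_inner_comm, mul_assoc (-2) π, neg_mul]
  have hinv := hFc.fourierInv_fourier_eq (integrable_conj_mul h groundState)
    (by rw [hfour]; exact integrable_zero _ _ _)
  ext x
  have hx : F x = 0 := by
    rw [← hinv, hfour, Real.fourierInv_eq']
    simp
  simpa [hF, groundState_apply] using hx

/-- An isometry of Schwartz space that commutes with all quadratures is a scalar. -/
theorem exists_eq_smul_of_commute_quadrature [DecidableEq ι] (T : Wave ι →ₗ[ℂ] Wave ι)
    (hT : ∀ f g : Wave ι, ∫ x, conj (T f x) * T g x = ∫ x, conj (f x) * g x)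
    (hq : ∀ a f, quadrature a (T f) = T (quadrature a f)) :
    ∃ c : ℂ, ‖c‖ = 1 ∧ ∀ f, T f = c • f := by
  obtain ⟨c, hc⟩ := eq_smul_groundState (T groundState) fun j => by
    have h1 := hq (Sum.inl j) groundState
    have h2 := hq (Sum.inr j) groundState
    simp only [quadrature, Sum.elim_inl, Sum.elim_inr] at h1 h2
    rw [h1, h2, ← map_smul, ← map_add, annihilate_groundState, map_zero]
  have hpos : (∫ x, conj ((groundState : Wave ι) x) * (groundState : Wave ι) x) ≠ 0 := by
    have h1 : ∀ x : Conf ι, conj ((groundState : Wave ι) x) * (groundState : Wave ι) x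
        = ((Real.exp (-‖x‖ ^ 2) : ℝ) : ℂ) := by
      intro x
      rw [groundState_apply, ← Complex.ofReal_neg, ← Complex.ofReal_exp, Complex.conj_ofReal,
        ← Complex.ofReal_mul, ← Real.exp_add]
      congr 2
      ring
    have hint := integrable_conj_mul (groundState : Wave ι) groundState
    simp_rw [h1] at hint ⊢
    rw [integral_complex_ofReal]
    have hint' : Integrable fun x : Conf ι => Real.exp (-‖x‖ ^ 2) := by
      simpa only [RCLike.ofReal_re, RCLike.re_to_complex, Complex.ofReal_re] using hint.re
    exact_mod_cast (integral_exp_pos hint').ne'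
  have hcc : conj c * c = 1 := by
    have h1 := hT groundState groundState
    rw [hc, integral_conj_mul_smul_right, integral_conj_mul_smul_left, ← mul_assoc] at h1
    have := mul_right_cancel₀ hpos (h1.trans (one_mul _).symm)
    rwa [mul_comm] at this
  have hnorm : ‖c‖ = 1 := by
    have : ‖c‖ ^ 2 = 1 := by
      have := congrArg norm hcc
      simpa [sq] using this
    nlinarith [norm_nonneg c]
  refine ⟨c, hnorm, fun f => ?_⟩
  have hdot : ∀ s g, positionDot s (T g) = T (positionDot s g) := by
    intro s g
    simp only [positionDot, sum_apply, smul_apply, map_sum,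
      map_smul]
    refine Finset.sum_congr rfl fun j _ => ?_
    have h1 := hq (Sum.inl j) g
    simp only [quadrature, Sum.elim_inl] at h1
    rw [h1]
  have hiter : ∀ s n, T ((positionDot s)^[n] groundState) = c • (positionDot s)^[n] groundState := by
    intro s n
    induction n with
    | zero => simpa using hc
    | succ n ih => rw [Function.iterate_succ_apply', ← hdot, ih, map_smul]
  refine sub_eq_zero.1 (eq_zero_of_integral_iterate_positionDot _ fun s n => ?_)
  set y := (positionDot s)^[n] (groundState : Wave ι)
  have h1 := hT f y
  rw [hiter, integral_conj_mul_smul_right] at h1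
  rw [integral_conj_mul_sub_left, integral_conj_mul_smul_left, ← h1, ← mul_assoc, hcc, one_mul,
    sub_self]

end Irreducible

/-! ### Gaussian unitaries and displacements -/

section GaussianUnitary

variable {ι : Type} [Fintype ι]

theorem integral_conj_displace (v : Phase ι) (f g : Wave ι) :
    ∫ x, conj (displace v f x) * displace v g x = ∫ x, conj (f x) * g x := by
  rw [← integral_sub_right_eq_self (fun x => conj (f x) * g x) (√(2 * π) • posPart v)]
  refine integral_congr_ae (ae_of_all _ fun x => ?_)
  simp only [displace_apply, map_mul]
  have h : conj (Complex.exp (displacePhase v x * Complex.I)) *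
      Complex.exp (displacePhase v x * Complex.I) = 1 := by
    rw [← Complex.exp_conj, ← Complex.exp_add]
    simp
  linear_combination (conj (f (x - √(2 * π) • posPart v)) * g (x - √(2 * π) • posPart v)) * h

/-- A Gaussian unitary with matrix `S` turns the displacement by `v` into the displacement by
`S v`, up to a phase: the two displacements translate the quadratures alike. -/
theorem IsGaussianUnitary.symm_displace [DecidableEq ι] {U : Wave ι ≃L[ℂ] Wave ι}
    {S : Matrix (ι ⊕ ι) (ι ⊕ ι) ℝ} (hU : IsGaussianUnitary U S) (v : Phase ι) :
    ∃ c : ℂ, ‖c‖ = 1 ∧ ∀ f, displace v (U.symm f) = c • U.symm (displace (S *ᵥ v) f) := by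
  have hsymm : ∀ a f, U.symm (quadrature a f) = ∑ b, (S a b : ℂ) • quadrature b (U.symm f) := by
    intro a f
    rw [ContinuousLinearEquiv.symm_apply_eq, ← hU.conj_quadrature, U.apply_symm_apply]
  have hneg : S *ᵥ (-v) = -(S *ᵥ v) := Matrix.mulVec_neg _ _
  let T : Wave ι →ₗ[ℂ] Wave ι :=
    ((displace (-(S *ᵥ v))) ∘L (U : Wave ι →L[ℂ] Wave ι) ∘L (displace v) ∘L
      (U.symm : Wave ι →L[ℂ] Wave ι) : Wave ι →L[ℂ] Wave ι)
  have hTa : ∀ f, T f = displace (-(S *ᵥ v)) (U (displace v (U.symm f))) := fun f => rfl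
  obtain ⟨c, hc, hcT⟩ := exists_eq_smul_of_commute_quadrature T
    (fun f g => by
      rw [hTa, hTa, integral_conj_displace, hU.inner_eq, integral_conj_displace, ← hU.inner_eq,
        U.apply_symm_apply, U.apply_symm_apply])
    (fun a f => by
      have h1 : ∑ b, (S a b : ℂ) • quadrature b (displace v (U.symm f)) =
          displace v (U.symm (quadrature a f)) +
            ((√(2 * π) * (S *ᵥ v) a : ℝ) : ℂ) • displace v (U.symm f) := by
        simp_rw [quadrature_displace, smul_add, Finset.sum_add_distrib, smul_smul,
          ← Finset.sum_smul]
        rw [hsymm, map_sum]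
        simp_rw [map_smul]
        congr 2
        simp only [Matrix.mulVec, dotProduct]
        push_cast
        rw [Finset.mul_sum]
        exact Finset.sum_congr rfl fun b _ => by ring
      rw [hTa, hTa, quadrature_displace, hU.conj_quadrature, h1, map_add, map_add, map_smul,
        map_smul, add_assoc, ← add_smul, ← Complex.ofReal_add]
      have : √(2 * π) * (S *ᵥ v) a + √(2 * π) * (-(S *ᵥ v)) a = 0 := by
        rw [Pi.neg_apply]; ring
      rw [this]
      simp)
  refine ⟨c, hc, fun f => ?_⟩
  have h := hcT f
  rw [hTa] at h
  have h2 := congrArg (displace (S *ᵥ v)) h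
  rw [displace_displace_neg, map_smul] at h2
  rw [← map_smul, ← h2, U.symm_apply_apply]

end GaussianUnitary

/-! ### Normal laws -/

section Normal

variable {κ : Type} [Fintype κ]

/-- The standard normal law `exp(-π z · z) dz`: every coordinate has variance `1/(2π)`. -/
def stdLaw (κ : Type) [Fintype κ] : Measure (κ → ℝ) :=
  Measure.pi fun _ => gaussianReal 0 (Real.toNNReal (2 * π)⁻¹)

instance : IsProbabilityMeasure (stdLaw κ) := by
  unfold stdLaw; infer_instance

theorem gaussianPDFReal_std (x : ℝ) :
    gaussianPDFReal 0 (Real.toNNReal (2 * π)⁻¹) x = Real.exp (-π * x ^ 2) := by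
  have h : ((Real.toNNReal (2 * π)⁻¹ : NNReal) : ℝ) = (2 * π)⁻¹ :=
    Real.coe_toNNReal _ (by positivity)
  rw [gaussianPDFReal_def, h, mul_inv_cancel₀ (by positivity)]
  simp only [Real.sqrt_one, inv_one, one_mul, sub_zero]
  congr 1
  field_simp

theorem stdVariance_ne_zero : Real.toNNReal (2 * π)⁻¹ ≠ 0 := by
  have : 0 < (2 * π)⁻¹ := by positivity
  simpa using this

theorem stdLaw_eq_withDensity : stdLaw κ =
    volume.withDensity fun z => ENNReal.ofReal (Real.exp (-π * (z ⬝ᵥ z))) := by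
  refine Measure.pi_eq fun s hs => ?_
  have hprod : ∀ z : κ → ℝ, (univ.pi s).indicator (fun z => Real.exp (-π * (z ⬝ᵥ z))) z
      = ∏ i, (s i).indicator (fun x => Real.exp (-π * x ^ 2)) (z i) := by
    intro z
    by_cases hz : z ∈ univ.pi s
    · rw [indicator_of_mem hz]
      rw [Finset.prod_congr rfl fun i _ => indicator_of_mem (hz i (mem_univ i)) _, ← Real.exp_sum,
        dotProduct, Finset.mul_sum]
      simp_rw [sq]
    · rw [indicator_of_notMem hz]
      simp only [Set.mem_pi, mem_univ, true_imp_iff, not_forall] at hz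
      obtain ⟨i, hi⟩ := hz
      exact (Finset.prod_eq_zero (Finset.mem_univ i) (indicator_of_notMem hi _)).symm
  have hint : ∀ i, Integrable ((s i).indicator fun x : ℝ => Real.exp (-π * x ^ 2)) := fun i =>
    (integrable_exp_neg_mul_sq pi_pos).indicator (hs i)
  have hnn : ∀ i x, 0 ≤ (s i).indicator (fun x : ℝ => Real.exp (-π * x ^ 2)) x := fun i x =>
    indicator_nonneg (fun _ _ => (Real.exp_pos _).le) x
  rw [withDensity_apply _ (MeasurableSet.univ_pi hs), ← lintegral_indicator (MeasurableSet.univ_pi hs)]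
  have h1 : ∀ z : κ → ℝ, (univ.pi s).indicator
      (fun z => ENNReal.ofReal (Real.exp (-π * (z ⬝ᵥ z)))) z =
      ENNReal.ofReal (∏ i, (s i).indicator (fun x => Real.exp (-π * x ^ 2)) (z i)) := by
    intro z
    rw [← hprod]
    by_cases hz : z ∈ univ.pi s
    · rw [indicator_of_mem hz, indicator_of_mem hz]
    · rw [indicator_of_notMem hz, indicator_of_notMem hz, ENNReal.ofReal_zero]
  simp_rw [h1]
  have hI : Integrable fun z : κ → ℝ => ∏ i, (s i).indicator (fun x => Real.exp (-π * x ^ 2)) (z i) :=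
    Integrable.fintype_prod hint
  rw [← ofReal_integral_eq_lintegral_ofReal hI
    (ae_of_all _ fun z => Finset.prod_nonneg fun i _ => hnn i (z i)),
    integral_fintype_prod_volume_eq_prod, ENNReal.ofReal_prod_of_nonneg
      fun i _ => integral_nonneg (hnn i)]
  refine Finset.prod_congr rfl fun i _ => ?_
  rw [ofReal_integral_eq_lintegral_ofReal (hint i) (ae_of_all _ (hnn i)),
    gaussianReal_of_var_ne_zero _ stdVariance_ne_zero, withDensity_apply _ (hs i),
    ← lintegral_indicator (hs i)]
  refine lintegral_congr fun x => ?_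
  by_cases hx : x ∈ s i
  · rw [indicator_of_mem hx, indicator_of_mem hx, gaussianPDF, gaussianPDFReal_std]
  · rw [indicator_of_notMem hx, indicator_of_notMem hx, ENNReal.ofReal_zero]

variable [DecidableEq κ]

/-- The normal density on `κ → ℝ` with mean `μ`, where `Sig / (2π)` is the covariance matrix. -/
def normalDensity (μ : κ → ℝ) (Sig : Matrix κ κ ℝ) (v : κ → ℝ) : ℝ :=
  Real.exp (-π * ((v - μ) ⬝ᵥ (Sig⁻¹ *ᵥ (v - μ)))) / √|Sig.det|

theorem normalDensity_nonneg (μ : κ → ℝ) (Sig : Matrix κ κ ℝ) (v : κ → ℝ) :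
    0 ≤ normalDensity μ Sig v := by
  unfold normalDensity; positivity

theorem continuous_normalDensity (Sig : Matrix κ κ ℝ) :
    Continuous fun p : (κ → ℝ) × (κ → ℝ) => normalDensity p.1 Sig p.2 := by
  unfold normalDensity
  refine Continuous.div_const (Real.continuous_exp.comp (continuous_const.mul ?_)) _
  exact (continuous_snd.sub continuous_fst).dotProduct
    (continuous_const.matrix_mulVec (continuous_snd.sub continuous_fst))

theorem continuous_normalDensity_right (μ : κ → ℝ) (Sig : Matrix κ κ ℝ) :
    Continuous (normalDensity μ Sig) :=
  (continuous_normalDensity Sig).comp (continuous_const.prodMk continuous_id)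

/-- The law with density `normalDensity μ Sig`. -/
def normalLaw (μ : κ → ℝ) (Sig : Matrix κ κ ℝ) : Measure (κ → ℝ) :=
  volume.withDensity fun v => ENNReal.ofReal (normalDensity μ Sig v)

/-- A normal law is the image of the standard normal law under an affine map. -/
theorem normalLaw_eq_map {R : Matrix κ κ ℝ} (hR : R.det ≠ 0) (μ : κ → ℝ) :
    normalLaw μ (R * Rᵀ) = (stdLaw κ).map fun z => μ + R *ᵥ z := by
  have hm : Measurable fun z : κ → ℝ => μ + R *ᵥ z := by
    refine Continuous.measurable (continuous_const.add ?_)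
    exact continuous_const.matrix_mulVec continuous_id
  have hu : IsUnit R.det := isUnit_iff_ne_zero.2 hR
  have hdens : ∀ z : κ → ℝ, ENNReal.ofReal (Real.exp (-π * (z ⬝ᵥ z))) =
      ENNReal.ofReal |R.det| * ENNReal.ofReal (normalDensity μ (R * Rᵀ) (μ + R *ᵥ z)) := by
    intro z
    rw [← ENNReal.ofReal_mul (abs_nonneg _), normalDensity, add_sub_cancel_left, Matrix.det_mul,
      Matrix.det_transpose, abs_mul, Real.sqrt_mul_self (abs_nonneg _),
      mul_div_cancel₀ _ (abs_ne_zero.2 hR)]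
    congr 3
    rw [Matrix.mul_inv_rev, ← Matrix.mulVec_mulVec, Matrix.mulVec_mulVec z R⁻¹ R,
      Matrix.nonsing_inv_mul _ hu, Matrix.one_mulVec, Matrix.dotProduct_mulVec,
      ← Matrix.transpose_nonsing_inv, Matrix.vecMul_transpose, Matrix.mulVec_mulVec,
      Matrix.nonsing_inv_mul _ hu, Matrix.one_mulVec]
  have hmap : (volume : Measure (κ → ℝ)).map (fun z => μ + R *ᵥ z) =
      ENNReal.ofReal |R.det|⁻¹ • volume := by
    have h1 := Real.map_matrix_volume_pi_eq_smul_volume_pi hR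
    have h2 : (fun z : κ → ℝ => μ + R *ᵥ z) = (fun x => μ + x) ∘ (Matrix.toLin' R) := by
      funext z; simp
    rw [h2, ← Measure.map_map (measurable_const_add μ)
      (LinearMap.continuous_of_finiteDimensional _).measurable, h1, Measure.map_smul,
      map_add_left_eq_self, abs_inv]
  have hnm : Measurable fun v => ENNReal.ofReal (normalDensity μ (R * Rᵀ) v) :=
    (continuous_normalDensity_right _ _).measurable.ennreal_ofReal
  ext s hs
  rw [Measure.map_apply hm hs, stdLaw_eq_withDensity, withDensity_apply _ (hm hs), normalLaw,
    withDensity_apply _ hs]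
  simp_rw [hdens]
  rw [lintegral_const_mul (f := fun z => ENNReal.ofReal (normalDensity μ (R * Rᵀ) (μ + R *ᵥ z))) _
      (hnm.comp hm),
    ← setLIntegral_map (μ := volume) (g := fun z => μ + R *ᵥ z) hs hnm hm, hmap,
    Measure.restrict_smul, lintegral_smul_measure, smul_eq_mul, ← mul_assoc,
    ← ENNReal.ofReal_mul (abs_nonneg _), mul_inv_cancel₀ (abs_ne_zero.2 hR), ENNReal.ofReal_one,
    one_mul]

open scoped MatrixOrder in
theorem exists_eq_mul_transpose {Sig : Matrix κ κ ℝ} (hS : Sig.PosDef) :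
    ∃ R : Matrix κ κ ℝ, R.det ≠ 0 ∧ Sig = R * Rᵀ := by
  have h0 : (0 : Matrix κ κ ℝ) ≤ Sig := Matrix.nonneg_iff_posSemidef.2 hS.posSemidef
  have h1 : Sig = CFC.sqrt Sig * (CFC.sqrt Sig)ᵀ := by
    have h2 : (CFC.sqrt Sig)ᵀ = CFC.sqrt Sig := by
      have := (CFC.sqrt_nonneg Sig).isSelfAdjoint
      rwa [IsSelfAdjoint, Matrix.star_eq_conjTranspose, Matrix.conjTranspose_eq_transpose_of_trivial]
        at this
    rw [h2, CFC.sqrt_mul_sqrt_self Sig h0]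
  refine ⟨_, fun h => ?_, h1⟩
  have := hS.det_pos
  rw [h1, Matrix.det_mul, h, zero_mul] at this
  exact lt_irrefl _ this

theorem charFunDual_stdLaw (L : StrongDual ℝ (κ → ℝ)) : charFunDual (stdLaw κ) L =
    Complex.exp (-((∑ i, L (Pi.single i 1) ^ 2) / (4 * π) : ℝ)) := by
  rw [stdLaw, charFunDual_pi, Complex.ofReal_div, Complex.ofReal_sum, Finset.sum_div,
    ← Finset.sum_neg_distrib, Complex.exp_sum]
  refine Finset.prod_congr rfl fun i _ => ?_
  have h : ∀ M : StrongDual ℝ ℝ, charFunDual (gaussianReal 0 (Real.toNNReal (2 * π)⁻¹)) M =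
      charFun (gaussianReal 0 (Real.toNNReal (2 * π)⁻¹)) (M 1) := by
    intro M
    rw [charFunDual_apply, charFun_apply_real]
    refine integral_congr_ae (ae_of_all _ fun x => ?_)
    have : M x = M 1 * x := by
      have := M.map_smul x 1
      rw [smul_eq_mul, mul_one, smul_eq_mul] at this
      rw [this, mul_comm]
    simp only [this]
    push_cast
    rfl
  rw [h, charFun_gaussianReal]
  congr 1
  have h2 : ((Real.toNNReal (2 * π)⁻¹ : NNReal) : ℝ) = (2 * π)⁻¹ :=
    Real.coe_toNNReal _ (by positivity)
  have h3 : (((Real.toNNReal (2 * π)⁻¹ : NNReal) : ℝ) : ℂ) = (2 * π : ℂ)⁻¹ := by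
    rw [h2]; push_cast; rfl
  rw [h3]
  simp only [ContinuousLinearMap.comp_apply, ContinuousLinearMap.single_apply]
  have hpi : (π : ℂ) ≠ 0 := by exact_mod_cast pi_ne_zero
  push_cast
  field_simp
  ring

/-- Linear images of standard normal laws agree if their covariance matrices do. -/
theorem map_stdLaw_eq_of_mul_transpose_eq {ι ι' : Type} [Fintype ι] [DecidableEq ι] [Fintype ι']
    [DecidableEq ι'] {R : Matrix κ ι ℝ} {T : Matrix κ ι' ℝ} (h : R * Rᵀ = T * Tᵀ) :
    (stdLaw ι).map (fun z => R *ᵥ z) = (stdLaw ι').map (fun z => T *ᵥ z) := by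
  have key : ∀ {ι : Type} [Fintype ι] [DecidableEq ι] (R : Matrix κ ι ℝ)
      (L : StrongDual ℝ (κ → ℝ)), charFunDual ((stdLaw ι).map fun z => R *ᵥ z) L =
      Complex.exp (-(((fun k => L (Pi.single k 1)) ⬝ᵥ
        ((R * Rᵀ) *ᵥ fun k => L (Pi.single k 1))) / (4 * π) : ℝ)) := by
    intro ι _ _ R L
    have h1 : (fun z : ι → ℝ => R *ᵥ z) = (Matrix.toLin' R).toContinuousLinearMap := by
      funext z; simp
    rw [h1, charFunDual_map, charFunDual_stdLaw]
    congr 4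
    rw [← Matrix.mulVec_mulVec, Matrix.dotProduct_mulVec, ← Matrix.mulVec_transpose, dotProduct]
    refine Finset.sum_congr rfl fun i _ => ?_
    have h2 : (L.comp (Matrix.toLin' R).toContinuousLinearMap) (Pi.single i 1) =
        (Rᵀ *ᵥ fun k => L (Pi.single k 1)) i := by
      have h3 : (Matrix.toLin' R).toContinuousLinearMap (Pi.single i 1) =
          ∑ k, R k i • (Pi.single k 1 : κ → ℝ) := by
        funext k
        simp [Finset.sum_apply, Pi.single_apply]
      rw [ContinuousLinearMap.comp_apply, h3, map_sum]
      simp [Matrix.mulVec, dotProduct]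
    rw [h2, sq]
  have : IsFiniteMeasure ((stdLaw ι).map (fun z => R *ᵥ z)) := inferInstance
  have : IsFiniteMeasure ((stdLaw ι').map (fun z => T *ᵥ z)) := inferInstance
  refine Measure.ext_of_charFunDual (funext fun L => ?_)
  rw [key, key, h]

end Normal

section NormalLaw

variable {κ : Type} [Fintype κ] [DecidableEq κ]

theorem continuous_mulVec {κ ι : Type} [Fintype ι] (R : Matrix κ ι ℝ) :
    Continuous fun z : ι → ℝ => R *ᵥ z :=
  continuous_const.matrix_mulVec continuous_id

theorem measurable_const_add_mulVec {κ ι : Type} [Fintype κ] [Fintype ι] (μ : κ → ℝ) (R : Matrix κ ι ℝ) :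
    Measurable fun z : ι → ℝ => μ + R *ᵥ z := by
  have h : Continuous fun z : ι → ℝ => μ + R *ᵥ z := continuous_const.add (continuous_mulVec R)
  exact h.measurable

theorem integral_normalLaw (μ : κ → ℝ) (Sig : Matrix κ κ ℝ) (F : (κ → ℝ) → ℂ) :
    ∫ v, F v ∂normalLaw μ Sig = ∫ v, (normalDensity μ Sig v : ℂ) * F v := by
  rw [normalLaw, integral_withDensity_eq_integral_toReal_smul
    (continuous_normalDensity_right _ _).measurable.ennreal_ofReal
    (ae_of_all _ fun v => ENNReal.ofReal_lt_top)]
  refine integral_congr_ae (ae_of_all _ fun v => ?_)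
  simp only [ENNReal.toReal_ofReal (normalDensity_nonneg _ _ _), Complex.real_smul]

theorem isProbabilityMeasure_normalLaw {Sig : Matrix κ κ ℝ} (hS : Sig.PosDef) (μ : κ → ℝ) :
    IsProbabilityMeasure (normalLaw μ Sig) := by
  obtain ⟨R, hR, rfl⟩ := exists_eq_mul_transpose hS
  rw [normalLaw_eq_map hR]
  exact Measure.isProbabilityMeasure_map
    (measurable_const_add_mulVec _ R).aemeasurable

theorem normalLaw_eq_map_add {Sig : Matrix κ κ ℝ} (hS : Sig.PosDef) (μ : κ → ℝ) :
    normalLaw μ Sig = (normalLaw 0 Sig).map fun v => μ + v := by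
  obtain ⟨R, hR, rfl⟩ := exists_eq_mul_transpose hS
  rw [normalLaw_eq_map hR, normalLaw_eq_map hR, Measure.map_map (measurable_const_add μ)
    (measurable_const_add_mulVec _ R)]
  congr 1
  funext z
  simp

theorem integrable_normalDensity {Sig : Matrix κ κ ℝ} (hS : Sig.PosDef) (μ : κ → ℝ) :
    Integrable (normalDensity μ Sig) := by
  have h := isProbabilityMeasure_normalLaw hS μ
  refine ⟨(continuous_normalDensity_right _ _).aestronglyMeasurable, ?_⟩
  have h1 := h.measure_univ
  rw [normalLaw, withDensity_apply _ MeasurableSet.univ, Measure.restrict_univ] at h1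
  rw [hasFiniteIntegral_iff_ofReal (ae_of_all _ (normalDensity_nonneg μ Sig)), h1]
  exact ENNReal.one_lt_top

theorem integral_normalDensity {Sig : Matrix κ κ ℝ} (hS : Sig.PosDef) (μ : κ → ℝ) :
    ∫ v, normalDensity μ Sig v = 1 := by
  have h := isProbabilityMeasure_normalLaw hS μ
  have h1 := h.measure_univ
  rw [normalLaw, withDensity_apply _ MeasurableSet.univ, Measure.restrict_univ,
    ← ofReal_integral_eq_lintegral_ofReal (integrable_normalDensity hS μ)
    (ae_of_all _ (normalDensity_nonneg μ Sig)), ENNReal.ofReal_eq_one] at h1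
  exact h1

theorem normalDensity_le {Sig : Matrix κ κ ℝ} (hS : Sig.PosDef) (μ v : κ → ℝ) :
    normalDensity μ Sig v ≤ 1 / √|Sig.det| := by
  unfold normalDensity
  gcongr
  have h1 : 0 ≤ (v - μ) ⬝ᵥ (Sig⁻¹ *ᵥ (v - μ)) := by
    simpa using hS.posSemidef.inv.dotProduct_mulVec_nonneg (v - μ)
  rw [Real.exp_le_one_iff]
  nlinarith [pi_pos]

/-- Conditioning of a normal vector: if `R v` has the covariance blocks `P`, `Q`, `G`, then its
`Y`-part is normal with covariance `G`, and given the value `a` of the `Y`-part its `D`-part is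
normal with mean `Q G⁻¹ a` and the Schur complement `P - Q G⁻¹ Qᵀ` as covariance. -/
theorem integral_stdLaw_eq_conditional {D Y ι : Type} [Fintype D] [DecidableEq D] [Fintype Y]
    [DecidableEq Y] [Fintype ι] [DecidableEq ι] {R : Matrix (D ⊕ Y) ι ℝ} {P : Matrix D D ℝ}
    {Q : Matrix D Y ℝ} {G : Matrix Y Y ℝ} (hR : R * Rᵀ = Matrix.fromBlocks P Q Qᵀ G)
    (hG : G.PosDef) (hSig : (P - Q * G⁻¹ * Qᵀ).PosDef) (Φ : (D → ℝ) → (Y → ℝ) → ℂ)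
    (hΦ : Continuous fun p : (D → ℝ) × (Y → ℝ) => Φ p.1 p.2) (B : ℝ) (hB : ∀ u a, ‖Φ u a‖ ≤ B) :
    ∫ v, Φ (fun i => (R *ᵥ v) (Sum.inl i)) (fun j => (R *ᵥ v) (Sum.inr j)) ∂stdLaw ι =
      ∫ a, ∫ u, Φ u a ∂normalLaw ((Q * G⁻¹) *ᵥ a) (P - Q * G⁻¹ * Qᵀ) ∂normalLaw 0 G := by
  obtain ⟨R₁, hR₁, h₁⟩ := exists_eq_mul_transpose hSig
  obtain ⟨R₂, hR₂, h₂⟩ := exists_eq_mul_transpose hG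
  set L := Q * G⁻¹ with hL
  have hGu : IsUnit G.det := isUnit_iff_ne_zero.2 hG.det_pos.ne'
  have hLG : L * G = Q := by
    rw [hL, Matrix.mul_assoc, Matrix.nonsing_inv_mul _ hGu, Matrix.mul_one]
  have hGt : Gᵀ = G := by
    rw [h₂, Matrix.transpose_mul, Matrix.transpose_transpose]
  have hGL : G * Lᵀ = Qᵀ := by
    have := congrArg Matrix.transpose hLG
    rwa [Matrix.transpose_mul, hGt] at this
  set T : Matrix (D ⊕ Y) (D ⊕ Y) ℝ := Matrix.fromBlocks R₁ (L * R₂) 0 R₂ with hT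
  have hTT : R * Rᵀ = T * Tᵀ := by
    rw [hR, hT, Matrix.fromBlocks_transpose, Matrix.fromBlocks_multiply]
    congr 1
    · rw [← h₁, Matrix.transpose_mul, Matrix.mul_assoc L, ← Matrix.mul_assoc R₂, ← h₂, hGL]
      simp
    · rw [Matrix.mul_assoc, ← h₂, hLG]; simp
    · rw [Matrix.transpose_mul, ← Matrix.mul_assoc, ← h₂, hGL]; simp
    · rw [← h₂]; simp
  set Ψ : (D ⊕ Y → ℝ) → ℂ := fun w => Φ (fun i => w (Sum.inl i)) fun j => w (Sum.inr j) with hΨ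
  have hΨc : Continuous Ψ := hΦ.comp (Continuous.prodMk
    (continuous_pi fun i => continuous_apply _) (continuous_pi fun i => continuous_apply _))
  have e1 : ∫ v, Ψ (R *ᵥ v) ∂stdLaw ι = ∫ z, Ψ (T *ᵥ z) ∂stdLaw (D ⊕ Y) := by
    rw [← integral_map (μ := stdLaw ι) (f := Ψ) (continuous_mulVec R).measurable.aemeasurable
      hΨc.aestronglyMeasurable, map_stdLaw_eq_of_mul_transpose_eq hTT,
      integral_map (continuous_mulVec T).measurable.aemeasurable hΨc.aestronglyMeasurable]
  have e2 : ∫ z, Ψ (T *ᵥ z) ∂stdLaw (D ⊕ Y) =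
      ∫ p, Φ (L *ᵥ (R₂ *ᵥ p.2) + R₁ *ᵥ p.1) (R₂ *ᵥ p.2) ∂(stdLaw D).prod (stdLaw Y) := by
    have hmp := measurePreserving_sumPiEquivProdPi_symm
      (X := fun _ : D ⊕ Y => ℝ) fun _ => gaussianReal 0 (Real.toNNReal (2 * π)⁻¹)
    have h3 := hmp.integral_comp (MeasurableEquiv.measurableEmbedding _) fun z => Ψ (T *ᵥ z)
    refine h3.symm.trans (integral_congr_ae (ae_of_all _ fun p => ?_))
    have h4 : T *ᵥ ((MeasurableEquiv.sumPiEquivProdPi fun _ : D ⊕ Y => ℝ).symm p) =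
        Sum.elim (L *ᵥ (R₂ *ᵥ p.2) + R₁ *ᵥ p.1) (R₂ *ᵥ p.2) := by
      have h5 : ((MeasurableEquiv.sumPiEquivProdPi fun _ : D ⊕ Y => ℝ).symm p) =
          Sum.elim p.1 p.2 := by
        funext i; cases i <;> rfl
      rw [h5, hT, Matrix.fromBlocks_mulVec]
      simp [Matrix.mulVec_mulVec, add_comm]
    simp only [h4, hΨ, Sum.elim_inl, Sum.elim_inr]
  have hcont : Continuous fun p : (D → ℝ) × (Y → ℝ) =>
      Φ (L *ᵥ (R₂ *ᵥ p.2) + R₁ *ᵥ p.1) (R₂ *ᵥ p.2) :=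
    hΦ.comp ((((continuous_mulVec L).comp ((continuous_mulVec R₂).comp continuous_snd)).add
      ((continuous_mulVec R₁).comp continuous_fst)).prodMk
        ((continuous_mulVec R₂).comp continuous_snd))
  have hcont' : Continuous fun p : (Y → ℝ) × (D → ℝ) => Φ (L *ᵥ p.1 + R₁ *ᵥ p.2) p.1 :=
    hΦ.comp ((((continuous_mulVec L).comp continuous_fst).add
      ((continuous_mulVec R₁).comp continuous_snd)).prodMk continuous_fst)
  have e4 : ∀ a, ∫ u, Φ u a ∂normalLaw (L *ᵥ a) (P - L * Qᵀ) =
      ∫ x, Φ (L *ᵥ a + R₁ *ᵥ x) a ∂stdLaw D := by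
    intro a
    rw [h₁, normalLaw_eq_map hR₁, integral_map
      (measurable_const_add_mulVec _ R₁).aemeasurable]
    exact (hΦ.comp (continuous_id.prodMk continuous_const)).aestronglyMeasurable
  have hmeas : StronglyMeasurable fun a => ∫ x, Φ (L *ᵥ a + R₁ *ᵥ x) a ∂stdLaw D :=
    hcont'.stronglyMeasurable.integral_prod_right'
  rw [show (fun v => Φ (fun i => (R *ᵥ v) (Sum.inl i)) fun j => (R *ᵥ v) (Sum.inr j)) =
    fun v => Ψ (R *ᵥ v) from rfl, e1, e2, integral_prod_symm]
  · simp_rw [e4]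
    rw [h₂, normalLaw_eq_map hR₂, integral_map
      (measurable_const_add_mulVec _ R₂).aemeasurable
      hmeas.aestronglyMeasurable]
    simp only [zero_add]
  · exact Integrable.of_bound hcont.aestronglyMeasurable B (ae_of_all _ fun p => hB _ _)

end NormalLaw

/-! ### Second moments of normal laws -/

section Moments

variable {κ : Type} [Fintype κ]

theorem memLp_eval_stdLaw (k : κ) : MemLp (fun z : κ → ℝ => z k) 2 (stdLaw κ) := by
  have h1 : MemLp id 2 (gaussianReal 0 (Real.toNNReal (2 * π)⁻¹)) :=
    memLp_id_gaussianReal' 2 (by norm_num)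
  exact h1.comp_measurePreserving (measurePreserving_eval _ k)

theorem memLp_dotProduct {ν : Measure (κ → ℝ)} (h : ∀ k, MemLp (fun v : κ → ℝ => v k) 2 ν)
    (c : κ → ℝ) : MemLp (fun v : κ → ℝ => c ⬝ᵥ v) 2 ν :=
  memLp_finsetSum _ fun i _ => (h i).const_mul _

variable [DecidableEq κ]

theorem memLp_eval_normalLaw {Sig : Matrix κ κ ℝ} (hS : Sig.PosDef) (μ : κ → ℝ) (k : κ) :
    MemLp (fun v : κ → ℝ => v k) 2 (normalLaw μ Sig) := by
  obtain ⟨R, hR, rfl⟩ := exists_eq_mul_transpose hS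
  rw [normalLaw_eq_map hR, memLp_map_measure_iff (continuous_apply k).aestronglyMeasurable
    (measurable_const_add_mulVec _ R).aemeasurable]
  have h1 : (fun v : κ → ℝ => v k) ∘ (fun z => μ + R *ᵥ z) =
      fun z => μ k + ∑ i, R k i * z i := by
    funext z; simp [Matrix.mulVec, dotProduct]
  rw [h1]
  have h2 : MemLp (fun z : κ → ℝ => ∑ i, R k i * z i) 2 (stdLaw κ) :=
    memLp_finsetSum Finset.univ fun i _ => (memLp_eval_stdLaw i).const_mul (R k i)
  have h3 : MemLp (fun _ : κ → ℝ => μ k) 2 (stdLaw κ) := memLp_const _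
  exact h3.add h2

theorem variance_normalLaw {Sig : Matrix κ κ ℝ} (hS : Sig.PosDef) (μ c : κ → ℝ) :
    Var[fun v => c ⬝ᵥ v; normalLaw μ Sig] = (c ⬝ᵥ (Sig *ᵥ c)) / (2 * π) := by
  obtain ⟨R, hR, rfl⟩ := exists_eq_mul_transpose hS
  have hc : Continuous fun v : κ → ℝ => c ⬝ᵥ v := continuous_const.dotProduct continuous_id
  rw [normalLaw_eq_map hR, variance_map hc.aemeasurable
    (measurable_const_add_mulVec _ R).aemeasurable]
  have h1 : (fun v : κ → ℝ => c ⬝ᵥ v) ∘ (fun z => μ + R *ᵥ z) =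
      fun z => c ⬝ᵥ μ + (∑ i, fun z : κ → ℝ => (Rᵀ *ᵥ c) i * z i) z := by
    funext z
    simp only [Function.comp_apply, dotProduct_add, Matrix.dotProduct_mulVec, Finset.sum_apply,
      Matrix.mulVec_transpose]
    rfl
  have hm : ∀ i : κ, MemLp (fun x : ℝ => (Rᵀ *ᵥ c) i * x) 2
      (gaussianReal 0 (Real.toNNReal (2 * π)⁻¹)) := fun i =>
    (memLp_id_gaussianReal' 2 (by norm_num)).const_mul _
  have hm' : MemLp (∑ i, fun z : κ → ℝ => (Rᵀ *ᵥ c) i * z i) 2 (stdLaw κ) :=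
    memLp_finsetSum' _ fun i _ => (memLp_eval_stdLaw i).const_mul _
  rw [h1, variance_const_add hm'.aestronglyMeasurable, stdLaw, variance_sum_pi hm]
  have hv : ∀ i : κ, Var[fun x : ℝ => (Rᵀ *ᵥ c) i * x;
      gaussianReal 0 (Real.toNNReal (2 * π)⁻¹)] = (Rᵀ *ᵥ c) i ^ 2 * (2 * π)⁻¹ := by
    intro i
    rw [variance_const_mul, variance_fun_id_gaussianReal, Real.coe_toNNReal _ (by positivity)]
  rw [Finset.sum_congr rfl fun i _ => hv i, ← Finset.sum_mul, ← div_eq_mul_inv,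
    ← Matrix.mulVec_mulVec, Matrix.dotProduct_mulVec, ← Matrix.mulVec_transpose, dotProduct]
  simp_rw [sq]

end Moments

/-! ### Mixtures of normal laws -/

section Mixture

variable {ι : Type} {Sig : Matrix (ι ⊕ ι) (ι ⊕ ι) ℝ}

theorem GaussianMixture.countable_index (M : GaussianMixture Sig) : Countable M.Index := by
  have h := M.weight_sum.summable.countable_support
  rwa [Function.support_eq_univ fun i => (M.weight_pos i).ne', countable_univ_iff] at h

theorem GaussianMixture.tsum_ofReal_weight (M : GaussianMixture Sig) :
    ∑' i, ENNReal.ofReal (M.weight i) = 1 := by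
  rw [← ENNReal.ofReal_tsum_of_nonneg (fun i => (M.weight_pos i).le) M.weight_sum.summable,
    M.weight_sum.tsum_eq, ENNReal.ofReal_one]

variable [Fintype ι] [DecidableEq ι]

theorem gaussianDensity_eq_normalDensity (μ : Phase ι) (Sig : Matrix (ι ⊕ ι) (ι ⊕ ι) ℝ) :
    gaussianDensity μ Sig = normalDensity μ Sig := rfl

theorem gaussianDensity_nonneg (μ : Phase ι) (Sig : Matrix (ι ⊕ ι) (ι ⊕ ι) ℝ) (v : Phase ι) :
    0 ≤ gaussianDensity μ Sig v := normalDensity_nonneg μ Sig v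

theorem GaussianMixture.summable_density (M : GaussianMixture Sig) (hS : Sig.PosDef) (v : Phase ι) :
    Summable fun i => M.weight i * gaussianDensity (M.mean i) Sig v := by
  refine Summable.of_nonneg_of_le
    (fun i => mul_nonneg (M.weight_pos i).le (gaussianDensity_nonneg _ _ _))
    (fun i => ?_) (M.weight_sum.summable.mul_right (1 / √|Sig.det|))
  exact mul_le_mul_of_nonneg_left (normalDensity_le hS _ _) (M.weight_pos i).le

theorem GaussianMixture.displacementLaw_eq (M : GaussianMixture Sig) (hS : Sig.PosDef) :
    displacementLaw M.density =
      Measure.sum fun i => ENNReal.ofReal (M.weight i) • normalLaw (M.mean i) Sig := by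
  have := M.countable_index
  have hm : ∀ i, Measurable fun v => ENNReal.ofReal (gaussianDensity (M.mean i) Sig v) := fun i =>
    (continuous_normalDensity_right _ _).measurable.ennreal_ofReal
  have h1 : (fun v => ENNReal.ofReal (M.density v)) =
      ∑' i, ENNReal.ofReal (M.weight i) • fun v => ENNReal.ofReal (gaussianDensity (M.mean i) Sig v) := by
    funext v
    rw [tsum_apply (Pi.summable.2 fun _ => ENNReal.summable)]
    · rw [GaussianMixture.density, ENNReal.ofReal_tsum_of_nonneg
        (fun i => mul_nonneg (M.weight_pos i).le (gaussianDensity_nonneg _ _ _))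
        (M.summable_density hS v)]
      exact tsum_congr fun i => ENNReal.ofReal_mul (M.weight_pos i).le
  rw [displacementLaw, h1, withDensity_tsum fun i => (hm i).const_smul _]
  congr 1
  funext i
  rw [withDensity_smul _ (hm i)]
  rfl

theorem GaussianMixture.lintegral_displacementLaw (M : GaussianMixture Sig) (hS : Sig.PosDef)
    (F : Phase ι → ENNReal) : ∫⁻ v, F v ∂displacementLaw M.density =
      ∑' i, ENNReal.ofReal (M.weight i) * ∫⁻ v, F v ∂normalLaw (M.mean i) Sig := by
  rw [M.displacementLaw_eq hS, lintegral_sum_measure]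
  simp_rw [lintegral_smul_measure, smul_eq_mul]

theorem GaussianMixture.isProbabilityMeasure (M : GaussianMixture Sig) (hS : Sig.PosDef) :
    IsProbabilityMeasure (displacementLaw M.density) := by
  refine ⟨?_⟩
  have h := M.lintegral_displacementLaw hS fun _ => 1
  have h1 : ∀ i, normalLaw (M.mean i) Sig univ = 1 := fun i =>
    (isProbabilityMeasure_normalLaw hS _).measure_univ
  simp only [lintegral_const, one_mul, h1, mul_one, M.tsum_ofReal_weight] at h
  exact h

/-- A mixture has finite second moments as soon as its means have. -/
theorem GaussianMixture.hasFiniteVariance (M : GaussianMixture Sig) (hS : Sig.PosDef)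
    (hM : ∀ a, Summable fun i => M.weight i * M.mean i a ^ 2) : HasFiniteVariance M.density := by
  intro a
  have hma : Measurable fun v : Phase ι => v a := measurable_pi_apply a
  have := isProbabilityMeasure_normalLaw hS 0
  rw [memLp_two_iff_integrable_sq hma.aestronglyMeasurable]
  refine ⟨(hma.pow_const 2).aestronglyMeasurable, ?_⟩
  rw [hasFiniteIntegral_iff_ofReal (ae_of_all _ fun v => sq_nonneg _),
    M.lintegral_displacementLaw hS]
  set K := ∫ v, v a ^ 2 ∂normalLaw 0 Sig with hK
  have hK0 : 0 ≤ K := integral_nonneg fun v => sq_nonneg _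
  have h0 : Integrable (fun v : Phase ι => v a ^ 2) (normalLaw 0 Sig) :=
    (memLp_eval_normalLaw hS 0 a).integrable_sq
  have hle : ∀ i, ∫⁻ v, ENNReal.ofReal (v a ^ 2) ∂normalLaw (M.mean i) Sig ≤
      ENNReal.ofReal (2 * M.mean i a ^ 2 + 2 * K) := by
    intro i
    have hint : Integrable (fun v : Phase ι => 2 * M.mean i a ^ 2 + 2 * v a ^ 2) (normalLaw 0 Sig) :=
      (integrable_const _).add (h0.const_mul 2)
    rw [normalLaw_eq_map_add hS, lintegral_map (hma.pow_const 2).ennreal_ofReal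
      (measurable_const_add _)]
    calc ∫⁻ v, ENNReal.ofReal ((M.mean i + v) a ^ 2) ∂normalLaw 0 Sig
        ≤ ∫⁻ v, ENNReal.ofReal (2 * M.mean i a ^ 2 + 2 * v a ^ 2) ∂normalLaw 0 Sig := by
          refine lintegral_mono fun v => ENNReal.ofReal_le_ofReal ?_
          rw [Pi.add_apply]
          nlinarith [sq_nonneg (M.mean i a - v a)]
      _ = ENNReal.ofReal (2 * M.mean i a ^ 2 + 2 * K) := by
          rw [← ofReal_integral_eq_lintegral_ofReal hint (ae_of_all _ fun v => by positivity),
            integral_add (integrable_const _) (h0.const_mul 2), integral_const, hK]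
          have h1 : ∫ v : Phase ι, 2 * v a ^ 2 ∂normalLaw 0 Sig =
              2 * ∫ v, v a ^ 2 ∂normalLaw 0 Sig := integral_const_mul _ _
          rw [h1]
          simp
  have hsum : Summable fun i => M.weight i * (2 * M.mean i a ^ 2 + 2 * K) := by
    refine (((hM a).mul_left 2).add (M.weight_sum.summable.mul_right (2 * K))).congr fun i => ?_
    ring
  calc ∑' i, ENNReal.ofReal (M.weight i) * ∫⁻ v, ENNReal.ofReal (v a ^ 2) ∂normalLaw (M.mean i) Sig
      ≤ ∑' i, ENNReal.ofReal (M.weight i * (2 * M.mean i a ^ 2 + 2 * K)) := by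
        refine ENNReal.tsum_le_tsum fun i => ?_
        rw [ENNReal.ofReal_mul (M.weight_pos i).le]
        gcongr
        exact hle i
    _ < ⊤ := by
        rw [← ENNReal.ofReal_tsum_of_nonneg _ hsum]
        · exact ENNReal.ofReal_lt_top
        · intro i
          have := M.weight_pos i
          positivity

/-- The variance of a mixture in any direction is at least that of its components. -/
theorem GaussianMixture.le_variance (M : GaussianMixture Sig) (hS : Sig.PosDef)
    (hM : HasFiniteVariance M.density) (c : Phase ι) :
    (c ⬝ᵥ (Sig *ᵥ c)) / (2 * π) ≤ Var[fun v => c ⬝ᵥ v; displacementLaw M.density] := by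
  have hP := M.isProbabilityMeasure hS
  have hc : Continuous fun v : Phase ι => c ⬝ᵥ v := continuous_const.dotProduct continuous_id
  have hL : MemLp (fun v : Phase ι => c ⬝ᵥ v) 2 (displacementLaw M.density) :=
    memLp_dotProduct hM c
  rw [variance_eq_integral hc.aemeasurable]
  set e := ∫ v, c ⬝ᵥ v ∂displacementLaw M.density
  have hint : Integrable (fun v : Phase ι => (c ⬝ᵥ v - e) ^ 2) (displacementLaw M.density) :=
    (hL.sub (memLp_const e)).integrable_sq
  rw [← ENNReal.ofReal_le_ofReal_iff (integral_nonneg fun v => sq_nonneg _),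
    ofReal_integral_eq_lintegral_ofReal hint (ae_of_all _ fun v => sq_nonneg _),
    M.lintegral_displacementLaw hS]
  calc ENNReal.ofReal ((c ⬝ᵥ (Sig *ᵥ c)) / (2 * π))
      = ∑' i, ENNReal.ofReal (M.weight i) * ENNReal.ofReal ((c ⬝ᵥ (Sig *ᵥ c)) / (2 * π)) := by
        rw [ENNReal.tsum_mul_right, M.tsum_ofReal_weight, one_mul]
    _ ≤ _ := by
        refine ENNReal.tsum_le_tsum fun i => ?_
        gcongr
        have := isProbabilityMeasure_normalLaw hS (M.mean i)
        have hL' : MemLp (fun v : Phase ι => c ⬝ᵥ v) 2 (normalLaw (M.mean i) Sig) :=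
          memLp_dotProduct (memLp_eval_normalLaw hS _) c
        have hint' : Integrable (fun v : Phase ι => (c ⬝ᵥ v - e) ^ 2) (normalLaw (M.mean i) Sig) :=
          (hL'.sub (memLp_const e)).integrable_sq
        rw [← ofReal_integral_eq_lintegral_ofReal hint' (ae_of_all _ fun v => sq_nonneg _)]
        refine ENNReal.ofReal_le_ofReal ?_
        rw [← variance_normalLaw hS (M.mean i) c, ← variance_sub_const hc.aestronglyMeasurable e]
        exact variance_le_expectation_sq (hc.sub continuous_const).aestronglyMeasurable

theorem posSemidef_covarianceMatrix_sub (M : GaussianMixture Sig) (hS : Sig.PosDef)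
    (hM : HasFiniteVariance M.density) : (covarianceMatrix M.density - Sig).PosSemidef := by
  have hP := M.isProbabilityMeasure hS
  have hsymm : (covarianceMatrix M.density).IsHermitian := by
    ext a b
    simp only [covarianceMatrix, Matrix.conjTranspose_apply, Matrix.of_apply, star_trivial]
    rw [covariance_comm]
  refine Matrix.PosSemidef.of_dotProduct_mulVec_nonneg (hsymm.sub hS.isHermitian) fun c => ?_
  have h1 := M.le_variance hS hM c
  have h2 : c ⬝ᵥ (covarianceMatrix M.density *ᵥ c) =
      2 * π * Var[fun v => c ⬝ᵥ v; displacementLaw M.density] := by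
    have h3 : Var[fun v => c ⬝ᵥ v; displacementLaw M.density] =
        ∑ a, ∑ b, cov[fun v => c a * v a, fun v => c b * v b; displacementLaw M.density] :=
      variance_fun_sum fun a => (hM a).const_mul (c a)
    rw [h3]
    simp only [dotProduct, Matrix.mulVec, covarianceMatrix, Matrix.of_apply, Finset.mul_sum]
    refine Finset.sum_congr rfl fun a _ => Finset.sum_congr rfl fun b _ => ?_
    rw [covariance_const_mul_left, covariance_const_mul_right]
    ring
  rw [star_trivial, Matrix.sub_mulVec, dotProduct_sub, h2]
  rw [div_le_iff₀ (by positivity)] at h1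
  linarith

end Mixture

theorem det_fin_one_sum (A : Matrix (Fin 1 ⊕ Fin 1) (Fin 1 ⊕ Fin 1) ℝ) :
    A.det = A (Sum.inl 0) (Sum.inl 0) * A (Sum.inr 0) (Sum.inr 0) -
      A (Sum.inl 0) (Sum.inr 0) * A (Sum.inr 0) (Sum.inl 0) := by
  rw [← Matrix.det_submatrix_equiv_self (finSumFinEquiv (m := 1) (n := 1)).symm A,
    Matrix.det_fin_two]
  rfl

/-- For `2 × 2` matrices, `det` is monotone on positive definite matrices. -/
theorem det_le_det_of_posSemidef_sub {A B : Matrix (Fin 1 ⊕ Fin 1) (Fin 1 ⊕ Fin 1) ℝ}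
    (hB : B.PosDef) (hAB : (A - B).PosSemidef) : B.det ≤ A.det := by
  have h1 := hAB.det_nonneg
  have h2 := hB.det_pos
  have d1 := hAB.diag_nonneg (i := Sum.inl 0)
  have d2 := hAB.diag_nonneg (i := Sum.inr 0)
  have e1 := (hB.diag_pos (i := Sum.inl 0)).le
  have e2 := (hB.diag_pos (i := Sum.inr 0)).le
  have s1 : A (Sum.inr 0) (Sum.inl 0) - B (Sum.inr 0) (Sum.inl 0) =
      A (Sum.inl 0) (Sum.inr 0) - B (Sum.inl 0) (Sum.inr 0) :=
    hAB.isHermitian.apply (Sum.inl 0) (Sum.inr 0)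
  have s2 : B (Sum.inr 0) (Sum.inl 0) = B (Sum.inl 0) (Sum.inr 0) :=
    hB.isHermitian.apply (Sum.inl 0) (Sum.inr 0)
  rw [det_fin_one_sum] at h1 h2 ⊢
  rw [det_fin_one_sum]
  simp only [Matrix.sub_apply] at h1 d1 d2
  rw [s1] at h1
  rw [s2] at h2 ⊢
  have s3 : A (Sum.inr 0) (Sum.inl 0) = A (Sum.inl 0) (Sum.inr 0) := by linarith
  rw [s3]
  generalize A (Sum.inl 0) (Sum.inl 0) = a at *
  generalize A (Sum.inl 0) (Sum.inr 0) = b at *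
  generalize A (Sum.inr 0) (Sum.inr 0) = d at *
  generalize B (Sum.inl 0) (Sum.inl 0) = x at *
  generalize B (Sum.inl 0) (Sum.inr 0) = y at *
  generalize B (Sum.inr 0) (Sum.inr 0) = z at *
  have hyq : |2 * (y * (b - y))| ≤ x * (d - z) + z * (a - x) := by
    refine abs_le_of_sq_le_sq ?_ (by positivity)
    have h3 : y * y * ((b - y) * (b - y)) ≤ (x * z) * ((a - x) * (d - z)) :=
      mul_le_mul (by linarith) (by linarith) (mul_self_nonneg _) (by positivity)
    nlinarith [sq_nonneg (x * (d - z) - z * (a - x))]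
  have := le_abs_self (2 * (y * (b - y)))
  nlinarith

/-- A mixture of normal laws with covariance `Δ² Sig` and `det Sig = 1` obeys an uncertainty
relation. -/
theorem le_det_covarianceMatrix {Sig : Matrix (Fin 1 ⊕ Fin 1) (Fin 1 ⊕ Fin 1) ℝ} (hS : Sig.PosDef)
    (hdet : Sig.det = 1) {Δ : ℝ} (hΔ : 0 < Δ) (M : GaussianMixture (Δ ^ 2 • Sig))
    (hM : HasFiniteVariance M.density) : Δ ^ 4 ≤ (covarianceMatrix M.density).det ∧
      Δ ^ 2 ≤ spreadQ M.density * spreadP M.density := by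
  have hS' : (Δ ^ 2 • Sig).PosDef := hS.smul (by positivity)
  have hpsd := posSemidef_covarianceMatrix_sub M hS' hM
  have h1 := det_le_det_of_posSemidef_sub hS' hpsd
  have h2 : (Δ ^ 2 • Sig).det = Δ ^ 4 := by
    rw [Matrix.det_smul, hdet]
    simp
    ring
  rw [h2] at h1
  refine ⟨h1, ?_⟩
  have hC : (covarianceMatrix M.density).PosSemidef := by
    have := hpsd.add hS'.posSemidef
    rwa [sub_add_cancel] at this
  have s1 : covarianceMatrix M.density (Sum.inr 0) (Sum.inl 0) =
      covarianceMatrix M.density (Sum.inl 0) (Sum.inr 0) :=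
    hC.isHermitian.apply (Sum.inl 0) (Sum.inr 0)
  rw [det_fin_one_sum, s1] at h1
  rw [spreadQ, spreadP, ← Real.sqrt_mul hC.diag_nonneg]
  refine Real.le_sqrt_of_sq_le ?_
  nlinarith [mul_self_nonneg (covarianceMatrix M.density (Sum.inl 0) (Sum.inr 0))]

/-! ### The residual covariance of a symplectic matrix -/

section ResidualCovariance

variable {N : ℕ}

/-- The position and momentum of the data mode among all quadratures. -/
def dataIndex (N : ℕ) : Fin 1 ⊕ Fin 1 → Modes N ⊕ Modes N :=
  Sum.elim (fun i => Sum.inl (Sum.inl i)) fun i => Sum.inr (Sum.inl i)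

/-- The positions of the ancilla modes, which are measured. -/
def measuredIndex (N : ℕ) : Fin N → Modes N ⊕ Modes N := fun j => Sum.inl (Sum.inr j)

/-- The quadratures that matter after the measurement: those of the data mode, and the measured
positions of the ancillas. -/
def keptIndex (N : ℕ) : (Fin 1 ⊕ Fin 1) ⊕ Fin N → Modes N ⊕ Modes N :=
  Sum.elim (dataIndex N) (measuredIndex N)

/-- The splitting of the quadratures into the kept ones and the momenta of the ancillas. -/
def keptEquiv (N : ℕ) : ((Fin 1 ⊕ Fin 1) ⊕ Fin N) ⊕ Fin N ≃ Modes N ⊕ Modes N where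
  toFun := Sum.elim (keptIndex N) fun j => Sum.inr (Sum.inr j)
  invFun := Sum.elim
    (Sum.elim (fun i => Sum.inl (Sum.inl (Sum.inl i))) fun j => Sum.inl (Sum.inr j))
    (Sum.elim (fun i => Sum.inl (Sum.inl (Sum.inr i))) fun j => Sum.inr j)
  left_inv := by rintro (((i | i) | j) | j) <;> rfl
  right_inv := by rintro ((i | j) | (i | j)) <;> rfl

theorem keptIndex_injective : Function.Injective (keptIndex N) := fun a b h =>
  Sum.inl_injective ((keptEquiv N).injective (by exact h))

variable (S : Matrix (Modes N ⊕ Modes N) (Modes N ⊕ Modes N) ℝ)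

/-- The covariance of the data quadratures for the quadrature covariance `S Sᵀ`. -/
def dataCov : Matrix (Fin 1 ⊕ Fin 1) (Fin 1 ⊕ Fin 1) ℝ :=
  (S * Sᵀ).submatrix (dataIndex N) (dataIndex N)

/-- The covariance between the data quadratures and the measured positions. -/
def crossCov : Matrix (Fin 1 ⊕ Fin 1) (Fin N) ℝ :=
  (S * Sᵀ).submatrix (dataIndex N) (measuredIndex N)

/-- The covariance of the measured positions. -/
def measuredCov : Matrix (Fin N) (Fin N) ℝ :=
  (S * Sᵀ).submatrix (measuredIndex N) (measuredIndex N)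

/-- The covariance of the data quadratures conditioned on the measured positions. -/
def residualCov : Matrix (Fin 1 ⊕ Fin 1) (Fin 1 ⊕ Fin 1) ℝ :=
  dataCov S - crossCov S * (measuredCov S)⁻¹ * (crossCov S)ᵀ

theorem submatrix_kept_mul_transpose : S.submatrix (keptIndex N) id * (S.submatrix (keptIndex N) id)ᵀ =
    Matrix.fromBlocks (dataCov S) (crossCov S) (crossCov S)ᵀ (measuredCov S) := by
  ext a b
  rcases a with a | a <;> rcases b with b | b <;>
    simp [dataCov, crossCov, measuredCov, Matrix.mul_apply, keptIndex, mul_comm]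

variable {S}

theorem submatrix_kept (S : Matrix (Modes N ⊕ Modes N) (Modes N ⊕ Modes N) ℝ) :
    (S * Sᵀ).submatrix (keptIndex N) (keptIndex N) =
    Matrix.fromBlocks (dataCov S) (crossCov S) (crossCov S)ᵀ (measuredCov S) := by
  rw [← submatrix_kept_mul_transpose, Matrix.transpose_submatrix]
  rfl

theorem posDef_mul_transpose (hS : S ∈ Matrix.symplecticGroup (Modes N) ℝ) : (S * Sᵀ).PosDef := by
  have hps : (S * Sᵀ).PosSemidef := by
    simpa using Matrix.posSemidef_self_mul_conjTranspose S
  refine hps.posDef_iff_det_ne_zero.2 ?_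
  rw [Matrix.det_mul, Matrix.det_transpose, SymplecticGroup.det_eq_one hS]
  norm_num

theorem posDef_measuredCov (hS : S ∈ Matrix.symplecticGroup (Modes N) ℝ) :
    (measuredCov S).PosDef :=
  (posDef_mul_transpose hS).submatrix fun a b h => by simpa [measuredIndex] using h

/-- For symplectic `S`, the inverse of `S Sᵀ` is `S Sᵀ` with positions and momenta exchanged up to
signs, so that its block of ancilla momenta is `measuredCov S`; Jacobi's identity for complementary minors does the rest. -/
theorem det_kept (hS : S ∈ Matrix.symplecticGroup (Modes N) ℝ) :
    ((S * Sᵀ).submatrix (keptIndex N) (keptIndex N)).det = (measuredCov S).det := by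
  set A := S * Sᵀ with hA
  have hAs : A ∈ Matrix.symplecticGroup (Modes N) ℝ :=
    mul_mem hS (SymplecticGroup.transpose_mem hS)
  have hAt : Aᵀ = A := by rw [hA, Matrix.transpose_mul, Matrix.transpose_transpose]
  set J := Matrix.J (Modes N) ℝ with hJ
  set B := -(J * A * J) with hB
  have hAB : A * B = 1 := by
    have h1 := SymplecticGroup.mem_iff.1 hAs
    rw [hAt] at h1
    rw [hB, Matrix.mul_neg, Matrix.mul_assoc J, ← Matrix.mul_assoc, ← Matrix.mul_assoc, h1,
      Matrix.J_squared, neg_neg]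
  have hBp : ∀ a b, B (Sum.inr a) (Sum.inr b) = A (Sum.inl a) (Sum.inl b) := by
    intro a b
    rw [hB, hJ, Matrix.J, ← Matrix.fromBlocks_toBlocks A]
    simp [Matrix.fromBlocks_multiply]
  set e := keptEquiv N
  set A' := A.submatrix e e with hA'
  set B' := B.submatrix e e with hB'
  have hA'B' : A' * B' = 1 := by
    rw [hA', hB', Matrix.submatrix_mul_equiv, hAB, Matrix.submatrix_one_equiv]
  rw [← Matrix.fromBlocks_toBlocks A', ← Matrix.fromBlocks_toBlocks B',
    Matrix.fromBlocks_multiply, ← Matrix.fromBlocks_one, Matrix.fromBlocks_inj] at hA'B'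
  have hdetA : A'.det = 1 := by
    rw [hA', Matrix.det_submatrix_equiv_self, SymplecticGroup.det_eq_one hAs]
  have key : A' * Matrix.fromBlocks 1 B'.toBlocks₁₂ 0 B'.toBlocks₂₂ =
      Matrix.fromBlocks A'.toBlocks₁₁ 0 A'.toBlocks₂₁ 1 := by
    conv_lhs => rw [← Matrix.fromBlocks_toBlocks A']
    rw [Matrix.fromBlocks_multiply, hA'B'.2.1, hA'B'.2.2.2]
    simp
  have h2 := congrArg Matrix.det key
  rw [Matrix.det_mul, hdetA, Matrix.det_fromBlocks_zero₂₁, Matrix.det_fromBlocks_zero₁₂,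
    Matrix.det_one, Matrix.det_one, one_mul, one_mul, mul_one] at h2
  have h3 : B'.toBlocks₂₂ = measuredCov S := by
    ext i j
    exact hBp (Sum.inr i) (Sum.inr j)
  rw [← h3, h2]
  rfl

theorem residualCov_posDef_and_det (hS : S ∈ Matrix.symplecticGroup (Modes N) ℝ) :
    (residualCov S).PosDef ∧ (residualCov S).det = 1 := by
  have hG := posDef_measuredCov hS
  have hinv : Invertible (measuredCov S) :=
    Matrix.invertibleOfIsUnitDet _ (isUnit_iff_ne_zero.2 hG.det_pos.ne')
  have hdet := det_kept hS
  rw [submatrix_kept, Matrix.det_fromBlocks₂₂, Matrix.invOf_eq_nonsing_inv] at hdet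
  have h1 : (residualCov S).det = 1 :=
    mul_left_cancel₀ hG.det_pos.ne' (hdet.trans (mul_one _).symm)
  have h2 : (residualCov S).PosSemidef := by
    have h3 := ((posDef_mul_transpose hS).submatrix keptIndex_injective).posSemidef
    rw [submatrix_kept, ← Matrix.conjTranspose_eq_transpose_of_trivial,
      Matrix.PosDef.fromBlocks₂₂ _ _ hG, Matrix.conjTranspose_eq_transpose_of_trivial] at h3
    exact h3
  exact ⟨h2.posDef_iff_det_ne_zero.2 (by rw [h1]; norm_num), h1⟩

end ResidualCovariance

/-! ### Overlaps of GKP states with displaced wave functions -/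

section Overlap

variable {ι : Type} [Fintype ι]

/-- The matrix element `⟨f|W(u)|ψ⟩⟨ψ|W(u)†|g⟩` of a displaced pure state. -/
def overlap (ψ : Ket ι) (f g : Wave ι) (u : Phase ι) : ℂ :=
  ψ (displace (-u) f) * conj (ψ (displace (-u) g))

theorem overlap_self (ψ : Ket ι) (f : Wave ι) (u : Phase ι) :
    overlap ψ f f u = ((‖ψ (displace (-u) f)‖ ^ 2 : ℝ) : ℂ) := by
  rw [overlap, Complex.mul_conj, Complex.normSq_eq_norm_sq]

theorem continuous_overlap (ψ : Ket ι) (f g : Wave ι) : Continuous (overlap ψ f g) := by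
  have h (f : Wave ι) : Continuous fun u : Phase ι => ψ (displace (-u) f) :=
    ψ.continuous.comp ((continuous_displace f).comp continuous_neg)
  exact (h f).mul (Complex.continuous_conj.comp (h g))

theorem ket_mul_conj_ket_smul (ψ : Ket ι) (f g : Wave ι) {c : ℂ} (hc : ‖c‖ = 1) :
    ψ (c • f) * conj (ψ (c • g)) = ψ f * conj (ψ g) := by
  have h : conj c * c = 1 := by
    rw [mul_comm, Complex.mul_conj, Complex.normSq_eq_norm_sq, hc]; norm_num
  simp only [map_smulₛₗ, smul_eq_mul, map_mul, Complex.conj_conj]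
  linear_combination (ψ f * conj (ψ g)) * h

theorem overlap_displace (ψ : Ket ι) (f g : Wave ι) (u v : Phase ι) :
    overlap ψ (displace (-v) f) (displace (-v) g) u = overlap ψ f g (u + v) := by
  rw [overlap, displace_displace, displace_displace,
    ket_mul_conj_ket_smul ψ _ _ (Complex.norm_exp_ofReal_mul_I _), ← neg_add, overlap]

/-- The displacements that fix `ψ` up to a phase act trivially on the overlaps. -/
theorem overlap_add_of_fixed {ψ : Ket ι} {v : Phase ι} (hv : ∀ f, ψ (displace (-v) f) = ψ f)
    (f g : Wave ι) (u : Phase ι) : overlap ψ f g (u + v) = overlap ψ f g u := by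
  have h : overlap ψ f g (v + u) = overlap ψ f g u := by
    rw [← overlap_displace, overlap, hv, hv, overlap]
  rw [add_comm, h]

/-- Modulo the stabiliser lattice of a GKP state every displacement is bounded. -/
theorem IsGKPState.exists_bounded_overlap_eq {ψ : Ket ι} (hψ : IsGKPState ψ) :
    ∃ K : ℝ, ∀ u : Phase ι, ∃ u' : Phase ι, ‖u'‖ ≤ K ∧
      ∀ f g, overlap ψ f g u = overlap ψ f g u' := by
  classical
  obtain ⟨-, v, hv, -, hfix⟩ := hψ
  let periods : AddSubgroup (Phase ι) :=
    { carrier := {w | ∀ f g u, overlap ψ f g (u + w) = overlap ψ f g u}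
      zero_mem' := fun f g u => by rw [add_zero]
      add_mem' := fun {a b} ha hb f g u => by rw [← add_assoc, hb, ha]
      neg_mem' := fun {a} ha f g u => by rw [← ha, neg_add_cancel_right] }
  have hspan' := (hv.span_eq_top_of_card_eq_finrank' (by simp)).ge
  let b := Module.Basis.mk hv hspan'
  refine ⟨∑ i, ‖b i‖, fun u => ⟨ZSpan.fract b u, ZSpan.norm_fract_le b u, fun f g => ?_⟩⟩
  have hmem : ((ZSpan.floor b u : Submodule.span ℤ (Set.range b)) : Phase ι) ∈ periods := by
    have hspan : Submodule.span ℤ (Set.range b) ≤ periods.toIntSubmodule := by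
      rw [Submodule.span_le]
      rintro _ ⟨i, rfl⟩ f g w
      rw [show b i = v i from Module.Basis.mk_apply hv hspan' i]
      exact overlap_add_of_fixed (hfix i) f g w
    exact hspan (ZSpan.floor b u).2
  rw [← hmem f g (ZSpan.fract b u), ZSpan.fract_apply, sub_add_cancel]

theorem IsGKPState.exists_norm_overlap_le {ψ : Ket ι} (hψ : IsGKPState ψ) (f g : Wave ι) :
    ∃ B : ℝ, 0 ≤ B ∧ ∀ u, ‖overlap ψ f g u‖ ≤ B := by
  obtain ⟨K, hK⟩ := hψ.exists_bounded_overlap_eq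
  obtain ⟨B, hB⟩ := (isCompact_closedBall (0 : Phase ι) K).exists_bound_of_continuousOn
    (continuous_overlap ψ f g).continuousOn
  refine ⟨max B 0, le_max_right _ _, fun u => ?_⟩
  obtain ⟨u', hu', h⟩ := hK u
  rw [h]
  exact (hB u' (by simpa using hu')).trans (le_max_left _ _)

/-- Finitely many wave functions detect all displaced copies of a GKP state uniformly. -/
theorem IsGKPState.exists_le_sum_norm_sq {ψ : Ket ι} (hψ : IsGKPState ψ) :
    ∃ (F : Finset (Wave ι)) (c : ℝ), 0 < c ∧
      ∀ u, c ≤ ∑ f ∈ F, ‖ψ (displace (-u) f)‖ ^ 2 := by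
  obtain ⟨K, hK⟩ := hψ.exists_bounded_overlap_eq
  obtain ⟨f₀, hf₀⟩ : ∃ f, ψ f ≠ 0 := by
    by_contra! h
    exact hψ.1 (ContinuousLinearMap.ext h)
  have hcont (f : Wave ι) : Continuous fun u : Phase ι => ‖ψ (displace (-u) f)‖ ^ 2 :=
    ((ψ.continuous.comp ((continuous_displace f).comp continuous_neg)).norm).pow 2
  have hK0 : 0 ≤ K := by
    obtain ⟨u', hu', -⟩ := hK 0
    exact (norm_nonneg _).trans hu'
  obtain ⟨F, hF⟩ := (isCompact_closedBall (0 : Phase ι) K).elim_finite_subcover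
    (fun f : Wave ι => {u | 0 < ‖ψ (displace (-u) f)‖ ^ 2})
    (fun f => isOpen_lt continuous_const (hcont f)) (fun u _ => by
      refine mem_iUnion.2 ⟨displace u f₀, ?_⟩
      rw [mem_ofPred_eq, displace_neg_displace]
      positivity)
  obtain ⟨u₀, hu₀K, hu₀⟩ := (isCompact_closedBall (0 : Phase ι) K).exists_isMinOn
    ⟨0, by simpa using hK0⟩
    (f := fun u => ∑ f ∈ F, ‖ψ (displace (-u) f)‖ ^ 2)
    (continuous_finsetSum F fun f _ => hcont f).continuousOn
  have hpos : ∀ u ∈ Metric.closedBall (0 : Phase ι) K,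
      0 < ∑ f ∈ F, ‖ψ (displace (-u) f)‖ ^ 2 := by
    intro u hu
    obtain ⟨f, hf⟩ := mem_iUnion.1 (hF hu)
    obtain ⟨hfF, hf⟩ := mem_iUnion.1 hf
    exact Finset.sum_pos' (fun _ _ => by positivity) ⟨f, hfF, hf⟩
  refine ⟨F, _, hpos u₀ hu₀K, fun u => ?_⟩
  obtain ⟨u', hu', h⟩ := hK u
  have h1 : ∀ f, ‖ψ (displace (-u) f)‖ ^ 2 = ‖ψ (displace (-u') f)‖ ^ 2 := by
    intro f
    have := h f f
    rw [overlap_self, overlap_self] at this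
    exact_mod_cast this
  rw [Finset.sum_congr rfl fun f _ => h1 f]
  exact hu₀ (by simpa using hu')

end Overlap

/-! ### Growth of the amplitudes -/

section Amplitudes

variable {N : ℕ} {S : Matrix (Modes N ⊕ Modes N) (Modes N ⊕ Modes N) ℝ}

/-- The amplitudes of the outcomes are summable against Gaussians: the noiseless output pairs with
Gaussian wave functions of the ancillas. -/
theorem SyndromeCircuit.summable_amp (C : SyndromeCircuit N S) {a : ℝ} (ha : 0 < a) :
    Summable fun l : C.outcomes => ‖C.amp l‖ ^ 2 * Real.exp (-(a * ‖(l : Conf (Fin N))‖ ^ 2)) := by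
  obtain ⟨F, c, hc, hF⟩ := C.data_gkp.exists_le_sum_norm_sq
  have h1 : ∀ f : Wave (Fin 1), Summable fun l : C.outcomes => ‖C.amp l‖ ^ 2 *
      ‖C.data (displace (-C.shift l) f)‖ ^ 2 * Real.exp (-(a * ‖(l : Conf (Fin N))‖ ^ 2)) := by
    intro f
    have h2 := (C.noiseless f (gaussianWave (a / 2) (half_pos ha))).summable.norm
    have h3 := (h2.mul_of_nonneg h2 (fun _ => norm_nonneg _) fun _ => norm_nonneg _).comp_injective
      (i := fun l : C.outcomes => (l, l)) fun l l' h => (Prod.ext_iff.1 h).1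
    refine h3.congr fun l => ?_
    simp only [Function.comp_apply, norm_mul, RCLike.norm_conj, gaussianWave_apply,
      Complex.norm_exp, ← Complex.ofReal_neg, Complex.ofReal_re]
    have h4 : Real.exp (-(a * ‖(l : Conf (Fin N))‖ ^ 2)) =
        Real.exp (-(a / 2 * ‖(l : Conf (Fin N))‖ ^ 2)) *
          Real.exp (-(a / 2 * ‖(l : Conf (Fin N))‖ ^ 2)) := by
      rw [← Real.exp_add]; ring_nf
    rw [h4]
    ring
  have h5 := (summable_sum (s := F) fun f _ => h1 f).mul_left c⁻¹
  refine h5.of_nonneg_of_le (fun l => by positivity) fun l => ?_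
  rw [← Finset.sum_mul, ← Finset.mul_sum, inv_mul_eq_div, le_div_iff₀ hc]
  calc ‖C.amp l‖ ^ 2 * Real.exp (-(a * ‖(l : Conf (Fin N))‖ ^ 2)) * c
      = ‖C.amp l‖ ^ 2 * c * Real.exp (-(a * ‖(l : Conf (Fin N))‖ ^ 2)) := by ring
    _ ≤ _ := by gcongr; exact hF _

theorem SyndromeCircuit.countable_outcomes (C : SyndromeCircuit N S) : Countable C.outcomes := by
  have h := (C.summable_amp one_pos).countable_support
  rwa [Function.support_eq_univ fun l : C.outcomes => ?_, countable_univ_iff] at h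
  have := C.amp_ne_zero l l.2
  positivity

end Amplitudes

/-! ### The noisy state before the measurement -/

theorem hasSum_mul_conj_of_forall_ne {α : Type*} {a b : α → ℂ} {A B : ℂ} (ha : HasSum a A)
    (hb : HasSum b B) (i₀ : α) (ha' : ∀ i, i ≠ i₀ → a i = 0) (hb' : ∀ i, i ≠ i₀ → b i = 0) :
    HasSum (fun i => a i * conj (b i)) (A * conj B) := by
  rw [ha.unique (hasSum_single i₀ ha'), hb.unique (hasSum_single i₀ hb')]
  exact hasSum_single i₀ fun i hi => by rw [ha' i hi, zero_mul]

section Noisy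

variable {N : ℕ} {S : Matrix (Modes N ⊕ Modes N) (Modes N ⊕ Modes N) ℝ}

/-- The noiseless state after the Gaussian unitary. -/
def SyndromeCircuit.output (C : SyndromeCircuit N S) : Ket (Modes N) :=
  C.input.comp (C.U.symm : Wave (Modes N) →L[ℂ] Wave (Modes N))

theorem SyndromeCircuit.output_apply (C : SyndromeCircuit N S) (F : Wave (Modes N)) :
    C.output F = C.input (C.U.symm F) := rfl

theorem SyndromeCircuit.overlap_input (C : SyndromeCircuit N S) (F F' : Wave (Modes N))
    (v : Phase (Modes N)) : overlap C.input (C.U.symm F) (C.U.symm F') v =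
      overlap C.output F F' (S *ᵥ v) := by
  obtain ⟨c, hc, h⟩ := C.gaussian.symm_displace (-v)
  rw [overlap, h, h, ket_mul_conj_ket_smul _ _ _ hc, Matrix.mulVec_neg]
  rfl

theorem normalLaw_zero_smul_one {κ : Type} [Fintype κ] [DecidableEq κ] {Δ : ℝ} (hΔ : 0 < Δ) :
    normalLaw (0 : κ → ℝ) (Δ ^ 2 • 1) = (stdLaw κ).map fun z => Δ • z := by
  have h1 : (Δ ^ 2 • 1 : Matrix κ κ ℝ) = (Δ • (1 : Matrix κ κ ℝ)) * (Δ • (1 : Matrix κ κ ℝ))ᵀ := by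
    rw [Matrix.transpose_smul, Matrix.transpose_one, Matrix.smul_mul, Matrix.mul_smul,
      Matrix.one_mul, smul_smul, sq]
  rw [h1, normalLaw_eq_map (by rw [Matrix.det_smul, Matrix.det_one]; positivity)]
  congr 1
  funext z
  rw [zero_add, Matrix.smul_mulVec, Matrix.one_mulVec]

/-- The noise at the input of the circuit acts on the noiseless output as a normal displacement with
covariance matrix `Δ² S Sᵀ`. -/
theorem SyndromeCircuit.noisyState_apply (C : SyndromeCircuit N S) {Δ : ℝ} (hΔ : 0 < Δ)
    (F F' : Wave (Modes N)) : C.noisyState Δ F F' =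
      ∫ z, overlap C.output F F' (S *ᵥ (Δ • z)) ∂stdLaw (Modes N ⊕ Modes N) := by
  have h1 : C.noisyState Δ F F' =
      ∫ v, overlap C.input (C.U.symm F) (C.U.symm F') v ∂normalLaw 0 (Δ ^ 2 • 1) := by
    rw [integral_normalLaw]
    rfl
  rw [h1, normalLaw_zero_smul_one hΔ, integral_map (measurable_const_smul Δ).aemeasurable
    (continuous_overlap _ _ _).aestronglyMeasurable]
  simp_rw [C.overlap_input]

/-- If the wave packet is narrow, it overlaps with at most one of the displaced ancilla outcomes, so
that different outcomes do not interfere. -/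
theorem SyndromeCircuit.hasSum_overlap_output (C : SyndromeCircuit N S) {r : ℝ}
    (hr : C.outcomes.Pairwise fun x y => r ≤ dist x y) (k : Wave (Fin N)) {ρ : ℝ}
    (hk : ∀ x, k x ≠ 0 → ‖x‖ ≤ ρ) (m : Conf (Fin N)) {ε : ℝ} (hε : 0 < ε) (hερ : 2 * ρ * ε < r)
    (f g : Wave (Fin 1)) (w : Phase (Modes N)) :
    HasSum (fun l : C.outcomes => ((‖C.amp l‖ ^ 2 : ℝ) : ℂ) *
      (overlap C.data f g (C.shift l + fun i => w (dataIndex N i)) *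
        ((‖k (ε⁻¹ • (l + √(2 * π) • WithLp.toLp 2 (fun j => w (measuredIndex N j)) - m))‖ ^ 2 : ℝ) : ℂ)))
      (overlap C.output (tensor f (wavePacket k m ε)) (tensor g (wavePacket k m ε)) w) := by
  set wD : Phase (Fin 1) := fun i => w (dataIndex N i) with hwD
  set wA : Phase (Fin N) := Sum.elim (fun j => w (Sum.inl (Sum.inr j))) fun j => w (Sum.inr (Sum.inr j))
    with hwA
  have htensor : ∀ f : Wave (Fin 1), displace (-w) (tensor f (wavePacket k m ε)) =
      tensor (displace (-wD) f) (displace (-wA) (wavePacket k m ε)) := by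
    intro f
    rw [displace_tensor]
    congr 3 <;> (funext i; rcases i with i | i <;> rfl)
  set kw := displace (-wA) (wavePacket k m ε) with hkw
  set y : Conf (Fin N) → Conf (Fin N) := fun l =>
    ε⁻¹ • (l + √(2 * π) • WithLp.toLp 2 (fun j => w (measuredIndex N j)) - m) with hy
  have hnorm : ∀ l, ‖kw l‖ = ‖k (y l)‖ := by
    intro l
    have hpos : posPart (-wA) = -WithLp.toLp 2 (fun j => w (measuredIndex N j)) := rfl
    rw [hkw, displace_apply, norm_mul, Complex.norm_exp_ofReal_mul_I, one_mul,
      wavePacket_apply _ _ hε.ne', hpos, smul_neg, sub_neg_eq_add]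
  have huniq : ∀ l l' : C.outcomes, kw l ≠ 0 → kw l' ≠ 0 → l = l' := by
    intro l l' h h'
    rw [← norm_ne_zero_iff, hnorm, norm_ne_zero_iff] at h h'
    by_contra hne
    have h1 : r ≤ dist (l : Conf (Fin N)) l' := hr l.2 l'.2 fun h => hne (Subtype.ext h)
    have h2 : (l : Conf (Fin N)) - l' = ε • (y l - y l') := by
      rw [hy, ← smul_sub, smul_smul, mul_inv_cancel₀ hε.ne', one_smul]
      abel
    rw [dist_eq_norm, h2, norm_smul, Real.norm_of_nonneg hε.le] at h1
    have h3 := (norm_sub_le (y l) (y l')).trans (add_le_add (hk _ h) (hk _ h'))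
    nlinarith
  obtain ⟨l₀, hl₀⟩ : ∃ l₀ : C.outcomes, ∀ l : C.outcomes, l ≠ l₀ → kw l = 0 := by
    by_cases h : ∃ l₀ : C.outcomes, kw l₀ ≠ 0
    · obtain ⟨l₀, h⟩ := h
      exact ⟨l₀, fun l hl => by_contra fun h' => hl (huniq l l₀ h' h)⟩
    · push Not at h
      obtain ⟨l, hl⟩ := C.outcomes_nonempty
      exact ⟨⟨l, hl⟩, fun l' _ => h l'⟩
  have hsum := hasSum_mul_conj_of_forall_ne (C.noiseless (displace (-wD) f) kw)
    (C.noiseless (displace (-wD) g) kw) l₀ (fun l hl => by rw [hl₀ l hl, map_zero, mul_zero])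
    (fun l hl => by rw [hl₀ l hl, map_zero, mul_zero])
  rw [overlap, htensor, htensor, C.output_apply, C.output_apply]
  refine hsum.congr_fun fun l => ?_
  rw [← overlap_displace, overlap, ← hnorm]
  have h1 : ((‖C.amp l‖ ^ 2 : ℝ) : ℂ) = C.amp l * conj (C.amp l) := by
    rw [Complex.mul_conj, Complex.normSq_eq_norm_sq]
  have h2 : ((‖kw l‖ ^ 2 : ℝ) : ℂ) = kw l * conj (kw l) := by
    rw [Complex.mul_conj, Complex.normSq_eq_norm_sq]
  rw [h1, h2]
  simp only [map_mul, Complex.conj_conj]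
  ring

/-- The regression coefficients of the data quadratures on the measured positions. -/
def regression (S : Matrix (Modes N ⊕ Modes N) (Modes N ⊕ Modes N) ℝ) :
    Matrix (Fin 1 ⊕ Fin 1) (Fin N) ℝ := crossCov S * (measuredCov S)⁻¹

/-- The average of `F` over a normal law with mean `b`. -/
def normalAverage (Sig : Matrix (Fin 1 ⊕ Fin 1) (Fin 1 ⊕ Fin 1) ℝ) (F : Phase (Fin 1) → ℂ)
    (b : Phase (Fin 1)) : ℂ := ∫ u, F u ∂normalLaw b Sig

/-- The measured positions have the covariance matrix `Δ² measuredCov S`, and given their values `a`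
the data displacement is normal with mean `regression S *ᵥ a`. -/
theorem integral_outcome (hS : S ∈ Matrix.symplecticGroup (Modes N) ℝ)
    {Δ : ℝ} (hΔ : 0 < Δ) {F : Phase (Fin 1) → ℂ} (hF : Continuous F) {B : ℝ} (hB0 : 0 ≤ B)
    (hB : ∀ u, ‖F u‖ ≤ B) (d : Phase (Fin 1)) (κ : Conf (Fin N) → ℝ)
    (hκ : Continuous κ) {K : ℝ} (hK : ∀ x, ‖κ x‖ ≤ K) :
    ∫ z, F (d + fun i => (S *ᵥ (Δ • z)) (dataIndex N i)) *
        (κ (WithLp.toLp 2 fun j => (S *ᵥ (Δ • z)) (measuredIndex N j)) : ℂ)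
          ∂stdLaw (Modes N ⊕ Modes N) =
      ∫ a, (κ (WithLp.toLp 2 a) : ℂ) *
        normalAverage (Δ ^ 2 • residualCov S) F (d + regression S *ᵥ a)
          ∂normalLaw 0 (Δ ^ 2 • measuredCov S) := by
  have hΔ2 : 0 < Δ ^ 2 := by positivity
  have hG := posDef_measuredCov hS
  have hsig := (residualCov_posDef_and_det hS).1
  have hGu : IsUnit (measuredCov S).det := isUnit_iff_ne_zero.2 hG.det_pos.ne'
  have hinv : (Δ ^ 2 • measuredCov S)⁻¹ = (Δ ^ 2)⁻¹ • (measuredCov S)⁻¹ := by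
    refine Matrix.inv_eq_right_inv ?_
    rw [Matrix.smul_mul, Matrix.mul_smul, smul_smul, Matrix.mul_nonsing_inv _ hGu,
      mul_inv_cancel₀ hΔ2.ne', one_smul]
  have hreg : (Δ ^ 2 • crossCov S) * (Δ ^ 2 • measuredCov S)⁻¹ = regression S := by
    rw [hinv, Matrix.smul_mul, Matrix.mul_smul, smul_smul, mul_inv_cancel₀ hΔ2.ne', one_smul,
      regression]
  have hschur : Δ ^ 2 • dataCov S - (Δ ^ 2 • crossCov S) * (Δ ^ 2 • measuredCov S)⁻¹ *
      (Δ ^ 2 • crossCov S)ᵀ = Δ ^ 2 • residualCov S := by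
    rw [hreg, Matrix.transpose_smul, Matrix.mul_smul, ← smul_sub, regression, residualCov]
  have hR : (Δ • S.submatrix (keptIndex N) id) * (Δ • S.submatrix (keptIndex N) id)ᵀ =
      Matrix.fromBlocks (Δ ^ 2 • dataCov S) (Δ ^ 2 • crossCov S) (Δ ^ 2 • crossCov S)ᵀ
        (Δ ^ 2 • measuredCov S) := by
    rw [Matrix.transpose_smul, Matrix.smul_mul, Matrix.mul_smul, smul_smul,
      submatrix_kept_mul_transpose, Matrix.fromBlocks_smul, Matrix.transpose_smul, sq]
  have htoLp : Continuous fun a : Fin N → ℝ => (WithLp.toLp 2 a : Conf (Fin N)) :=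
    PiLp.continuous_toLp 2 _
  have hmain := integral_stdLaw_eq_conditional hR (hG.smul hΔ2)
    (by rw [hschur]; exact hsig.smul hΔ2)
    (fun u a => F (d + u) * (κ (WithLp.toLp 2 a) : ℂ))
    ((hF.comp (continuous_const.add continuous_fst)).mul
      (Complex.continuous_ofReal.comp (hκ.comp (htoLp.comp continuous_snd)))) (B * K)
    (fun u a => by
      rw [norm_mul, Complex.norm_real]
      exact mul_le_mul (hB _) (hK _) (norm_nonneg _) hB0)
  have hrow : ∀ (z : Modes N ⊕ Modes N → ℝ) i,
      ((Δ • S.submatrix (keptIndex N) id) *ᵥ z) i = (S *ᵥ (Δ • z)) (keptIndex N i) := by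
    intro z i
    rw [Matrix.smul_mulVec, Matrix.mulVec_smul]
    rfl
  simp only [hrow] at hmain
  rw [hschur, hreg] at hmain
  refine hmain.trans (integral_congr_ae (ae_of_all _ fun a => ?_))
  simp only
  have hc : Continuous fun u : Phase (Fin 1) => F (d + u) :=
    hF.comp (continuous_const.add continuous_id)
  rw [integral_mul_const, mul_comm, normalAverage,
    normalLaw_eq_map_add (hsig.smul hΔ2) (d + _), normalLaw_eq_map_add (hsig.smul hΔ2) (_ *ᵥ _),
    integral_map (measurable_const_add _).aemeasurable
      hF.aestronglyMeasurable,
    integral_map (measurable_const_add _).aemeasurable hc.aestronglyMeasurable]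
  simp only [add_assoc]

end Noisy

/-! ### The density of the measurement outcomes -/

section Density

variable {κ : Type} [Fintype κ] [DecidableEq κ]

theorem exists_mul_dotProduct_le {G : Matrix κ κ ℝ} (hG : G.PosDef) :
    ∃ c > 0, ∀ a : κ → ℝ, c * (a ⬝ᵥ a) ≤ a ⬝ᵥ (G⁻¹ *ᵥ a) := by
  obtain ⟨R, hR, rfl⟩ := exists_eq_mul_transpose hG
  have hu : IsUnit R.det := isUnit_iff_ne_zero.2 hR
  set K := ∑ i, R i ⬝ᵥ R i with hK
  have hK0 : 0 ≤ K := Finset.sum_nonneg fun i _ => by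
    simpa using dotProduct_star_self_nonneg (R i)
  refine ⟨(K + 1)⁻¹, by positivity, fun a => ?_⟩
  set z := R⁻¹ *ᵥ a with hz
  have ha : a = R *ᵥ z := by
    rw [hz, Matrix.mulVec_mulVec, Matrix.mul_nonsing_inv _ hu, Matrix.one_mulVec]
  have hz0 : 0 ≤ z ⬝ᵥ z := by simpa using dotProduct_star_self_nonneg z
  have h1 : a ⬝ᵥ ((R * Rᵀ)⁻¹ *ᵥ a) = z ⬝ᵥ z := by
    rw [Matrix.mul_inv_rev, ← Matrix.transpose_nonsing_inv, ← Matrix.mulVec_mulVec,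
      Matrix.mulVec_transpose, dotProduct_comm, ← Matrix.dotProduct_mulVec]
  have h2 : a ⬝ᵥ a ≤ K * (z ⬝ᵥ z) := by
    rw [hK, Finset.sum_mul, ha]
    refine Finset.sum_le_sum fun i _ => ?_
    have := Finset.sum_mul_sq_le_sq_mul_sq Finset.univ (R i) z
    simpa only [dotProduct, Matrix.mulVec, ← sq] using this
  rw [h1, inv_mul_le_iff₀ (by positivity)]
  nlinarith

/-- The normal density with covariance matrix `G`, as a function of `√(2π)` times its argument. -/
def outcomeDensity (G : Matrix κ κ ℝ) (x : Conf κ) : ℝ :=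
  normalDensity 0 G (WithLp.ofLp ((√(2 * π))⁻¹ • x))

theorem outcomeDensity_nonneg (G : Matrix κ κ ℝ) (x : Conf κ) : 0 ≤ outcomeDensity G x :=
  normalDensity_nonneg _ _ _

theorem continuous_ofLp_smul {κ : Type} [Fintype κ] (c : ℝ) :
    Continuous fun x : Conf κ => WithLp.ofLp (c • x) :=
  (PiLp.continuous_ofLp 2 _).comp (continuous_const_smul c)

theorem continuous_outcomeDensity (G : Matrix κ κ ℝ) : Continuous (outcomeDensity G) :=
  (continuous_normalDensity_right 0 G).comp (continuous_ofLp_smul _)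

theorem outcomeDensity_pos {G : Matrix κ κ ℝ} (hG : G.PosDef) (x : Conf κ) :
    0 < outcomeDensity G x := by
  have := hG.det_pos
  unfold outcomeDensity normalDensity
  positivity

theorem exists_outcomeDensity_le {G : Matrix κ κ ℝ} (hG : G.PosDef) (m : Conf κ) (ρ : ℝ) :
    ∃ a > 0, ∃ K, 0 ≤ K ∧ ∀ l x : Conf κ, ‖x‖ ≤ ρ →
      outcomeDensity G (m - l + x) ≤ K * Real.exp (-(a * ‖l‖ ^ 2)) := by
  obtain ⟨c, hc, h⟩ := exists_mul_dotProduct_le hG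
  refine ⟨c / 4, by positivity, Real.exp (c / 2 * (‖m‖ + ρ) ^ 2) / √|G.det|, by positivity,
    fun l x hx => ?_⟩
  have h1 : ∀ y : Conf κ, outcomeDensity G y ≤ Real.exp (-(c / 2 * ‖y‖ ^ 2)) / √|G.det| := by
    intro y
    unfold outcomeDensity normalDensity
    gcongr
    rw [sub_zero]
    set w := WithLp.ofLp ((√(2 * π))⁻¹ • y) with hw
    have h2 : w ⬝ᵥ w = (2 * π)⁻¹ * ‖y‖ ^ 2 := by
      rw [hw, EuclideanSpace.norm_sq_eq, dotProduct, Finset.mul_sum]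
      refine Finset.sum_congr rfl fun i _ => ?_
      have h3 : (√(2 * π))⁻¹ * (√(2 * π))⁻¹ = (2 * π)⁻¹ := by
        rw [← mul_inv, Real.mul_self_sqrt (by positivity)]
      rw [PiLp.smul_apply, smul_eq_mul, Real.norm_eq_abs, sq_abs, ← h3]
      ring
    have h4 := h w
    rw [h2] at h4
    have h5 : c / 2 * ‖y‖ ^ 2 = π * (c * ((2 * π)⁻¹ * ‖y‖ ^ 2)) := by
      field_simp
    rw [h5]
    nlinarith [pi_pos]
  refine (h1 _).trans ?_
  rw [div_mul_eq_mul_div (Real.exp (c / 2 * (‖m‖ + ρ) ^ 2)), ← Real.exp_add]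
  gcongr
  have h2 : ‖l‖ ≤ ‖m - l + x‖ + (‖m‖ + ρ) := by
    have h3 : l = -(m - l + x) + (m + x) := by abel
    calc ‖l‖ = ‖-(m - l + x) + (m + x)‖ := by rw [← h3]
      _ ≤ ‖m - l + x‖ + (‖m‖ + ‖x‖) := by
        refine (norm_add_le _ _).trans ?_
        rw [norm_neg]
        gcongr
        exact norm_add_le _ _
      _ ≤ _ := by gcongr
  have h3 : ‖l‖ ^ 2 ≤ 2 * ‖m - l + x‖ ^ 2 + 2 * (‖m‖ + ρ) ^ 2 := by
    nlinarith [norm_nonneg l, norm_nonneg (m - l + x), sq_nonneg (‖m - l + x‖ - (‖m‖ + ρ))]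
  nlinarith

/-- Blowing up the neighbourhood of width `ε` of a measurement outcome. -/
theorem integral_normalLaw_rescale (G : Matrix κ κ ℝ) (φ : Conf κ → ℝ) (H : (κ → ℝ) → ℂ)
    (x₀ : Conf κ) {ε : ℝ} (hε : 0 < ε) :
    ∫ a, (φ (ε⁻¹ • (√(2 * π) • WithLp.toLp 2 a - x₀)) : ℂ) * H a ∂normalLaw 0 G =
      (((√(2 * π))⁻¹ * ε) ^ Fintype.card κ : ℝ) *
        ∫ y, (φ y : ℂ) * ((outcomeDensity G (x₀ + ε • y) : ℂ) *
          H (WithLp.ofLp ((√(2 * π))⁻¹ • (x₀ + ε • y)))) := by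
  have hs : 0 < √(2 * π) := by positivity
  set Φ : Conf κ → ℂ := fun x => (φ (ε⁻¹ • (√(2 * π) • x - x₀)) : ℂ) *
    ((normalDensity 0 G (WithLp.ofLp x) : ℂ) * H (WithLp.ofLp x)) with hΦ
  have h1 : ∫ a, (φ (ε⁻¹ • (√(2 * π) • WithLp.toLp 2 a - x₀)) : ℂ) * H a ∂normalLaw 0 G =
      ∫ x, Φ x := by
    rw [integral_normalLaw, ← (PiLp.volume_preserving_toLp κ).integral_comp
      (MeasurableEquiv.toLp 2 (κ → ℝ)).measurableEmbedding]
    refine integral_congr_ae (ae_of_all _ fun a => ?_)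
    simp only [hΦ]
    ring
  set c := (√(2 * π))⁻¹ * ε with hc
  have hc0 : 0 < c := by positivity
  have h2 : ∫ y, (φ y : ℂ) * ((outcomeDensity G (x₀ + ε • y) : ℂ) *
      H (WithLp.ofLp ((√(2 * π))⁻¹ • (x₀ + ε • y)))) = ∫ y, Φ ((√(2 * π))⁻¹ • x₀ + c • y) := by
    refine integral_congr_ae (ae_of_all _ fun y => ?_)
    have h3 : (√(2 * π))⁻¹ • x₀ + c • y = (√(2 * π))⁻¹ • (x₀ + ε • y) := by
      rw [smul_add, smul_smul]
    simp only [hΦ, h3, outcomeDensity]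
    rw [smul_inv_smul₀ hs.ne', add_sub_cancel_left, inv_smul_smul₀ hε.ne']
  rw [h1, h2, Measure.integral_comp_smul volume (fun y => Φ ((√(2 * π))⁻¹ • x₀ + y)),
    integral_add_left_eq_self, finrank_euclideanSpace, abs_of_pos (by positivity),
    Complex.real_smul, ← mul_assoc, ← Complex.ofReal_mul, mul_inv_cancel₀ (by positivity),
    Complex.ofReal_one, one_mul]

end Density

/-! ### The limit of sharp measurements -/

section Average

variable {Sig : Matrix (Fin 1 ⊕ Fin 1) (Fin 1 ⊕ Fin 1) ℝ} {F : Phase (Fin 1) → ℂ} {B : ℝ}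

theorem normalAverage_eq (hS : Sig.PosDef) (hF : Continuous F) (b : Phase (Fin 1)) :
    normalAverage Sig F b = ∫ u, F (b + u) ∂normalLaw 0 Sig := by
  rw [normalAverage, normalLaw_eq_map_add hS, integral_map (measurable_const_add _).aemeasurable
    hF.aestronglyMeasurable]

theorem norm_normalAverage_le (hS : Sig.PosDef) (hB : ∀ u, ‖F u‖ ≤ B) (b : Phase (Fin 1)) :
    ‖normalAverage Sig F b‖ ≤ B := by
  have := isProbabilityMeasure_normalLaw hS b
  have h := norm_integral_le_of_norm_le_const (μ := normalLaw b Sig) (ae_of_all _ hB)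
  rwa [probReal_univ, mul_one] at h

theorem continuous_normalAverage (hS : Sig.PosDef) (hF : Continuous F) (hB : ∀ u, ‖F u‖ ≤ B) :
    Continuous (normalAverage Sig F) := by
  have := isProbabilityMeasure_normalLaw hS 0
  rw [funext (normalAverage_eq hS hF)]
  refine continuous_of_dominated (bound := fun _ => B) (fun b => ?_) (fun b => ae_of_all _ fun u => hB _)
    (integrable_const _) (ae_of_all _ fun u => ?_)
  · exact (hF.comp (continuous_const.add continuous_id)).aestronglyMeasurable
  · exact hF.comp (continuous_id.add continuous_const)

end Average

section Limit

variable {N : ℕ} {S : Matrix (Modes N ⊕ Modes N) (Modes N ⊕ Modes N) ℝ}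

/-- The contribution of the noiseless outcome `l` to the average of `F` over the data displacement,
when the noise displaces the measured positions by `x`: the density of this event times the
conditional average of `F`. -/
def SyndromeCircuit.contribution (C : SyndromeCircuit N S) (Δ : ℝ) (F : Phase (Fin 1) → ℂ)
    (l x : Conf (Fin N)) : ℂ :=
  (outcomeDensity (Δ ^ 2 • measuredCov S) x : ℂ) * normalAverage (Δ ^ 2 • residualCov S) F
    (C.shift l + regression S *ᵥ WithLp.ofLp ((√(2 * π))⁻¹ • x))

theorem SyndromeCircuit.continuous_contribution (C : SyndromeCircuit N S)
    (hS : S ∈ Matrix.symplecticGroup (Modes N) ℝ) {Δ : ℝ} (hΔ : 0 < Δ) {F : Phase (Fin 1) → ℂ}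
    (hF : Continuous F) {B : ℝ} (hB : ∀ u, ‖F u‖ ≤ B) (l : Conf (Fin N)) :
    Continuous (C.contribution Δ F l) := by
  have hsig := (residualCov_posDef_and_det hS).1.smul (sq_pos_of_pos hΔ)
  refine (Complex.continuous_ofReal.comp (continuous_outcomeDensity _)).mul
    ((continuous_normalAverage hsig hF hB).comp (continuous_const.add ?_))
  exact (continuous_mulVec _).comp (continuous_ofLp_smul _)

theorem SyndromeCircuit.exists_norm_contribution_le (C : SyndromeCircuit N S)
    (hS : S ∈ Matrix.symplecticGroup (Modes N) ℝ) {Δ : ℝ} (hΔ : 0 < Δ) {F : Phase (Fin 1) → ℂ}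
    {B : ℝ} (hB0 : 0 ≤ B) (hB : ∀ u, ‖F u‖ ≤ B) (m : Conf (Fin N)) (ρ : ℝ) :
    ∃ a > 0, ∃ K, 0 ≤ K ∧ ∀ l x : Conf (Fin N), ‖x‖ ≤ ρ →
      ‖C.contribution Δ F l (m - l + x)‖ ≤ K * Real.exp (-(a * ‖l‖ ^ 2)) := by
  have hsig := (residualCov_posDef_and_det hS).1.smul (sq_pos_of_pos hΔ)
  obtain ⟨a, ha, K, hK, h⟩ := exists_outcomeDensity_le
    ((posDef_measuredCov hS).smul (sq_pos_of_pos hΔ)) m ρ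
  refine ⟨a, ha, K * B, by positivity, fun l x hx => ?_⟩
  rw [contribution, norm_mul, Complex.norm_real, Real.norm_of_nonneg (outcomeDensity_nonneg _ _)]
  calc _ ≤ (K * Real.exp (-(a * ‖l‖ ^ 2))) * B :=
        mul_le_mul (h l x hx) (norm_normalAverage_le hsig hB _) (norm_nonneg _) (by positivity)
    _ = _ := by ring

theorem integrable_norm_sq_of_hasCompactSupport {ι : Type} [Fintype ι] {k : Wave ι}
    (hkc : HasCompactSupport k) : Integrable fun y => ‖k y‖ ^ 2 := by
  have h : HasCompactSupport fun y => ‖k y‖ ^ 2 :=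
    hkc.mono fun y hy hk => hy (by simp only [hk, norm_zero]; norm_num)
  exact (k.continuous.norm.pow 2).integrable_of_hasCompactSupport h

theorem SyndromeCircuit.norm_packet_contribution_le (C : SyndromeCircuit N S)
    (hS : S ∈ Matrix.symplecticGroup (Modes N) ℝ) {Δ : ℝ} (hΔ : 0 < Δ) {F : Phase (Fin 1) → ℂ}
    {B : ℝ} (hB0 : 0 ≤ B) (hB : ∀ u, ‖F u‖ ≤ B) {k : Wave (Fin N)}
    {ρ : ℝ} (hk : ∀ x, k x ≠ 0 → ‖x‖ ≤ ρ) (m : Conf (Fin N)) :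
    ∃ a > 0, ∃ K, ∀ (l y : Conf (Fin N)) (ε : ℝ), 0 < ε → ε ≤ 1 →
      ‖((‖k y‖ ^ 2 : ℝ) : ℂ) * C.contribution Δ F l (m - l + ε • y)‖ ≤
        ‖k y‖ ^ 2 * (K * Real.exp (-(a * ‖l‖ ^ 2))) := by
  obtain ⟨a, ha, K, hK, h⟩ := C.exists_norm_contribution_le hS hΔ hB0 hB m ρ
  refine ⟨a, ha, K, fun l y ε hε hε1 => ?_⟩
  rw [norm_mul, Complex.norm_real, Real.norm_of_nonneg (by positivity)]
  by_cases hy : k y = 0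
  · simp [hy]
  · gcongr
    refine h _ _ ?_
    rw [norm_smul, Real.norm_of_nonneg hε.le]
    have := hk y hy
    nlinarith [norm_nonneg y]

theorem SyndromeCircuit.norm_integral_contribution_le (C : SyndromeCircuit N S)
    (hS : S ∈ Matrix.symplecticGroup (Modes N) ℝ) {Δ : ℝ} (hΔ : 0 < Δ) {F : Phase (Fin 1) → ℂ}
    {B : ℝ} (hB0 : 0 ≤ B) (hB : ∀ u, ‖F u‖ ≤ B) {k : Wave (Fin N)} (hkc : HasCompactSupport k)
    {ρ : ℝ} (hk : ∀ x, k x ≠ 0 → ‖x‖ ≤ ρ) (m : Conf (Fin N)) :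
    ∃ a > 0, ∃ K, ∀ (l : Conf (Fin N)) (ε : ℝ), 0 < ε → ε ≤ 1 →
      ‖∫ y, ((‖k y‖ ^ 2 : ℝ) : ℂ) * C.contribution Δ F l (m - l + ε • y)‖ ≤
        K * Real.exp (-(a * ‖l‖ ^ 2)) := by
  obtain ⟨a, ha, K, h⟩ := C.norm_packet_contribution_le hS hΔ hB0 hB hk m
  refine ⟨a, ha, (∫ y, ‖k y‖ ^ 2) * K, fun l ε hε hε1 => ?_⟩
  refine (norm_integral_le_of_norm_le ((integrable_norm_sq_of_hasCompactSupport hkc).mul_const _)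
    (ae_of_all _ fun y => h l y ε hε hε1)).trans ?_
  rw [integral_mul_const, mul_assoc]

/-- The state before the measurement, between wave packets of width `ε`: the ancilla wave packets
select the outcomes incoherently. -/
theorem SyndromeCircuit.noisyState_wavePacket (C : SyndromeCircuit N S)
    (hS : S ∈ Matrix.symplecticGroup (Modes N) ℝ) {Δ : ℝ} (hΔ : 0 < Δ) (f g : Wave (Fin 1)) {r : ℝ}
    (hr : C.outcomes.Pairwise fun x y => r ≤ dist x y) {k : Wave (Fin N)} {ρ : ℝ}
    (hkc : HasCompactSupport k) (hk : ∀ x, k x ≠ 0 → ‖x‖ ≤ ρ) (m : Conf (Fin N)) {ε : ℝ}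
    (hε : 0 < ε) (hε1 : ε ≤ 1) (hερ : 2 * ρ * ε < r) :
    C.noisyState Δ (tensor f (wavePacket k m ε)) (tensor g (wavePacket k m ε)) =
      (((√(2 * π))⁻¹ * ε) ^ N : ℝ) * ∑' l : C.outcomes, ((‖C.amp l‖ ^ 2 : ℝ) : ℂ) *
        ∫ y, ((‖k y‖ ^ 2 : ℝ) : ℂ) * C.contribution Δ (overlap C.data f g) l (m - l + ε • y) := by
  have hcount := C.countable_outcomes
  obtain ⟨B, hB0, hB⟩ := C.data_gkp.exists_norm_overlap_le f g
  have hG := (posDef_measuredCov hS).smul (sq_pos_of_pos hΔ)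
  obtain ⟨K, hK⟩ := k.continuous.bounded_above_of_compact_support hkc
  -- the weight with which the packet sees the displaced outcome
  set κ : Conf (Fin N) → Conf (Fin N) → ℝ := fun l x =>
    ‖k (ε⁻¹ • (√(2 * π) • x - (m - l)))‖ ^ 2 with hκ
  have hκc : ∀ l, Continuous (κ l) := fun l => by
    have := k.continuous
    simp only [hκ]; fun_prop
  have hκ0 : ∀ l x, 0 ≤ κ l x := fun l x => by positivity
  have hκK : ∀ l x, ‖κ l x‖ ≤ K ^ 2 := fun l x => by
    simp only [hκ, norm_pow, norm_norm]
    have := hK (ε⁻¹ • (√(2 * π) • x - (m - l)))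
    gcongr
  set w : (Modes N ⊕ Modes N → ℝ) → Modes N ⊕ Modes N → ℝ := fun z => S *ᵥ (Δ • z) with hw
  have hwc : Continuous w := (continuous_mulVec S).comp (continuous_const_smul Δ)
  set wm : (Modes N ⊕ Modes N → ℝ) → Conf (Fin N) :=
    fun z => WithLp.toLp 2 fun j => w z (measuredIndex N j) with hwm
  have hwmc : Continuous wm :=
    (PiLp.continuous_toLp 2 _).comp (continuous_pi fun j => (continuous_apply _).comp hwc)
  set wd : (Modes N ⊕ Modes N → ℝ) → Phase (Fin 1) := fun z i => w z (dataIndex N i) with hwd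
  have hwdc : Continuous wd := continuous_pi fun j => (continuous_apply _).comp hwc
  have hterm : ∀ (F : Phase (Fin 1) → ℂ), Continuous F → ∀ B : ℝ, 0 ≤ B → (∀ u, ‖F u‖ ≤ B) →
      ∀ l : Conf (Fin N), ∫ z, F (C.shift l + wd z) * (κ l (wm z) : ℂ) ∂stdLaw _ =
      (((√(2 * π))⁻¹ * ε) ^ N : ℝ) * ∫ y, ((‖k y‖ ^ 2 : ℝ) : ℂ) *
        C.contribution Δ F l (m - l + ε • y) := by
    intro F hF B hB0 hB l
    rw [integral_outcome hS hΔ hF hB0 hB _ (κ l) (hκc l) (hκK l)]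
    simp only [hκ]
    rw [integral_normalLaw_rescale _ (fun x => ‖k x‖ ^ 2) (fun a =>
      normalAverage (Δ ^ 2 • residualCov S) F (C.shift l + regression S *ᵥ a)) _ hε,
      Fintype.card_fin]
    rfl
  have hcont : ∀ l : Conf (Fin N), Continuous fun z =>
      overlap C.data f g (C.shift l + wd z) * (κ l (wm z) : ℂ) := fun l =>
    ((continuous_overlap _ _ _).comp (continuous_const.add hwdc)).mul
      (Complex.continuous_ofReal.comp ((hκc l).comp hwmc))
  have hint : ∀ l : C.outcomes, Integrable (fun z => ((‖C.amp l‖ ^ 2 : ℝ) : ℂ) *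
      (overlap C.data f g (C.shift l + wd z) * (κ l (wm z) : ℂ))) (stdLaw _) := by
    intro l
    refine Integrable.const_mul (Integrable.of_bound (hcont l).aestronglyMeasurable (B * K ^ 2)
      (ae_of_all _ fun z => ?_)) _
    rw [norm_mul, Complex.norm_real]
    exact mul_le_mul (hB _) (hκK _ _) (norm_nonneg _) hB0
  have hsum : Summable fun l : C.outcomes => ∫ z, ‖((‖C.amp l‖ ^ 2 : ℝ) : ℂ) *
      (overlap C.data f g (C.shift l + wd z) * (κ l (wm z) : ℂ))‖ ∂stdLaw _ := by
    -- the constant function `1` in place of the overlap gives the probability of the outcome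
    have hone : ∀ u : Phase (Fin 1), ‖(fun _ => (1 : ℂ)) u‖ ≤ (1 : ℝ) := fun u => by simp
    obtain ⟨a, ha, K', hK'⟩ := C.norm_integral_contribution_le hS hΔ zero_le_one hone hkc hk m
    have hκint : ∀ l : Conf (Fin N), Integrable (fun z => κ l (wm z)) (stdLaw (Modes N ⊕ Modes N)) :=
      fun l => Integrable.of_bound ((hκc l).comp hwmc).aestronglyMeasurable (K ^ 2)
        (ae_of_all _ fun z => hκK _ _)
    refine ((C.summable_amp ha).mul_right (B * (((√(2 * π))⁻¹ * ε) ^ N * K'))).of_nonneg_of_le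
      (fun l => integral_nonneg fun z => norm_nonneg _) fun l => ?_
    have h1 := hterm (fun _ => 1) continuous_const 1 zero_le_one hone l
    simp only [one_mul] at h1
    have h2 := congrArg norm h1
    rw [integral_complex_ofReal, norm_mul, Complex.norm_real, Complex.norm_real, Real.norm_of_nonneg
      (integral_nonneg fun z => hκ0 _ _), Real.norm_of_nonneg (by positivity)] at h2
    calc ∫ z, ‖((‖C.amp l‖ ^ 2 : ℝ) : ℂ) *
          (overlap C.data f g (C.shift l + wd z) * (κ l (wm z) : ℂ))‖ ∂stdLaw _
        ≤ ∫ z, ‖C.amp l‖ ^ 2 * (B * κ l (wm z)) ∂stdLaw _ := by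
          refine integral_mono (hint l).norm (((hκint l).const_mul _).const_mul _) fun z => ?_
          simp only [norm_mul, Complex.norm_real]
          rw [Real.norm_of_nonneg (hκ0 _ _), Real.norm_of_nonneg (by positivity)]
          have := hB (C.shift l + wd z)
          have := hκ0 l (wm z)
          gcongr
      _ = ‖C.amp l‖ ^ 2 * (B * ∫ z, κ l (wm z) ∂stdLaw _) := by
          rw [integral_const_mul, integral_const_mul]
      _ ≤ ‖C.amp l‖ ^ 2 * (B * (((√(2 * π))⁻¹ * ε) ^ N *
            (K' * Real.exp (-(a * ‖(l : Conf (Fin N))‖ ^ 2))))) := by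
          rw [h2]
          gcongr
          exact hK' l ε hε hε1
      _ = _ := by ring
  have hpoint : ∀ z, overlap C.output (tensor f (wavePacket k m ε)) (tensor g (wavePacket k m ε)) (w z) =
      ∑' l : C.outcomes, ((‖C.amp l‖ ^ 2 : ℝ) : ℂ) *
        (overlap C.data f g (C.shift l + wd z) * (κ l (wm z) : ℂ)) := by
    intro z
    rw [← (C.hasSum_overlap_output hr k hk m hε hερ f g (w z)).tsum_eq]
    refine tsum_congr fun l => ?_
    have h1 : (l : Conf (Fin N)) + √(2 * π) • wm z - m = √(2 * π) • wm z - (m - l) := by abel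
    simp only [hκ]
    rw [← h1]
  rw [C.noisyState_apply hΔ]
  change ∫ z, overlap C.output _ _ (w z) ∂stdLaw _ = _
  simp_rw [hpoint]
  rw [← (hasSum_integral_of_summable_integral_norm hint hsum).tsum_eq, ← tsum_mul_left]
  refine tsum_congr fun l => ?_
  rw [integral_const_mul, hterm _ (continuous_overlap _ _ _) B hB0 hB]
  ring

/-- The limit of sharper and sharper measurements, up to normalisation. -/
theorem SyndromeCircuit.tendsto_contribution (C : SyndromeCircuit N S)
    (hS : S ∈ Matrix.symplecticGroup (Modes N) ℝ) {Δ : ℝ} (hΔ : 0 < Δ) (f g : Wave (Fin 1))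
    {k : Wave (Fin N)} {ρ : ℝ} (hkc : HasCompactSupport k) (hk : ∀ x, k x ≠ 0 → ‖x‖ ≤ ρ)
    (m : Conf (Fin N)) :
    Tendsto (fun ε : ℝ => ∑' l : C.outcomes, ((‖C.amp l‖ ^ 2 : ℝ) : ℂ) *
        ∫ y, ((‖k y‖ ^ 2 : ℝ) : ℂ) * C.contribution Δ (overlap C.data f g) l (m - l + ε • y)) (𝓝[>] 0)
      (𝓝 (((∫ y, ‖k y‖ ^ 2 : ℝ) : ℂ) * ∑' l : C.outcomes, ((‖C.amp l‖ ^ 2 : ℝ) : ℂ) *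
        C.contribution Δ (overlap C.data f g) l (m - l))) := by
  obtain ⟨B, hB0, hB⟩ := C.data_gkp.exists_norm_overlap_le f g
  have hcont := C.continuous_contribution hS hΔ (continuous_overlap C.data f g) hB
  have hsmall : ∀ᶠ ε : ℝ in 𝓝[>] 0, 0 < ε ∧ ε ≤ 1 := by
    filter_upwards [Ioc_mem_nhdsGT zero_lt_one] with ε hε using hε
  obtain ⟨a, ha, K, hK⟩ := C.norm_integral_contribution_le hS hΔ hB0 hB hkc hk m
  obtain ⟨a', ha', K', hK'⟩ := C.norm_packet_contribution_le hS hΔ hB0 hB hk m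
  rw [← tsum_mul_left]
  refine tendsto_tsum_of_dominated_convergence ((C.summable_amp ha).mul_right K) (fun l => ?_) ?_
  · have h1 : Tendsto (fun ε : ℝ => ∫ y, ((‖k y‖ ^ 2 : ℝ) : ℂ) *
        C.contribution Δ (overlap C.data f g) l (m - l + ε • y)) (𝓝[>] 0)
        (𝓝 (∫ y, ((‖k y‖ ^ 2 : ℝ) : ℂ) * C.contribution Δ (overlap C.data f g) l (m - l))) := by
      refine tendsto_integral_filter_of_dominated_convergence
        (fun y => ‖k y‖ ^ 2 * (K' * Real.exp (-(a' * ‖(l : Conf (Fin N))‖ ^ 2))))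
        (Eventually.of_forall fun ε => ?_) ?_
        ((integrable_norm_sq_of_hasCompactSupport hkc).mul_const _) (ae_of_all _ fun y => ?_)
      · exact ((Complex.continuous_ofReal.comp (k.continuous.norm.pow 2)).mul ((hcont l).comp
          (continuous_const.add (continuous_const_smul ε)))).aestronglyMeasurable
      · filter_upwards [hsmall] with ε hε
        exact ae_of_all _ fun y => hK' l y ε hε.1 hε.2
      · have h2 : Continuous fun ε : ℝ => ((‖k y‖ ^ 2 : ℝ) : ℂ) *
            C.contribution Δ (overlap C.data f g) l (m - l + ε • y) :=
          continuous_const.mul ((hcont l).comp (by fun_prop))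
        have h3 := h2.tendsto 0
        rw [zero_smul, add_zero] at h3
        exact h3.mono_left nhdsWithin_le_nhds
    rw [integral_mul_const, integral_complex_ofReal] at h1
    have h2 := h1.const_mul ((‖C.amp l‖ ^ 2 : ℝ) : ℂ)
    rwa [mul_left_comm] at h2
  · filter_upwards [hsmall] with ε hε l
    rw [norm_mul, Complex.norm_real, Real.norm_of_nonneg (by positivity)]
    calc _ ≤ ‖C.amp l‖ ^ 2 * (K * Real.exp (-(a * ‖(l : Conf (Fin N))‖ ^ 2))) := by
          gcongr
          exact hK l ε hε.1 hε.2
      _ = _ := by ring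

end Limit

/-! ### The residual error is a Gaussian mixture -/

section Mixture

variable {Sig : Matrix (Fin 1 ⊕ Fin 1) (Fin 1 ⊕ Fin 1) ℝ} {F : Phase (Fin 1) → ℂ} {B : ℝ}

theorem GaussianMixture.integral_density_mul (M : GaussianMixture Sig) (hS : Sig.PosDef)
    (hF : Continuous F) (hB : ∀ u, ‖F u‖ ≤ B) :
    ∫ v, (M.density v : ℂ) * F v = ∑' i, (M.weight i : ℂ) * normalAverage Sig F (M.mean i) := by
  have hcount := M.countable_index
  have hcont : ∀ i, Continuous fun v => (normalDensity (M.mean i) Sig v : ℂ) * F v := fun i =>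
    (Complex.continuous_ofReal.comp (continuous_normalDensity_right _ _)).mul hF
  have hle : ∀ i v, ‖(normalDensity (M.mean i) Sig v : ℂ) * F v‖ ≤
      normalDensity (M.mean i) Sig v * B := fun i v => by
    rw [norm_mul, Complex.norm_real, Real.norm_of_nonneg (normalDensity_nonneg _ _ _)]
    exact mul_le_mul_of_nonneg_left (hB v) (normalDensity_nonneg _ _ _)
  have hint0 : ∀ i, Integrable fun v => (normalDensity (M.mean i) Sig v : ℂ) * F v := fun i =>
    ((integrable_normalDensity hS _).mul_const B).mono' (hcont i).aestronglyMeasurable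
      (ae_of_all _ (hle i))
  have hint : ∀ i, Integrable fun v =>
      (M.weight i : ℂ) * ((normalDensity (M.mean i) Sig v : ℂ) * F v) := fun i =>
    (hint0 i).const_mul _
  have hsum : Summable fun i =>
      ∫ v, ‖(M.weight i : ℂ) * ((normalDensity (M.mean i) Sig v : ℂ) * F v)‖ := by
    refine (M.weight_sum.summable.mul_right B).of_nonneg_of_le
      (fun i => integral_nonneg fun v => norm_nonneg _) fun i => ?_
    calc ∫ v, ‖(M.weight i : ℂ) * ((normalDensity (M.mean i) Sig v : ℂ) * F v)‖
        ≤ ∫ v, M.weight i * (normalDensity (M.mean i) Sig v * B) := by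
          refine integral_mono (hint i).norm
            (((integrable_normalDensity hS _).mul_const B).const_mul _) fun v => ?_
          simp only [norm_mul (M.weight i : ℂ), Complex.norm_real]
          rw [Real.norm_of_nonneg (M.weight_pos i).le]
          exact mul_le_mul_of_nonneg_left (hle i v) (M.weight_pos i).le
      _ = M.weight i * B := by
          rw [integral_const_mul, integral_mul_const, integral_normalDensity hS, one_mul]
  have h1 : ∀ v, (M.density v : ℂ) * F v =
      ∑' i, (M.weight i : ℂ) * ((normalDensity (M.mean i) Sig v : ℂ) * F v) := by
    intro v
    rw [GaussianMixture.density, Complex.ofReal_tsum, ← tsum_mul_right]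
    refine tsum_congr fun i => ?_
    rw [gaussianDensity_eq_normalDensity, Complex.ofReal_mul, mul_assoc]
  simp_rw [h1]
  rw [← (hasSum_integral_of_summable_integral_norm hint hsum).tsum_eq]
  refine tsum_congr fun i => ?_
  rw [integral_const_mul, normalAverage, integral_normalLaw]

/-- Displacements that give the data state the same overlaps may be exchanged as means. -/
theorem normalAverage_overlap_congr (hS : Sig.PosDef) {ψ : Ket (Fin 1)} {u u' : Phase (Fin 1)}
    (h : ∀ f g, overlap ψ f g u = overlap ψ f g u') (f g : Wave (Fin 1)) (c : Phase (Fin 1)) :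
    normalAverage Sig (overlap ψ f g) (u + c) = normalAverage Sig (overlap ψ f g) (u' + c) := by
  rw [normalAverage_eq hS (continuous_overlap _ _ _), normalAverage_eq hS (continuous_overlap _ _ _)]
  refine integral_congr_ae (ae_of_all _ fun v => ?_)
  simp only [add_assoc]
  rw [← overlap_displace, ← overlap_displace, h]

theorem normalAverage_overlap_displace (hS : Sig.PosDef) (ψ : Ket (Fin 1)) (f g : Wave (Fin 1))
    (v b : Phase (Fin 1)) :
    normalAverage Sig (overlap ψ (displace v f) (displace v g)) b =
      normalAverage Sig (overlap ψ f g) (b - v) := by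
  rw [normalAverage_eq hS (continuous_overlap _ _ _), normalAverage_eq hS (continuous_overlap _ _ _)]
  refine integral_congr_ae (ae_of_all _ fun u => ?_)
  have h := overlap_displace ψ f g (b + u) (-v)
  rw [neg_neg] at h
  simp only [h]
  congr 1
  abel

theorem exists_pos_normalAverage_overlap (hS : Sig.PosDef) {ψ : Ket (Fin 1)} (hψ : IsGKPState ψ)
    {f : Wave (Fin 1)} (hf : ψ f ≠ 0) (b : Phase (Fin 1)) :
    ∃ p : ℝ, 0 < p ∧ normalAverage Sig (overlap ψ f f) b = p := by
  obtain ⟨B, hB0, hB⟩ := hψ.exists_norm_overlap_le f f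
  set s : Phase (Fin 1) → ℝ := fun u => ‖ψ (displace (-u) f)‖ ^ 2 with hs
  have hsc : Continuous s :=
    ((ψ.continuous.comp ((continuous_displace f).comp continuous_neg)).norm).pow 2
  have hsB : ∀ u, ‖s u‖ ≤ B := fun u => by
    have := hB u
    rwa [overlap_self, Complex.norm_real] at this
  refine ⟨∫ u, normalDensity b Sig u * s u, ?_, ?_⟩
  · have hcont := (continuous_normalDensity_right b Sig).mul hsc
    have hnn : ∀ u, 0 ≤ normalDensity b Sig u * s u := fun u =>
      mul_nonneg (normalDensity_nonneg _ _ _) (by positivity)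
    have hint : Integrable fun u => normalDensity b Sig u * s u := by
      refine ((integrable_normalDensity hS b).mul_const B).mono' hcont.aestronglyMeasurable
        (ae_of_all _ fun u => ?_)
      rw [norm_mul, Real.norm_of_nonneg (normalDensity_nonneg _ _ _)]
      exact mul_le_mul_of_nonneg_left (hsB u) (normalDensity_nonneg _ _ _)
    refine (integral_pos_iff_support_of_nonneg hnn hint).2 (hcont.isOpen_support.measure_pos _ ⟨0, ?_⟩)
    have := hS.det_pos
    have h0 : s 0 ≠ 0 := by
      simp only [hs, neg_zero, displace_zero]
      positivity
    refine mul_ne_zero (ne_of_gt ?_) h0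
    unfold normalDensity
    positivity
  · rw [normalAverage, integral_normalLaw, ← integral_complex_ofReal]
    refine integral_congr_ae (ae_of_all _ fun u => ?_)
    simp only [overlap_self, hs, Complex.ofReal_mul]

end Mixture

section Residual

variable {N : ℕ} {S : Matrix (Modes N ⊕ Modes N) (Modes N ⊕ Modes N) ℝ}

theorem exists_abs_mulVec_le (R : Matrix (Fin 1 ⊕ Fin 1) (Fin N) ℝ) (a : Fin 1 ⊕ Fin 1) :
    ∃ A, 0 ≤ A ∧ ∀ x : Conf (Fin N), |(R *ᵥ WithLp.ofLp x) a| ≤ A * ‖x‖ := by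
  refine ⟨∑ j, |R a j|, Finset.sum_nonneg fun j _ => abs_nonneg _, fun x => ?_⟩
  rw [Matrix.mulVec, dotProduct, Finset.sum_mul]
  refine (Finset.abs_sum_le_sum_abs _ _).trans (Finset.sum_le_sum fun j _ => ?_)
  rw [abs_mul]
  gcongr
  simpa using PiLp.norm_apply_le x j

/-- Second moments with respect to Gaussian weights on the outcomes are finite. -/
theorem SyndromeCircuit.summable_amp_mul_norm_sq (C : SyndromeCircuit N S) {a : ℝ} (ha : 0 < a) :
    Summable fun l : C.outcomes => ‖C.amp l‖ ^ 2 * Real.exp (-(a * ‖(l : Conf (Fin N))‖ ^ 2)) *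
      ‖(l : Conf (Fin N))‖ ^ 2 := by
  refine ((C.summable_amp (half_pos ha)).mul_right (2 / a)).of_nonneg_of_le
    (fun l => by positivity) fun l => ?_
  set t := ‖(l : Conf (Fin N))‖ ^ 2 with ht
  have h1 : t ≤ 2 / a * Real.exp (a / 2 * t) := by
    have := Real.add_one_le_exp (a / 2 * t)
    rw [div_mul_eq_mul_div, le_div_iff₀ ha]
    linarith
  calc ‖C.amp l‖ ^ 2 * Real.exp (-(a * t)) * t
      ≤ ‖C.amp l‖ ^ 2 * Real.exp (-(a * t)) * (2 / a * Real.exp (a / 2 * t)) := by gcongr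
    _ = ‖C.amp l‖ ^ 2 * (Real.exp (-(a * t)) * Real.exp (a / 2 * t)) * (2 / a) := by ring
    _ = _ := by rw [← Real.exp_add]; ring_nf

/-- The residual error is a Gaussian mixture with covariance matrix `Δ² residualCov S` and with one
component for every noiseless outcome `l`: its weight is `|amp l|²` times the density with which
the noise moves `l` to the measured outcome. -/
theorem SyndromeCircuit.exists_gaussianMixture (C : SyndromeCircuit N S)
    (hS : S ∈ Matrix.symplecticGroup (Modes N) ℝ) {Δ : ℝ} (hΔ : 0 < Δ)
    (D : Conf (Fin N) → Phase (Fin 1)) (m : Conf (Fin N)) :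
    ∃ M : GaussianMixture (Δ ^ 2 • residualCov S),
      C.HasResidualError Δ D m M.density ∧ HasFiniteVariance M.density := by
  have hsig := (residualCov_posDef_and_det hS).1.smul (sq_pos_of_pos hΔ)
  have hG := (posDef_measuredCov hS).smul (sq_pos_of_pos hΔ)
  set Sig := Δ ^ 2 • residualCov S with hSig
  set G := Δ ^ 2 • measuredCov S with hGdef
  have hne : Nonempty C.outcomes := C.outcomes_nonempty.to_subtype
  -- the weights
  obtain ⟨a, ha, K, hK, hle⟩ := exists_outcomeDensity_le hG m 0
  set W : C.outcomes → ℝ := fun l => ‖C.amp l‖ ^ 2 * outcomeDensity G (m - l) with hW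
  have hWpos : ∀ l, 0 < W l := fun l => by
    have := C.amp_ne_zero l l.2
    have := outcomeDensity_pos hG (m - l)
    positivity
  have hWle : ∀ l : C.outcomes, W l ≤
      ‖C.amp l‖ ^ 2 * Real.exp (-(a * ‖(l : Conf (Fin N))‖ ^ 2)) * K := fun l => by
    have h := hle l 0 (by simp)
    rw [add_zero] at h
    calc W l ≤ ‖C.amp l‖ ^ 2 * (K * Real.exp (-(a * ‖(l : Conf (Fin N))‖ ^ 2))) := by
          simp only [hW]; gcongr
      _ = _ := by ring
  have hWsum : Summable W :=
    ((C.summable_amp ha).mul_right K).of_nonneg_of_le (fun l => (hWpos l).le) hWle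
  set Z := ∑' l, W l with hZ
  have hZpos : 0 < Z := hWsum.tsum_pos (fun l => (hWpos l).le) hne.some (hWpos _)
  -- the means, with shifts reduced modulo the stabiliser lattice so that they stay bounded
  obtain ⟨K', hK'⟩ := C.data_gkp.exists_bounded_overlap_eq
  choose red hred hredeq using hK'
  set c : C.outcomes → Phase (Fin 1) := fun l =>
    regression S *ᵥ WithLp.ofLp ((√(2 * π))⁻¹ • (m - (l : Conf (Fin N)))) with hc
  set μ : C.outcomes → Phase (Fin 1) := fun l => red (C.shift l) + c l with hμ
  let M : GaussianMixture Sig :=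
    { Index := C.outcomes
      weight := fun l => W l * Z⁻¹
      weight_pos := fun l => mul_pos (hWpos l) (inv_pos.2 hZpos)
      weight_sum := by
        have := hWsum.hasSum.mul_right Z⁻¹
        rwa [← hZ, mul_inv_cancel₀ hZpos.ne'] at this
      mean := fun l => μ l - D m }
  set σ : Op (Fin 1) := fun f g =>
    ∑' l : C.outcomes, ((W l * Z⁻¹ : ℝ) : ℂ) * normalAverage Sig (overlap C.data f g) (μ l) with hσ
  have hσeq : ∀ f g, σ f g = ((Z⁻¹ : ℝ) : ℂ) * ∑' l : C.outcomes, ((‖C.amp l‖ ^ 2 : ℝ) : ℂ) *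
      C.contribution Δ (overlap C.data f g) l (m - l) := by
    intro f g
    rw [← tsum_mul_left]
    refine tsum_congr fun l => ?_
    rw [SyndromeCircuit.contribution, normalAverage_overlap_congr hsig (hredeq (C.shift l))]
    simp only [hW, Complex.ofReal_mul]
    ring
  refine ⟨M, ⟨σ, ⟨?_, ?_⟩, ?_⟩, M.hasFiniteVariance hsig fun i => ?_⟩
  · obtain ⟨f, hf⟩ : ∃ f, C.data f ≠ 0 := by
      by_contra! h
      exact C.data_gkp.1 (ContinuousLinearMap.ext h)
    choose p hp hpeq using exists_pos_normalAverage_overlap hsig C.data_gkp hf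
    intro h0
    have h1 : σ f f = ((∑' l, W l * Z⁻¹ * p (μ l) : ℝ) : ℂ) := by
      rw [Complex.ofReal_tsum]
      refine tsum_congr fun l => ?_
      rw [hpeq, Complex.ofReal_mul (W l * Z⁻¹)]
    obtain ⟨B, hB0, hB⟩ := C.data_gkp.exists_norm_overlap_le f f
    have hpB : ∀ b, p b ≤ B := fun b => by
      have := norm_normalAverage_le hsig hB b
      rwa [hpeq, Complex.norm_real, Real.norm_of_nonneg (hp b).le] at this
    have h2 : 0 < ∑' l, W l * Z⁻¹ * p (μ l) := by
      have hpos : ∀ l, 0 < W l * Z⁻¹ * p (μ l) := fun l =>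
        mul_pos (mul_pos (hWpos l) (inv_pos.2 hZpos)) (hp _)
      refine Summable.tsum_pos ?_ (fun l => (hpos l).le) hne.some (hpos _)
      refine ((hWsum.mul_right Z⁻¹).mul_right B).of_nonneg_of_le (fun l => (hpos l).le) fun l => ?_
      exact mul_le_mul_of_nonneg_left (hpB _) (mul_pos (hWpos l) (inv_pos.2 hZpos)).le
    rw [h0] at h1
    exact h2.ne' (Complex.ofReal_eq_zero.1 h1.symm)
  · intro k hk0 hkc _
    obtain ⟨r, hr0, hr⟩ := C.outcomes_separated
    obtain ⟨ρ, hρ⟩ := hkc.isCompact.isBounded.exists_norm_le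
    have hkρ : ∀ x, k x ≠ 0 → ‖x‖ ≤ ρ := fun x hx => hρ x (subset_tsupport _ hx)
    set L := ∫ y, ‖k y‖ ^ 2 with hL
    have hLpos : 0 < L := by
      have hcont : Continuous fun y => ‖k y‖ ^ 2 := k.continuous.norm.pow 2
      refine (integral_pos_iff_support_of_nonneg (fun y => by positivity)
        (integrable_norm_sq_of_hasCompactSupport hkc)).2 (hcont.isOpen_support.measure_pos _ ?_)
      obtain ⟨y, hy⟩ : ∃ y, k y ≠ 0 := by
        by_contra! h
        exact hk0 (SchwartzMap.ext h)
      exact ⟨y, by simpa using hy⟩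
    -- the Jacobian of the rescaling by `ε`, the mass of the squared packet and the total weight
    refine ⟨fun ε => (((√(2 * π))⁻¹ * ε) ^ N * (L * Z))⁻¹, fun ε hε => by positivity, fun f g => ?_⟩
    have hlim := (C.tendsto_contribution hS hΔ f g hkc hkρ m).const_mul (((L * Z)⁻¹ : ℝ) : ℂ)
    have hval : (((L * Z)⁻¹ : ℝ) : ℂ) * ((L : ℂ) * ∑' l : C.outcomes, ((‖C.amp l‖ ^ 2 : ℝ) : ℂ) *
        C.contribution Δ (overlap C.data f g) l (m - l)) = σ f g := by
      rw [hσeq, ← mul_assoc, ← Complex.ofReal_mul]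
      congr 2
      field_simp
    rw [hval] at hlim
    refine hlim.congr' ?_
    have h1 : ∀ᶠ ε : ℝ in 𝓝[>] 0, 2 * ρ * ε < r := by
      have h2 : Tendsto (fun ε : ℝ => 2 * ρ * ε) (𝓝[>] 0) (𝓝 (2 * ρ * 0)) :=
        ((continuous_const_mul _).tendsto 0).mono_left nhdsWithin_le_nhds
      exact h2.eventually_lt_const (by simpa using hr0)
    filter_upwards [h1, Ioc_mem_nhdsGT zero_lt_one] with ε hε1 hε
    have hε0 := hε.1
    rw [C.noisyState_wavePacket hS hΔ f g hr hkc hkρ m hε.1 hε.2 hε1, ← mul_assoc,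
      ← Complex.ofReal_mul]
    congr 2
    field_simp
  · funext f g
    obtain ⟨B, hB0, hB⟩ := C.data_gkp.exists_norm_overlap_le f g
    have h1 : randomDisplacement M.density (pureState C.data) f g =
        ∫ v, (M.density v : ℂ) * overlap C.data f g v := rfl
    rw [h1, M.integral_density_mul hsig (continuous_overlap _ _ _) hB, conjDisplace, neg_neg]
    refine tsum_congr fun l => ?_
    rw [normalAverage_overlap_displace hsig]
  · obtain ⟨A, hA, hAle⟩ := exists_abs_mulVec_le (regression S) i
    set A₁ := |K'| + A * ((√(2 * π))⁻¹ * ‖m‖) + |D m i| with hA₁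
    set A₂ := A * (√(2 * π))⁻¹ with hA₂
    have hmean : ∀ l : C.outcomes, (μ l i - D m i) ^ 2 ≤
        2 * A₁ ^ 2 + 2 * A₂ ^ 2 * ‖(l : Conf (Fin N))‖ ^ 2 := by
      intro l
      have h1 : |red (C.shift l) i| ≤ |K'| :=
        (norm_le_pi_norm (red (C.shift l)) i).trans ((hred _).trans (le_abs_self _))
      have h2 : |c l i| ≤ A * ((√(2 * π))⁻¹ * (‖m‖ + ‖(l : Conf (Fin N))‖)) := by
        refine (hAle _).trans ?_
        rw [norm_smul, Real.norm_of_nonneg (by positivity)]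
        gcongr
        exact norm_sub_le _ _
      have h3 : |μ l i - D m i| ≤ A₁ + A₂ * ‖(l : Conf (Fin N))‖ := by
        calc |μ l i - D m i| ≤ |red (C.shift l) i| + |c l i| + |D m i| :=
              (abs_sub _ _).trans (add_le_add_left (abs_add_le _ _) _)
          _ ≤ |K'| + A * ((√(2 * π))⁻¹ * (‖m‖ + ‖(l : Conf (Fin N))‖)) + |D m i| := by gcongr
          _ = _ := by rw [hA₁, hA₂]; ring
      rw [← sq_abs]
      have h4 : |μ l i - D m i| ^ 2 ≤ (A₁ + A₂ * ‖(l : Conf (Fin N))‖) ^ 2 := by gcongr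
      nlinarith [sq_nonneg (A₁ - A₂ * ‖(l : Conf (Fin N))‖)]
    have hs1 := (C.summable_amp ha).mul_right (K * Z⁻¹ * (2 * A₁ ^ 2))
    have hs2 := (C.summable_amp_mul_norm_sq ha).mul_right (K * Z⁻¹ * (2 * A₂ ^ 2))
    refine (hs1.add hs2).of_nonneg_of_le
      (fun l => mul_nonneg (M.weight_pos l).le (sq_nonneg _)) fun l => ?_
    calc M.weight l * M.mean l i ^ 2
        ≤ ‖C.amp l‖ ^ 2 * Real.exp (-(a * ‖(l : Conf (Fin N))‖ ^ 2)) * K * Z⁻¹ *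
          (2 * A₁ ^ 2 + 2 * A₂ ^ 2 * ‖(l : Conf (Fin N))‖ ^ 2) := by
          refine mul_le_mul ?_ (hmean l) (sq_nonneg _) (by positivity)
          exact mul_le_mul_of_nonneg_right (hWle l) (inv_pos.2 hZpos).le
      _ = _ := by ring

end Residual

/-! ### The unitary of the biased Steane circuit -/

section SteaneUnitary

theorem conf_ext_modes_one {x y : Conf (Modes 1)} (h0 : x (Sum.inl 0) = y (Sum.inl 0))
    (h1 : x (Sum.inr 0) = y (Sum.inr 0)) : x = y := by
  ext i
  rcases i with i | i <;> rw [Subsingleton.elim i 0]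
  exacts [h0, h1]

@[simp] theorem point₂_inl (x y : ℝ) (i : Fin 1) : point₂ x y (Sum.inl i) = x := rfl

@[simp] theorem point₂_inr (x y : ℝ) (i : Fin 1) : point₂ x y (Sum.inr i) = y := rfl

/-- The change of positions `(x, y) ↦ (x, s (y - x))`. -/
def steaneMap (s : ℝ) (hs : s ≠ 0) : Conf (Modes 1) ≃L[ℝ] Conf (Modes 1) :=
  LinearEquiv.toContinuousLinearEquiv
    { toFun := fun x => point₂ (x (Sum.inl 0)) (s * (x (Sum.inr 0) - x (Sum.inl 0)))
      invFun := fun x => point₂ (x (Sum.inl 0)) (x (Sum.inl 0) + s⁻¹ * x (Sum.inr 0))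
      map_add' := fun x y => conf_ext_modes_one (by simp) (by simp; ring)
      map_smul' := fun c x => conf_ext_modes_one (by simp) (by simp; ring)
      left_inv := fun x => conf_ext_modes_one (by simp) (by simp [hs])
      right_inv := fun x => conf_ext_modes_one (by simp) (by simp [hs]) }

theorem steaneMap_apply {s : ℝ} (hs : s ≠ 0) (x : Conf (Modes 1)) :
    steaneMap s hs x = point₂ (x (Sum.inl 0)) (s * (x (Sum.inr 0) - x (Sum.inl 0))) := rfl

theorem steaneMap_symm_apply {s : ℝ} (hs : s ≠ 0) (x : Conf (Modes 1)) :
    (steaneMap s hs).symm x = point₂ (x (Sum.inl 0)) (x (Sum.inl 0) + s⁻¹ * x (Sum.inr 0)) := rfl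

theorem det_steaneMap {s : ℝ} (hs : s ≠ 0) :
    LinearMap.det ((steaneMap s hs : Conf (Modes 1) →L[ℝ] Conf (Modes 1)) :
      Conf (Modes 1) →ₗ[ℝ] Conf (Modes 1)) = s := by
  rw [← LinearMap.det_toMatrix (EuclideanSpace.basisFun (Modes 1) ℝ).toBasis, det_fin_one_sum]
  simp [LinearMap.toMatrix_apply, steaneMap_apply]

theorem integral_comp_steaneMap {s : ℝ} (hs : 0 < s) (F : Conf (Modes 1) → ℂ) :
    ∫ x, F (steaneMap s hs.ne' x) = (s⁻¹ : ℝ) * ∫ x, F x := by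
  have h1 := Measure.map_linearMap_addHaar_eq_smul_addHaar (volume : Measure (Conf (Modes 1)))
    (f := ((steaneMap s hs.ne' : Conf (Modes 1) →L[ℝ] Conf (Modes 1)) :
      Conf (Modes 1) →ₗ[ℝ] Conf (Modes 1))) (by rw [det_steaneMap]; exact hs.ne')
  rw [det_steaneMap, abs_of_pos (inv_pos.2 hs)] at h1
  have h2 := (steaneMap s hs.ne').toHomeomorph.measurableEmbedding.integral_map
    (μ := (volume : Measure (Conf (Modes 1)))) F
  have h3 : Measure.map (steaneMap s hs.ne').toHomeomorph (volume : Measure (Conf (Modes 1))) =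
      ENNReal.ofReal s⁻¹ • volume := h1
  rw [h3, integral_smul_measure, ENNReal.toReal_ofReal (inv_nonneg.2 hs.le), Complex.real_smul] at h2
  exact h2.symm

/-- The unitary `(U f)(x, y) = √s f(x, s (y - x))`, which is `exp(-i q₁ p₂) Sq₂(s)`. -/
def steaneUnitary (s : ℝ) (hs : 0 < s) : Wave (Modes 1) ≃L[ℂ] Wave (Modes 1) :=
  ContinuousLinearEquiv.equivOfInverse
    ((√s : ℂ) • SchwartzMap.compCLMOfContinuousLinearEquiv ℂ (steaneMap s hs.ne'))
    ((√s : ℂ)⁻¹ • SchwartzMap.compCLMOfContinuousLinearEquiv ℂ (steaneMap s hs.ne').symm)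
    (fun f => by
      have h : (√s : ℂ) ≠ 0 := Complex.ofReal_ne_zero.2 (Real.sqrt_pos.2 hs).ne'
      ext x
      simp [h])
    (fun f => by
      have h : (√s : ℂ) ≠ 0 := Complex.ofReal_ne_zero.2 (Real.sqrt_pos.2 hs).ne'
      ext x
      simp [h])

theorem steaneUnitary_apply {s : ℝ} (hs : 0 < s) (f : Wave (Modes 1)) (x : Conf (Modes 1)) :
    steaneUnitary s hs f x = √s * f (steaneMap s hs.ne' x) := rfl

theorem steaneUnitary_symm_apply {s : ℝ} (hs : 0 < s) (f : Wave (Modes 1)) (x : Conf (Modes 1)) :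
    (steaneUnitary s hs).symm f x = (√s : ℂ)⁻¹ * f ((steaneMap s hs.ne').symm x) := rfl

/-- The action of the Steane unitary on the quadratures: `q₂ ↦ q₁ + s⁻¹ q₂`, `p₁ ↦ p₁ - s p₂`,
`p₂ ↦ s p₂`. -/
def steaneMatrix (s : ℝ) : Matrix (Modes 1 ⊕ Modes 1) (Modes 1 ⊕ Modes 1) ℝ :=
  Matrix.fromBlocks (Matrix.fromBlocks 1 0 1 (s⁻¹ • 1)) 0 0 (Matrix.fromBlocks 1 (-s • 1) 0 (s • 1))

theorem steaneMatrix_mem_symplecticGroup {s : ℝ} (hs : s ≠ 0) :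
    steaneMatrix s ∈ Matrix.symplecticGroup (Modes 1) ℝ := by
  rw [SymplecticGroup.mem_iff, Matrix.J, steaneMatrix]
  simp [Matrix.fromBlocks_multiply, Matrix.fromBlocks_transpose, hs]

theorem isGaussianUnitary_steaneUnitary {s : ℝ} (hs : 0 < s) :
    IsGaussianUnitary (steaneUnitary s hs) (steaneMatrix s) where
  inner_eq f g := by
    have h1 : ∀ x, conj (steaneUnitary s hs f x) * steaneUnitary s hs g x =
        (s : ℂ) * (fun y => conj (f y) * g y) (steaneMap s hs.ne' x) := by
      intro x
      have h2 : (√s : ℂ) * (√s : ℂ) = s := by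
        rw [← Complex.ofReal_mul, Real.mul_self_sqrt hs.le]
      rw [steaneUnitary_apply, steaneUnitary_apply, map_mul, Complex.conj_ofReal, ← h2]
      ring
    simp_rw [h1]
    rw [integral_const_mul, integral_comp_steaneMap hs fun y => conj (f y) * g y, ← mul_assoc,
      ← Complex.ofReal_mul, mul_inv_cancel₀ hs.ne', Complex.ofReal_one, one_mul]
  conj_quadrature a f := by
    have hsC : (s : ℂ) ≠ 0 := Complex.ofReal_ne_zero.2 hs.ne'
    have hderiv : ∀ v : Conf (Modes 1), ∂_{v} (steaneUnitary s hs f) =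
        steaneUnitary s hs (∂_{steaneMap s hs.ne' v} f) := by
      intro v
      have h := SchwartzMap.lineDerivOp_compCLMOfContinuousLinearEquiv ℂ v (steaneMap s hs.ne') f
      have h1 : steaneUnitary s hs f =
        (√s : ℂ) • SchwartzMap.compCLMOfContinuousLinearEquiv ℂ (steaneMap s hs.ne') f := rfl
      rw [h1, LineDeriv.lineDerivOp_smul, h]
      rfl
    have e1 : steaneMap s hs.ne' (EuclideanSpace.single (Sum.inl 0) 1) =
        EuclideanSpace.single (Sum.inl 0) (1 : ℝ) + (-s) • EuclideanSpace.single (Sum.inr 0) (1 : ℝ) :=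
      conf_ext_modes_one (by simp [steaneMap_apply]) (by simp [steaneMap_apply])
    have e2 : steaneMap s hs.ne' (EuclideanSpace.single (Sum.inr 0) 1) =
        s • EuclideanSpace.single (Sum.inr 0) (1 : ℝ) :=
      conf_ext_modes_one (by simp [steaneMap_apply]) (by simp [steaneMap_apply])
    rcases a with (i | i) | (i | i) <;> obtain rfl := Subsingleton.elim i 0
    · ext x
      simp [quadrature, steaneMatrix, positionOp_apply, steaneUnitary_apply, steaneMap_apply]
      ring
    · ext x
      simp [quadrature, steaneMatrix, positionOp_apply, steaneUnitary_apply, steaneMap_apply]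
      field_simp
      ring
    · ext x
      simp only [quadrature, momentumOp, Sum.elim_inr, FunLike.coe_smul, Pi.smul_apply,
        LineDeriv.lineDerivOpCLM_apply, hderiv, e1, LineDeriv.lineDerivOp_left_add,
        LineDeriv.lineDerivOp_left_smul]
      simp [steaneMatrix, steaneUnitary_apply, momentumOp]
      ring
    · ext x
      simp only [quadrature, momentumOp, Sum.elim_inr, FunLike.coe_smul, Pi.smul_apply,
        LineDeriv.lineDerivOpCLM_apply, hderiv, e2, LineDeriv.lineDerivOp_left_smul]
      simp [steaneMatrix, steaneUnitary_apply, momentumOp]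
      ring

theorem residualCov_steaneMatrix {s : ℝ} (hs : 0 < s) : residualCov (steaneMatrix s) =
    Matrix.diagonal (Sum.elim (fun _ => (1 + s ^ 2)⁻¹) fun _ => 1 + s ^ 2) := by
  have hm : measuredCov (steaneMatrix s) = (1 + (s ^ 2)⁻¹) • 1 := by
    ext i j
    obtain rfl := Subsingleton.elim i 0
    obtain rfl := Subsingleton.elim j 0
    simp [measuredCov, measuredIndex, steaneMatrix, Matrix.mul_apply, Fintype.sum_sum_type]
    ring
  have hinv : (measuredCov (steaneMatrix s))⁻¹ = (1 + (s ^ 2)⁻¹)⁻¹ • 1 := by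
    refine Matrix.inv_eq_right_inv ?_
    rw [hm, Matrix.smul_mul, Matrix.one_mul, smul_smul, mul_inv_cancel₀ (by positivity), one_smul]
  rw [residualCov, hinv]
  ext i j
  rcases i with i | i <;> rcases j with j | j <;> obtain rfl := Subsingleton.elim i 0 <;>
    obtain rfl := Subsingleton.elim j 0 <;>
    simp [dataCov, crossCov, dataIndex, measuredIndex, steaneMatrix, Matrix.mul_apply,
      Fintype.sum_sum_type]
  · field_simp
    ring
  · ring

end SteaneUnitary

/-! ### Rectangular GKP states -/

section Sampling

variable {ι : Type} [Fintype ι] {J : Type}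

theorem norm_wave_le (n : ℕ) (f : Wave ι) (x : Conf ι) : ‖f x‖ ≤ ((1 + ‖x‖) ^ n)⁻¹ *
    (2 ^ n * ((Finset.Iic (n, 0)).sup (schwartzSeminormFamily ℂ (Conf ι) ℂ)) f) := by
  rw [← div_eq_inv_mul, le_div_iff₀' (by positivity)]
  have h := SchwartzMap.one_add_le_sup_seminorm_apply (𝕜 := ℂ) (m := (n, 0)) (k := n) (n := 0)
    le_rfl le_rfl f x
  rwa [norm_iteratedFDeriv_zero] at h

theorem summable_sample {x : J → Conf ι} {c : J → ℂ} {K : ℝ} (hc : ∀ j, ‖c j‖ ≤ K) {n : ℕ}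
    (hx : Summable fun j => ((1 + ‖x j‖) ^ n)⁻¹) (f : Wave ι) :
    Summable fun j => ‖c j * conj (f (x j))‖ := by
  refine ((hx.mul_right (2 ^ n * ((Finset.Iic (n, 0)).sup
    (schwartzSeminormFamily ℂ (Conf ι) ℂ)) f)).mul_left K).of_nonneg_of_le
    (fun j => norm_nonneg _) fun j => ?_
  rw [norm_mul, RCLike.norm_conj]
  exact mul_le_mul (hc j) (norm_wave_le n f _) (norm_nonneg _) ((norm_nonneg _).trans (hc j))

/-- The generalised ket `∑ⱼ cⱼ |xⱼ⟩_q`. -/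
def sampleKet (x : J → Conf ι) (c : J → ℂ) {K : ℝ} (hc : ∀ j, ‖c j‖ ≤ K) {n : ℕ}
    (hx : Summable fun j => ((1 + ‖x j‖) ^ n)⁻¹) : Ket ι :=
  SchwartzMap.mkCLMtoNormedSpace (fun f => ∑' j, c j * conj (f (x j)))
    (fun f g => by
      rw [← (summable_sample hc hx f).of_norm.tsum_add (summable_sample hc hx g).of_norm]
      refine tsum_congr fun j => ?_
      rw [add_apply, map_add, mul_add])
    (fun a f => by
      rw [smul_eq_mul, ← tsum_mul_left]
      refine tsum_congr fun j => ?_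
      rw [smul_apply, smul_eq_mul, map_mul]
      ring)
    ⟨Finset.Iic (n, 0), |K| * ((∑' j, ((1 + ‖x j‖) ^ n)⁻¹) * 2 ^ n), by positivity, fun f => by
      refine (norm_tsum_le_tsum_norm (summable_sample hc hx f)).trans ?_
      have h := (hx.mul_right (2 ^ n * ((Finset.Iic (n, 0)).sup
        (schwartzSeminormFamily ℂ (Conf ι) ℂ)) f)).mul_left |K|
      refine ((summable_sample hc hx f).tsum_le_tsum (fun j => ?_) h).trans_eq ?_
      · rw [norm_mul, RCLike.norm_conj]
        exact mul_le_mul ((hc j).trans (le_abs_self K)) (norm_wave_le n f _) (norm_nonneg _)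
          (abs_nonneg _)
      · rw [tsum_mul_left, tsum_mul_right]
        ring⟩

theorem hasSum_sampleKet (x : J → Conf ι) (c : J → ℂ) {K : ℝ} (hc : ∀ j, ‖c j‖ ≤ K) {n : ℕ}
    (hx : Summable fun j => ((1 + ‖x j‖) ^ n)⁻¹) (f : Wave ι) :
    HasSum (fun j => c j * conj (f (x j))) (sampleKet x c hc hx f) :=
  (summable_sample hc hx f).of_norm.hasSum

theorem summable_int_mul {a : ℝ} (ha : 0 < a) :
    Summable fun n : ℤ => ((1 + |n * a|) ^ 2)⁻¹ := by
  have h := (Real.summable_one_div_int_pow (p := 2)).2 one_lt_two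
  refine Summable.of_norm_bounded_eventually (g := fun n : ℤ => (a ^ 2)⁻¹ * (1 / (n : ℝ) ^ 2))
    (h.mul_left _) ?_
  filter_upwards [(Set.finite_singleton (0 : ℤ)).compl_mem_cofinite] with n hn
  have hn' : (n : ℝ) ≠ 0 := by exact_mod_cast hn
  rw [Real.norm_of_nonneg (by positivity), one_div, ← mul_inv]
  refine inv_anti₀ (by positivity) ?_
  have h1 : a ^ 2 * (n : ℝ) ^ 2 = |n * a| ^ 2 := by rw [sq_abs]; ring
  rw [h1]
  gcongr
  linarith

end Sampling

section Rectangular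

theorem norm_point (x : ℝ) : ‖point x‖ = |x| := by
  simp [point, EuclideanSpace.norm_eq, Real.sqrt_sq_eq_abs]

theorem point_sub (x y : ℝ) : point x - point y = point (x - y) := rfl

/-- The amplitude of the `n`-th grid point. -/
def gridAmp (α β : ℂ) (n : ℤ) : ℂ := if Even n then α else β

theorem norm_gridAmp_le (α β : ℂ) (n : ℤ) : ‖gridAmp α β n‖ ≤ ‖α‖ + ‖β‖ := by
  unfold gridAmp
  split_ifs
  · linarith [norm_nonneg β]
  · linarith [norm_nonneg α]

theorem gridAmp_add_two (α β : ℂ) (n : ℤ) : gridAmp α β (n + 2) = gridAmp α β n := by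
  simp [gridAmp]

theorem summable_point {a : ℝ} (ha : 0 < a) :
    Summable fun n : ℤ => ((1 + ‖point (n * a)‖) ^ 2)⁻¹ := by
  simpa only [norm_point] using summable_int_mul ha

theorem sqrt_mul_pi_pos {lam : ℝ} (hl : 0 < lam) : 0 < √(lam * π) := by positivity

/-- The rectangular state `α|0̄⟩ + β|1̄⟩`. -/
def rectangularState {lam : ℝ} (hl : 0 < lam) (α β : ℂ) : Ket (Fin 1) :=
  sampleKet (fun n : ℤ => point (n * √(lam * π))) (gridAmp α β) (norm_gridAmp_le α β)
    (summable_point (sqrt_mul_pi_pos hl))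

theorem isRectangularState_rectangularState {lam : ℝ} (hl : 0 < lam) (α β : ℂ) :
    IsRectangularState lam α β (rectangularState hl α β) :=
  hasSum_sampleKet _ _ (norm_gridAmp_le α β) (summable_point (sqrt_mul_pi_pos hl))

theorem rectangularState_ne_zero {lam : ℝ} (hl : 0 < lam) {α β : ℂ} (h : α ≠ 0 ∨ β ≠ 0) :
    rectangularState hl α β ≠ 0 := by
  have ha := sqrt_mul_pi_pos hl
  obtain ⟨n₀, hn₀⟩ : ∃ n, gridAmp α β n ≠ 0 := by
    rcases h with h | h
    · exact ⟨0, by simpa [gridAmp] using h⟩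
    · exact ⟨1, by simpa [gridAmp] using h⟩
  -- a test function that sees a single grid point
  let b : ContDiffBump (point (n₀ * √(lam * π))) :=
    ⟨√(lam * π) / 2, √(lam * π), by positivity, by linarith⟩
  have hbc : HasCompactSupport fun x => (b x : ℂ) :=
    b.hasCompactSupport.comp_left (g := fun t : ℝ => (t : ℂ)) Complex.ofReal_zero
  have hbs : ContDiff ℝ ∞ fun x => (b x : ℂ) := Complex.ofRealCLM.contDiff.comp b.contDiff
  let f : Wave (Fin 1) := hbc.toSchwartzMap hbs
  have hf : ∀ x, f x = (b x : ℂ) := fun x => rfl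
  have h1 := isRectangularState_rectangularState hl α β f
  have h2 : rectangularState hl α β f = gridAmp α β n₀ := by
    refine h1.unique ?_
    convert hasSum_single n₀ fun n hn => ?_ using 1
    · have h3 : b (point (n₀ * √(lam * π))) = 1 := b.one_of_mem_closedBall (by simp [b.rIn_pos.le])
      rw [hf, h3, Complex.ofReal_one, map_one, mul_one, gridAmp]
    · have h3 : b (point (n * √(lam * π))) = 0 := by
        refine b.zero_of_le_dist ?_
        rw [dist_eq_norm, point_sub, norm_point, ← sub_mul, abs_mul, abs_of_pos ha]
        have h4 : (1 : ℝ) ≤ |(n : ℝ) - n₀| := by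
          exact_mod_cast Int.one_le_abs (sub_ne_zero.2 hn)
        exact le_mul_of_one_le_left ha.le h4
      rw [hf, h3, Complex.ofReal_zero, map_zero, mul_zero]
  intro h0
  rw [h0] at h2
  exact hn₀ h2.symm

theorem displace_neg_single_inl (d : ℝ) (f : Wave (Fin 1)) (x : ℝ) :
    displace (-Pi.single (Sum.inl 0) d) f (point x) = f (point (x + √(2 * π) * d)) := by
  have h1 : momPart (-Pi.single (Sum.inl 0) d : Phase (Fin 1)) = 0 := by
    ext i
    simp [momPart]
  have h2 : posPart (-Pi.single (Sum.inl 0) d : Phase (Fin 1)) = point (-d) := by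
    ext i
    obtain rfl := Subsingleton.elim i 0
    simp [posPart, point]
  have h3 : point x - √(2 * π) • point (-d) = point (x + √(2 * π) * d) := by
    ext i
    simp [point]
  rw [displace_apply, displacePhase, h1, h2, h3]
  simp

theorem displace_neg_single_inr (d : ℝ) (f : Wave (Fin 1)) (x : ℝ) :
    displace (-Pi.single (Sum.inr 0) d) f (point x) =
      Complex.exp ((-(√(2 * π) * d * x) : ℝ) * Complex.I) * f (point x) := by
  have h1 : posPart (-Pi.single (Sum.inr 0) d : Phase (Fin 1)) = 0 := by
    ext i
    simp [posPart]
  have h2 : momPart (-Pi.single (Sum.inr 0) d : Phase (Fin 1)) = point (-d) := by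
    ext i
    obtain rfl := Subsingleton.elim i 0
    simp [momPart, point]
  have h3 : displacePhase (-Pi.single (Sum.inr 0) d : Phase (Fin 1)) (point x) =
      -(√(2 * π) * d * x) := by
    rw [displacePhase, h1, h2, inner_zero_left, inner_conf]
    simp [point]
    ring
  rw [displace_apply, h3, h1, smul_zero, sub_zero]

theorem isGKPState_rectangularState {lam : ℝ} (hl : 0 < lam) {α β : ℂ} (h : α ≠ 0 ∨ β ≠ 0) :
    IsGKPState (rectangularState hl α β) := by
  set ψ := rectangularState hl α β with hψ
  have hrect := isRectangularState_rectangularState hl α β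
  have ha := sqrt_mul_pi_pos hl
  -- the stabilisers shift the position by two grid spacings, and the momentum by an amount that
  -- multiplies the grid points by `1`
  set d : Fin 1 ⊕ Fin 1 → ℝ := Sum.elim (fun _ => √2 * √lam) fun _ => √2 / √lam with hd
  have hd0 : ∀ i, d i ≠ 0 := by
    rintro (i | i) <;> simp only [hd, Sum.elim_inl, Sum.elim_inr] <;> positivity
  have hshift : √(2 * π) * (√2 * √lam) = 2 * √(lam * π) := by
    rw [Real.sqrt_mul zero_le_two, Real.sqrt_mul hl.le]
    linear_combination √π * √lam * Real.mul_self_sqrt (zero_le_two (α := ℝ))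
  have hphase : √(2 * π) * (√2 / √lam) * √(lam * π) = 2 * π := by
    rw [Real.sqrt_mul zero_le_two, Real.sqrt_mul hl.le]
    have := Real.mul_self_sqrt (zero_le_two (α := ℝ))
    have := Real.mul_self_sqrt pi_pos.le
    have : √lam ≠ 0 := by positivity
    field_simp
    nlinarith
  have hsymp : √2 * √lam * (√2 / √lam) = 2 := by
    have := Real.mul_self_sqrt (zero_le_two (α := ℝ))
    have : √lam ≠ 0 := by positivity
    field_simp
    linarith
  refine ⟨rectangularState_ne_zero hl h, fun i => Pi.single i (d i), ?_, ?_, ?_⟩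
  · rw [Fintype.linearIndependent_iff]
    intro g hg i
    have h1 := congrFun hg i
    simp only [Finset.sum_apply, Pi.smul_apply, smul_eq_mul, Pi.single_apply, mul_ite, mul_zero,
      Finset.sum_ite_eq, Finset.mem_univ, if_true, Pi.zero_apply] at h1
    exact (mul_eq_zero.1 h1).resolve_right (hd0 i)
  · rintro (i | i) (j | j) <;> obtain rfl := Subsingleton.elim i 0 <;>
      obtain rfl := Subsingleton.elim j 0
    · exact ⟨0, by simp [symplecticProduct]⟩
    · exact ⟨2, by simp [symplecticProduct, hd, hsymp]⟩
    · exact ⟨-2, by simp [symplecticProduct, hd, mul_comm (√2 / √lam), hsymp]⟩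
    · exact ⟨0, by simp [symplecticProduct]⟩
  · rintro (i | i) f <;> obtain rfl := Subsingleton.elim i 0
    · refine (hrect _).unique ?_
      have h1 := hrect f
      rw [← (Equiv.addRight (2 : ℤ)).hasSum_iff] at h1
      refine h1.congr_fun fun n => ?_
      have h2 : (n : ℝ) * √(lam * π) + √(2 * π) * d (Sum.inl 0) = (n + 2 : ℤ) * √(lam * π) := by
        rw [show d (Sum.inl 0) = √2 * √lam from rfl, hshift]
        push_cast
        ring
      rw [displace_neg_single_inl, h2]
      exact congrArg (· * _) (gridAmp_add_two α β n).symm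
    · refine (hrect _).unique ?_
      refine (hrect f).congr_fun fun n => ?_
      have h2 : √(2 * π) * d (Sum.inr 0) * (n * √(lam * π)) = n * (2 * π) := by
        rw [show d (Sum.inr 0) = √2 / √lam from rfl]
        linear_combination (n : ℝ) * hphase
      have h3 : Complex.exp ((-(n * (2 * π)) : ℝ) * Complex.I) = 1 := by
        rw [Complex.exp_eq_one_iff]
        exact ⟨-n, by push_cast; ring⟩
      rw [displace_neg_single_inr, h2, h3, one_mul]

end Rectangular

/-! ### The biased Steane circuit -/

section Steane

theorem norm_gridAmp_one_one (n : ℤ) : gridAmp 1 1 n = 1 := by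
  simp [gridAmp]

theorem summable_point₂ {a b : ℝ} (ha : 0 < a) (hb : 0 < b) :
    Summable fun n : ℤ × ℤ => ((1 + ‖point₂ (n.1 * a) (n.2 * b)‖) ^ 4)⁻¹ := by
  have h := (summable_int_mul ha).mul_of_nonneg (summable_int_mul hb)
    (fun n => by positivity) fun n => by positivity
  refine h.of_nonneg_of_le (fun n => by positivity) fun n => ?_
  rw [← mul_inv]
  have h1 : |(n.1 : ℝ) * a| ≤ ‖point₂ (n.1 * a) (n.2 * b)‖ := by
    simpa using PiLp.norm_apply_le (point₂ (n.1 * a) (n.2 * b)) (Sum.inl 0)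
  have h2 : |(n.2 : ℝ) * b| ≤ ‖point₂ (n.1 * a) (n.2 * b)‖ := by
    simpa using PiLp.norm_apply_le (point₂ (n.1 * a) (n.2 * b)) (Sum.inr 0)
  refine inv_anti₀ (by positivity) ?_
  calc (1 + |(n.1 : ℝ) * a|) ^ 2 * (1 + |(n.2 : ℝ) * b|) ^ 2
      ≤ (1 + ‖point₂ (n.1 * a) (n.2 * b)‖) ^ 2 * (1 + ‖point₂ (n.1 * a) (n.2 * b)‖) ^ 2 := by
        gcongr
    _ = _ := by ring

theorem tensor_point₂ (f g : Wave (Fin 1)) (x y : ℝ) :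
    (tensor f g : Wave (Modes 1)) (point₂ x y) = f (point x) * g (point y) := rfl

/-- The joint input `∑ₙₘ cₙ |n√π⟩_q ⊗ |m√(λπ)⟩_q` of the Steane circuit. -/
def steaneInput {lam : ℝ} (hl : 0 < lam) (α β : ℂ) : Ket (Modes 1) :=
  sampleKet (fun n : ℤ × ℤ => point₂ (n.1 * √(1 * π)) (n.2 * √(lam * π)))
    (fun n => gridAmp α β n.1) (fun n => norm_gridAmp_le α β n.1)
    (summable_point₂ (sqrt_mul_pi_pos one_pos) (sqrt_mul_pi_pos hl))

theorem hasSum_steaneInput {lam : ℝ} (hl : 0 < lam) (α β : ℂ) (F : Wave (Modes 1)) :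
    HasSum (fun n : ℤ × ℤ => gridAmp α β n.1 *
      conj (F (point₂ (n.1 * √(1 * π)) (n.2 * √(lam * π))))) (steaneInput hl α β F) :=
  hasSum_sampleKet (fun n : ℤ × ℤ => point₂ (n.1 * √(1 * π)) (n.2 * √(lam * π)))
    (fun n => gridAmp α β n.1) (fun n => norm_gridAmp_le α β n.1)
    (summable_point₂ (sqrt_mul_pi_pos one_pos) (sqrt_mul_pi_pos hl)) F

theorem steaneInput_tensor {lam : ℝ} (hl : 0 < lam) (α β : ℂ) (f g : Wave (Fin 1)) :
    steaneInput hl α β (tensor f g) =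
      rectangularState one_pos α β f * rectangularState hl 1 1 g := by
  have h := hasSum_steaneInput hl α β (tensor f g)
  refine h.unique (((isRectangularState_rectangularState one_pos α β f).mul
    (isRectangularState_rectangularState hl 1 1 g) ?_).congr_fun ?_)
  · refine h.summable.congr fun n => ?_
    rw [tensor_point₂, map_mul]
    simp [gridAmp, mul_assoc]
  · intro n
    rw [tensor_point₂, map_mul]
    simp [gridAmp, mul_assoc]

/-- The homodyne outcomes of the noiseless Steane circuit. -/
def steaneOutcomes : Set (Conf (Fin 1)) := Set.range fun n : ℤ => point (n * √(1 * π))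

theorem le_dist_point {a : ℝ} (ha : 0 < a) {n n' : ℤ} (h : n ≠ n') :
    a ≤ dist (point (n * a)) (point (n' * a)) := by
  rw [dist_eq_norm, point_sub, norm_point, ← sub_mul, abs_mul, abs_of_pos ha]
  have h4 : (1 : ℝ) ≤ |(n : ℝ) - n'| := by
    exact_mod_cast Int.one_le_abs (sub_ne_zero.2 h)
  exact le_mul_of_one_le_left ha.le h4

theorem injective_point_mul {a : ℝ} (ha : 0 < a) :
    Function.Injective fun n : ℤ => point (n * a) := by
  intro n n' h
  by_contra hne
  have h1 := le_dist_point ha hne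
  rw [show point (n * a) = point (n' * a) from h, dist_self] at h1
  exact ha.not_ge h1

/-- The unitary maps the grid of the input to the grid `{(n√π, l√π)}`, whose points have the
amplitudes of the data state, independently of the ancilla position `l√π`. -/
theorem steaneInput_symm_tensor {lam : ℝ} (hl : 0 < lam) (α β : ℂ) (f g : Wave (Fin 1)) :
    steaneInput hl α β ((steaneUnitary √lam (Real.sqrt_pos.2 hl)).symm (tensor f g)) =
      (√√lam : ℂ)⁻¹ * (rectangularState one_pos α β f * rectangularState one_pos 1 1 g) := by
  have hs := Real.sqrt_pos.2 hl
  have h := hasSum_steaneInput hl α β ((steaneUnitary √lam hs).symm (tensor f g))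
  let e : ℤ × ℤ ≃ ℤ × ℤ :=
    { toFun := fun n => (n.1, n.2 - n.1)
      invFun := fun n => (n.1, n.2 + n.1)
      left_inv := fun n => by simp
      right_inv := fun n => by simp }
  rw [← e.hasSum_iff] at h
  have hterm : ∀ n : ℤ × ℤ, ((fun n : ℤ × ℤ => gridAmp α β n.1 *
      conj ((steaneUnitary √lam hs).symm (tensor f g)
        (point₂ (n.1 * √(1 * π)) (n.2 * √(lam * π))))) ∘ e) n =
      (√√lam : ℂ)⁻¹ * ((gridAmp α β n.1 * conj (f (point (n.1 * √(1 * π))))) *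
        (gridAmp 1 1 n.2 * conj (g (point (n.2 * √(1 * π)))))) := by
    intro n
    have h1 : (n.1 : ℝ) * √(1 * π) + (√lam)⁻¹ * ((n.2 - n.1 : ℤ) * √(lam * π)) = n.2 * √(1 * π) := by
      rw [Real.sqrt_mul hl.le, one_mul]
      push_cast
      field_simp
      ring
    have h2 : (e n) = (n.1, n.2 - n.1) := rfl
    rw [Function.comp_apply, h2, steaneUnitary_symm_apply, steaneMap_symm_apply, point₂_inl,
      point₂_inr, h1, tensor_point₂, norm_gridAmp_one_one]
    simp only [map_mul, map_inv₀, Complex.conj_ofReal]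
    ring
  rw [funext hterm] at h
  have hne : (√√lam : ℂ)⁻¹ ≠ 0 :=
    inv_ne_zero (Complex.ofReal_ne_zero.2 (Real.sqrt_pos.2 hs).ne')
  have hprod := (isRectangularState_rectangularState one_pos α β f).mul
    (isRectangularState_rectangularState one_pos 1 1 g)
    ((summable_mul_left_iff hne).1 h.summable)
  exact h.unique (hprod.mul_left _)

/-- The biased Steane circuit. -/
def steaneCircuit {lam : ℝ} (hl : 0 < lam) {α β : ℂ} (h : α ≠ 0 ∨ β ≠ 0) :
    SyndromeCircuit 1 (steaneMatrix √lam) where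
  U := steaneUnitary √lam (Real.sqrt_pos.2 hl)
  gaussian := isGaussianUnitary_steaneUnitary (Real.sqrt_pos.2 hl)
  data := rectangularState one_pos α β
  data_gkp := isGKPState_rectangularState one_pos h
  ancilla := rectangularState hl 1 1
  ancilla_gkp := isGKPState_rectangularState hl (Or.inl one_ne_zero)
  input := steaneInput hl α β
  input_tensor := steaneInput_tensor hl α β
  outcomes := steaneOutcomes
  outcomes_nonempty := Set.range_nonempty _
  outcomes_separated := by
    refine ⟨√(1 * π), sqrt_mul_pi_pos one_pos, ?_⟩
    rintro _ ⟨n, rfl⟩ _ ⟨n', rfl⟩ hne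
    exact le_dist_point (sqrt_mul_pi_pos one_pos) fun h => hne (by rw [h])
  amp := fun _ => (√√lam : ℂ)⁻¹
  amp_ne_zero := fun _ _ =>
    inv_ne_zero (Complex.ofReal_ne_zero.2 (Real.sqrt_pos.2 (Real.sqrt_pos.2 hl)).ne')
  shift := fun _ => 0
  noiseless := fun f g => by
    rw [steaneInput_symm_tensor, ← mul_assoc]
    refine (Equiv.hasSum_iff
      (Equiv.ofInjective _ (injective_point_mul (sqrt_mul_pi_pos one_pos)))).1 ?_
    refine ((isRectangularState_rectangularState one_pos 1 1 g).mul_left _).congr_fun fun n => ?_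
    simp only [neg_zero, displace_zero, ite_self]
    rw [one_mul (conj _)]
    rfl

theorem isBiasedSteane_steaneCircuit {lam : ℝ} (hl : 0 < lam) {α β : ℂ} (h : α ≠ 0 ∨ β ≠ 0) :
    (steaneCircuit hl h).IsBiasedSteane lam α β where
  unitary f x y := by
    have h1 : √√lam = lam ^ (1 / 4 : ℝ) := by
      rw [Real.sqrt_eq_rpow, Real.sqrt_eq_rpow, ← Real.rpow_mul hl.le]
      norm_num
    rw [← h1]
    rfl
  data := isRectangularState_rectangularState one_pos α β
  ancilla := isRectangularState_rectangularState hl 1 1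

theorem smul_residualCov_steaneMatrix {lam : ℝ} (hl : 0 < lam) (Δ : ℝ) :
    Δ ^ 2 • residualCov (steaneMatrix √lam) =
      biasedCovariance (Δ / √(1 + lam)) (√(1 + lam) * Δ) := by
  rw [residualCov_steaneMatrix (Real.sqrt_pos.2 hl), biasedCovariance, ← Matrix.diagonal_smul,
    Real.sq_sqrt hl.le]
  congr 1
  funext i
  have h1 : √(1 + lam) ^ 2 = 1 + lam := Real.sq_sqrt (by positivity)
  rcases i with i | i
  · change Δ ^ 2 * (1 + lam)⁻¹ = (Δ / √(1 + lam)) ^ 2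
    rw [div_pow, h1, div_eq_mul_inv]
  · simp [mul_pow, h1, mul_comm]

end Steane

end GKPNoGo

end

open GKPNoGo in
theorem theoremC1 :
    (∀ (N : ℕ) (S : Matrix (Modes N ⊕ Modes N) (Modes N ⊕ Modes N) ℝ),
      S ∈ Matrix.symplecticGroup (Modes N) ℝ →
      ∃ Sig : Matrix (Fin 1 ⊕ Fin 1) (Fin 1 ⊕ Fin 1) ℝ, Sig.PosDef ∧ Sig.det = 1 ∧
        ∀ (C : SyndromeCircuit N S) (Δ : ℝ), 0 < Δ →
        ∀ (D : Conf (Fin N) → Phase (Fin 1)) (m : Conf (Fin N)),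
          (∃ M : GaussianMixture (Δ ^ 2 • Sig),
            C.HasResidualError Δ D m M.density ∧ HasFiniteVariance M.density) ∧
          ∀ M : GaussianMixture (Δ ^ 2 • Sig),
            C.HasResidualError Δ D m M.density → HasFiniteVariance M.density →
              Δ ^ 4 ≤ (covarianceMatrix M.density).det ∧
              Δ ^ 2 ≤ spreadQ M.density * spreadP M.density) ∧
    (∀ (lam : ℝ), 0 < lam → ∀ α β : ℂ, (α ≠ 0 ∨ β ≠ 0) →
      ∃ S ∈ Matrix.symplecticGroup (Modes 1) ℝ, ∃ C : SyndromeCircuit 1 S,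
        C.IsBiasedSteane lam α β ∧
        ∀ Δ : ℝ, 0 < Δ → ∀ (D : Conf (Fin 1) → Phase (Fin 1)) (m : Conf (Fin 1)),
          ∃ Δq Δp : ℝ, Δq = Δ / √(1 + lam) ∧ Δp = √(1 + lam) * Δ ∧ Δq * Δp = Δ ^ 2 ∧
            ∃ M : GaussianMixture (biasedCovariance Δq Δp),
              C.HasResidualError Δ D m M.density ∧ HasFiniteVariance M.density) := by
  refine ⟨fun N S hS => ?_, fun lam hl α β h => ?_⟩
  · obtain ⟨hpos, hdet⟩ := residualCov_posDef_and_det hS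
    exact ⟨residualCov S, hpos, hdet, fun C Δ hΔ D m => ⟨C.exists_gaussianMixture hS hΔ D m,
      fun M _ hM => le_det_covarianceMatrix hpos hdet hΔ M hM⟩⟩
  · have hS := steaneMatrix_mem_symplecticGroup (Real.sqrt_pos.2 hl).ne'
    refine ⟨_, hS, steaneCircuit hl h, isBiasedSteane_steaneCircuit hl h, fun Δ hΔ D m =>
      ⟨_, _, rfl, rfl, ?_, ?_⟩⟩
    · have : √(1 + lam) ≠ 0 := by positivity
      field_simp
    · rw [← smul_residualCov_steaneMatrix hl]
      exact (steaneCircuit hl h).exists_gaussianMixture hS hΔ D m
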